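/- Let $G$ be a compact connected semisimple Lie group, $T \subset G$ a Cartan subgroup (maximal torus) with Lie algebra $\mathfrak t$, and let $K = \{g \in G : \mathrm{Ad}(g)\xi = \xi\}$ be the stabilizer, under the adjoint action, of an element $\xi \in \mathfrak t$. Let $T$ act on $M = G/K$ by left multiplication, and let $\Gamma$ be the GKM graph of $M$: its vertices are the zero-dimensional orbits in the orbit space $M/T$, its edges are the connected components of the set of one-dimensional orbits in $M/T$, and an edge joins the zero-dimensional orbits which lie in its closure. Then $\Gamma$ is a graph (the closure of each edge contains exactly two zero-dimensional orbits), and it is simple, i.e. any two vertices are joined by at most one edge. -/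

import Mathlib

open scoped Manifold ContDiff

noncomputable section

section LieTheory

variable {E : Type*} [NormedAddCommGroup E] [NormedSpace ℝ E]
  {G : Type*} [TopologicalSpace G] [ChartedSpace E G] [Group G]

variable (E) in
/-- The derivative at `1` of the conjugation `x ↦ g * x * g⁻¹`, as an endomorphism of the Lie
algebra `T₁G`. -/
def lieAd (g : G) :
    GroupLieAlgebra 𝓘(ℝ, E) G →L[ℝ] GroupLieAlgebra 𝓘(ℝ, E) G :=
  (mfderiv 𝓘(ℝ, E) 𝓘(ℝ, E) (fun x : G => g * x * g⁻¹) 1 : E →L[ℝ] E)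

theorem lieAd_one : lieAd E (1 : G) = ContinuousLinearMap.id ℝ _ := by
  have h : (fun x : G => 1 * x * 1⁻¹) = id := by ext x; simp
  unfold lieAd
  rw [h]
  exact mfderiv_id

theorem lieAd_mul [LieGroup 𝓘(ℝ, E) ∞ G] (g h : G) :
    lieAd E (g * h) = (lieAd E g).comp (lieAd E h) := by
  have hd : ∀ (a b : G), MDifferentiableAt 𝓘(ℝ, E) 𝓘(ℝ, E) (fun x : G => a * x * a⁻¹) b := by
    intro a b
    have hs : ContMDiff 𝓘(ℝ, E) 𝓘(ℝ, E) ∞ (fun x : G => a * x * a⁻¹) :=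
      (contMDiff_mul_right (a := a⁻¹)).comp (contMDiff_mul_left (a := a))
    exact hs.contMDiffAt.mdifferentiableAt (by simp)
  have hc : (fun x : G => g * h * x * (g * h)⁻¹) =
      (fun x : G => g * x * g⁻¹) ∘ (fun x : G => h * x * h⁻¹) := by
    ext x; simp [mul_assoc]
  have h1 : h * 1 * h⁻¹ = 1 := by simp
  have key := mfderiv_comp (I := 𝓘(ℝ, E)) (I' := 𝓘(ℝ, E)) (I'' := 𝓘(ℝ, E)) (1 : G)
    (hd g (h * 1 * h⁻¹)) (hd h 1)
  unfold lieAd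
  rw [hc]
  refine key.trans ?_
  rw [h1]
  rfl

variable (E G) in
/-- The adjoint representation of a Lie group on its Lie algebra. -/
def adjointRep [LieGroup 𝓘(ℝ, E) ∞ G] :
    G →* (GroupLieAlgebra 𝓘(ℝ, E) G →L[ℝ] GroupLieAlgebra 𝓘(ℝ, E) G) where
  toFun := lieAd E
  map_one' := lieAd_one
  map_mul' := lieAd_mul

/-- The stabilizer in `G` of an element `ξ` of the Lie algebra, under the adjoint action. -/
def adjointStabilizer [LieGroup 𝓘(ℝ, E) ∞ G] (ξ : GroupLieAlgebra 𝓘(ℝ, E) G) : Subgroup G where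
  carrier := {g | adjointRep E G g ξ = ξ}
  one_mem' := by simp
  mul_mem' := by
    intro a b (ha : _ = _) (hb : _ = _)
    simp [hb, ha]
  inv_mem' := by
    intro a (ha : _ = _)
    have h : adjointRep E G (a⁻¹ * a) ξ = ξ := by simp
    rw [map_mul] at h
    simpa [ha] using h

variable (E) in
/-- The Lie algebra of a closed subgroup `H` of `G`, spanned by (in fact equal to) the set of
velocity vectors at `1` of the one-parameter subgroups of `G` contained in `H`. -/
def subgroupLieAlgebra (H : Subgroup G) : Submodule ℝ (GroupLieAlgebra 𝓘(ℝ, E) G) :=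
  Submodule.span ℝ {v : E | ∃ γ : ℝ → G,
    ContMDiff 𝓘(ℝ, ℝ) 𝓘(ℝ, E) ∞ γ ∧ (∀ s t, γ (s + t) = γ s * γ t) ∧ (∀ s, γ s ∈ H) ∧
    (mfderiv 𝓘(ℝ, ℝ) 𝓘(ℝ, E) γ 0 : ℝ →L[ℝ] E) 1 = v}

variable (E G) in
/-- A Lie group is semisimple if its Lie algebra is. -/
def IsSemisimpleLieGroup [LieGroup 𝓘(ℝ, E) ∞ G] [FiniteDimensional ℝ E] : Prop :=
  haveI : CompleteSpace E := FiniteDimensional.complete ℝ E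
  haveI : LieGroup 𝓘(ℝ, E) (minSmoothness ℝ 3) G :=
    LieGroup.of_le (n := ∞) (by simp only [minSmoothness_of_isRCLikeNormedField]; norm_cast)
  LieAlgebra.IsSemisimple ℝ (GroupLieAlgebra 𝓘(ℝ, E) G)

/-- A torus in a compact Lie group: a closed connected commutative subgroup (equivalently, a closed
subgroup isomorphic to a product of circles). -/
structure IsTorusSubgroup {G : Type*} [TopologicalSpace G] [Group G] (T : Subgroup G) : Prop where
  isClosed : IsClosed (T : Set G)
  isConnected : IsConnected (T : Set G)
  mul_comm : ∀ x ∈ T, ∀ y ∈ T, x * y = y * x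

/-- A Cartan subgroup of a compact connected Lie group: a maximal torus. -/
def IsCartanSubgroup {G : Type*} [TopologicalSpace G] [Group G] (T : Subgroup G) : Prop :=
  Maximal IsTorusSubgroup T

end LieTheory

section GKM

variable (E : Type*) [NormedAddCommGroup E] [NormedSpace ℝ E]
  {G : Type*} [TopologicalSpace G] [ChartedSpace E G] [Group G]
  (T : Subgroup G) (M : Type*) [TopologicalSpace M] [MulAction T M]

/-- The orbit space `M/T` with the quotient topology. -/
abbrev OrbitSpace : Type _ := Quotient (MulAction.orbitRel T M)

/-- The set of `k`-dimensional `T`-orbits, as a subset of `M/T`. The orbit through `p` is `T/T_p`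
with `T_p` the stabilizer, so that it has dimension `k` exactly when `T_p` has codimension `k`
in `T`. -/
def orbitsOfDim (k : ℕ) : Set (OrbitSpace T M) :=
  {x | ∃ p : M, (Quotient.mk (MulAction.orbitRel T M) p) = x ∧
    Module.finrank ℝ (subgroupLieAlgebra E ((MulAction.stabilizer T p).map T.subtype)) + k =
      Module.finrank ℝ (subgroupLieAlgebra E T)}

/-- `C` is a connected component of the set of one-dimensional orbits in `M/T`. -/
def IsOneDimComponent (C : Set (OrbitSpace T M)) : Prop :=
  ∃ x ∈ orbitsOfDim E T M 1, C = connectedComponentIn (orbitsOfDim E T M 1) x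

/-- The GKM graph of a `T`-space `M`. The vertices are the zero-dimensional orbits, and the edges
are the connected components of the set of one-dimensional orbits; an edge joins `x` and `y` if
`x` and `y` are exactly the zero-dimensional orbits in its closure in `M/T`. -/
def gkmGraph : Graph (OrbitSpace T M) (Set (OrbitSpace T M)) where
  vertexSet := orbitsOfDim E T M 0
  IsLink C x y := IsOneDimComponent E T M C ∧ closure C ∩ orbitsOfDim E T M 0 = {x, y}
  isLink_symm := fun _ _ => ⟨fun x y h => ⟨h.1, by rw [h.2, Set.pair_comm]⟩⟩
  eq_or_eq_of_isLink_of_isLink := by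
    rintro C x y v w ⟨-, h⟩ ⟨-, h'⟩
    have hx : x ∈ ({v, w} : Set (OrbitSpace T M)) := by rw [← h', h]; simp
    simpa using hx
  left_mem_of_isLink := by
    rintro C x y ⟨-, h⟩
    have hx : x ∈ closure C ∩ orbitsOfDim E T M 0 := by rw [h]; simp
    exact hx.2

end GKM

end

open scoped Topology InnerProductSpace
open VectorField Filter

noncomputable section

set_option linter.unusedSectionVars false

/-! ### Multiplication of the group in a chart at the identity -/

section LieGroupChart

variable {E : Type*} [NormedAddCommGroup E] [NormedSpace ℝ E]
  {G : Type*} [TopologicalSpace G] [ChartedSpace E G] [Group G]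

/-! The map `gK ↦ Ad(g)ξ` identifies `G/K` equivariantly with the adjoint orbit `O` of `ξ`, inside
the Lie algebra with an `Ad`-invariant inner product. All the geometry takes place there and is
described by the infinitesimal isotropy `t_v = {x ∈ t : [x, v] = 0}`, without a root space
decomposition or a Weyl group.

Since `t` is its own centralizer (`mem_of_ad_eq_zero`), the zero-dimensional orbits are the points
of `O ∩ t`. If the orbit of `v` is one-dimensional, then `a = t_v` is a hyperplane of `t`, with unit
normal `h`, and `v` centralizes `a`. Maximizing and minimizing the height `⟪Ad(g)v, h⟫` over the `g`
fixing `a` pointwise moves `v` to points `p + r h` and `p - r h` of `t`, with `p ∈ a` and `r > 0`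
(`exists_Ad_mem`, `exists_rootSphere`). So `v` lies on a sphere with these two poles, consisting of
the elements of the centralizer of `a` that have the same projection to `a` and the same norm; the
whole sphere lies in `O`.

The sphere without its poles is connected, because the directions orthogonal to `t` have dimension
at least two (`one_lt_rank_rootSpace`). It is also relatively clopen in the one-dimensional stratum
(`exists_isOpen_rootSphere`); openness uses that `O ∩ t` is finite (`finite_orbit_inter`), which
follows from a spectral gap between commuting elements of an adjoint orbit. Hence the edges are the
images of these punctured spheres, and the zero-dimensional orbits in the closure of an edge are the
two poles. The poles determine the edge: their midpoint is `p`, half their difference is `r h` up to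
sign, and `a` is the orthogonal complement of `h` in `t`.

The long preparation extracts the required Lie theory into `AdjointData`: `Ad` with derivative the
bracket, one-parameter subgroups, an invariant inner product, and inner derivations. -/

theorem extChartAt_one_symm_self :
    (extChartAt 𝓘(ℝ, E) (1 : G)).symm (extChartAt 𝓘(ℝ, E) (1 : G) 1) = 1 := by simp

variable (E G) in
/-- The multiplication of a Lie group, read in the preferred chart at `1`. -/
def chartMul (p : E × E) : E :=
  extChartAt 𝓘(ℝ, E) (1 : G) ((extChartAt 𝓘(ℝ, E) (1 : G)).symm p.1 *
    (extChartAt 𝓘(ℝ, E) (1 : G)).symm p.2)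

variable [LieGroup 𝓘(ℝ, E) ∞ G]

theorem contMDiffAt_extChartAt_one_symm {a : E} (ha : a ∈ (extChartAt 𝓘(ℝ, E) (1 : G)).target) :
    ContMDiffAt 𝓘(ℝ, E) 𝓘(ℝ, E) ∞ (extChartAt 𝓘(ℝ, E) (1 : G)).symm a :=
  (contMDiffOn_extChartAt_symm (1 : G)).contMDiffAt ((isOpen_extChartAt_target (1 : G)).mem_nhds ha)

theorem contDiffAt_chartMul {a b : E} (ha : a ∈ (extChartAt 𝓘(ℝ, E) (1 : G)).target)
    (hb : b ∈ (extChartAt 𝓘(ℝ, E) (1 : G)).target)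
    (hab : (extChartAt 𝓘(ℝ, E) (1 : G)).symm a * (extChartAt 𝓘(ℝ, E) (1 : G)).symm b ∈
      (chartAt E (1 : G)).source) :
    ContDiffAt ℝ ∞ (chartMul E G) (a, b) := by
  rw [← contMDiffAt_iff_contDiffAt]
  have h1 : ContMDiffAt 𝓘(ℝ, E × E) 𝓘(ℝ, E) ∞
      (fun p : E × E => (extChartAt 𝓘(ℝ, E) (1 : G)).symm p.1) (a, b) :=
    (contMDiffAt_extChartAt_one_symm ha).comp (a, b) contDiff_fst.contMDiff.contMDiffAt
  have h2 : ContMDiffAt 𝓘(ℝ, E × E) 𝓘(ℝ, E) ∞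
      (fun p : E × E => (extChartAt 𝓘(ℝ, E) (1 : G)).symm p.2) (a, b) :=
    (contMDiffAt_extChartAt_one_symm hb).comp (a, b) contDiff_snd.contMDiff.contMDiffAt
  exact (contMDiffAt_extChartAt' (x := (1 : G)) hab).comp (a, b) (h1.mul h2)

theorem mfderiv_extChartAt_one_symm :
    mfderiv 𝓘(ℝ, E) 𝓘(ℝ, E) (extChartAt 𝓘(ℝ, E) (1 : G)).symm (extChartAt 𝓘(ℝ, E) (1 : G) 1) =
      ContinuousLinearMap.id ℝ E := by
  have : IsManifold 𝓘(ℝ, E) 1 G := IsManifold.of_le (n := ∞) (by simp)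
  have := mfderivWithin_range_extChartAt_symm (I := 𝓘(ℝ, E)) (x := (1 : G))
  rwa [ModelWithCorners.range_eq_univ, mfderivWithin_univ] at this

/-- The partial derivative of the multiplication in the chart, in the second variable. -/
theorem fderiv_chartMul_inr {a : E} (ha : a ∈ (extChartAt 𝓘(ℝ, E) (1 : G)).target) (y : E) :
    fderiv ℝ (chartMul E G) (a, extChartAt 𝓘(ℝ, E) (1 : G) 1) (0, y) =
      (mfderiv 𝓘(ℝ, E) 𝓘(ℝ, E) (extChartAt 𝓘(ℝ, E) (1 : G))
        ((extChartAt 𝓘(ℝ, E) (1 : G)).symm a) : E →L[ℝ] E)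
      ((mfderiv 𝓘(ℝ, E) 𝓘(ℝ, E) (fun x : G => (extChartAt 𝓘(ℝ, E) (1 : G)).symm a * x) 1 :
        E →L[ℝ] E) y) := by
  have : IsManifold 𝓘(ℝ, E) 1 G := IsManifold.of_le (n := ∞) (by simp)
  set φ := extChartAt 𝓘(ℝ, E) (1 : G) with hφ
  have he : φ 1 ∈ φ.target := mem_extChartAt_target (1 : G)
  have hs : φ.symm a ∈ (chartAt E (1 : G)).source := by
    have := φ.map_target ha
    rwa [hφ, extChartAt_source] at this
  have hm : ContDiffAt ℝ ∞ (chartMul E G) (a, φ 1) := by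
    refine contDiffAt_chartMul ha he ?_
    rw [extChartAt_one_symm_self, mul_one]; exact hs
  have h1 : HasFDerivAt (fun b : E => chartMul E G (a, b))
      ((fderiv ℝ (chartMul E G) (a, φ 1)).comp (ContinuousLinearMap.inr ℝ E E)) (φ 1) :=
    (hm.differentiableAt (by simp)).hasFDerivAt.comp (φ 1) (hasFDerivAt_prodMk_right a (φ 1))
  have h2 : HasMFDerivAt 𝓘(ℝ, E) 𝓘(ℝ, E) φ.symm (φ 1) (ContinuousLinearMap.id ℝ E) := by
    have := ((contMDiffAt_extChartAt_one_symm he).mdifferentiableAt (by simp)).hasMFDerivAt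
    rwa [mfderiv_extChartAt_one_symm] at this
  have h3 : HasMFDerivAt 𝓘(ℝ, E) 𝓘(ℝ, E) (fun x : G => φ.symm a * x) (φ.symm (φ 1))
      (mfderiv 𝓘(ℝ, E) 𝓘(ℝ, E) (fun x : G => φ.symm a * x) (φ.symm (φ 1))) :=
    ((contMDiff_mul_left (n := ∞)).contMDiffAt.mdifferentiableAt (by simp)).hasMFDerivAt
  have h4 : HasMFDerivAt 𝓘(ℝ, E) 𝓘(ℝ, E) φ (φ.symm a * φ.symm (φ 1))
      (mfderiv 𝓘(ℝ, E) 𝓘(ℝ, E) φ (φ.symm a * φ.symm (φ 1))) := by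
    refine (mdifferentiableAt_extChartAt ?_).hasMFDerivAt
    rw [extChartAt_one_symm_self, mul_one]; exact hs
  have h5 := (HasMFDerivAt.comp (φ 1) h4 (HasMFDerivAt.comp (φ 1) h3 h2)).hasFDerivAt
  have h6 := h1.unique h5
  have h7 := congrArg (fun f : E →L[ℝ] E => f y) h6
  rw [extChartAt_one_symm_self, mul_one] at h7
  exact h7

/-- The partial derivative of the multiplication in the chart, in the first variable. -/
theorem fderiv_chartMul_inl {a : E} (ha : a ∈ (extChartAt 𝓘(ℝ, E) (1 : G)).target) (y : E) :
    fderiv ℝ (chartMul E G) (extChartAt 𝓘(ℝ, E) (1 : G) 1, a) (y, 0) =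
      (mfderiv 𝓘(ℝ, E) 𝓘(ℝ, E) (extChartAt 𝓘(ℝ, E) (1 : G))
        ((extChartAt 𝓘(ℝ, E) (1 : G)).symm a) : E →L[ℝ] E)
      ((mfderiv 𝓘(ℝ, E) 𝓘(ℝ, E) (fun x : G => x * (extChartAt 𝓘(ℝ, E) (1 : G)).symm a) 1 :
        E →L[ℝ] E) y) := by
  have : IsManifold 𝓘(ℝ, E) 1 G := IsManifold.of_le (n := ∞) (by simp)
  set φ := extChartAt 𝓘(ℝ, E) (1 : G) with hφ
  have he : φ 1 ∈ φ.target := mem_extChartAt_target (1 : G)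
  have hs : φ.symm a ∈ (chartAt E (1 : G)).source := by
    have := φ.map_target ha
    rwa [hφ, extChartAt_source] at this
  have hm : ContDiffAt ℝ ∞ (chartMul E G) (φ 1, a) := by
    refine contDiffAt_chartMul he ha ?_
    rw [extChartAt_one_symm_self, one_mul]; exact hs
  have h1 : HasFDerivAt (fun b : E => chartMul E G (b, a))
      ((fderiv ℝ (chartMul E G) (φ 1, a)).comp (ContinuousLinearMap.inl ℝ E E)) (φ 1) :=
    (hm.differentiableAt (by simp)).hasFDerivAt.comp (f := fun b : E => (b, a)) (φ 1)
      (hasFDerivAt_prodMk_left (φ 1) a)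
  have h2 : HasMFDerivAt 𝓘(ℝ, E) 𝓘(ℝ, E) φ.symm (φ 1) (ContinuousLinearMap.id ℝ E) := by
    have := ((contMDiffAt_extChartAt_one_symm he).mdifferentiableAt (by simp)).hasMFDerivAt
    rwa [mfderiv_extChartAt_one_symm] at this
  have h3 : HasMFDerivAt 𝓘(ℝ, E) 𝓘(ℝ, E) (fun x : G => x * φ.symm a) (φ.symm (φ 1))
      (mfderiv 𝓘(ℝ, E) 𝓘(ℝ, E) (fun x : G => x * φ.symm a) (φ.symm (φ 1))) :=
    ((contMDiff_mul_right (n := ∞)).contMDiffAt.mdifferentiableAt (by simp)).hasMFDerivAt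
  have h4 : HasMFDerivAt 𝓘(ℝ, E) 𝓘(ℝ, E) φ (φ.symm (φ 1) * φ.symm a)
      (mfderiv 𝓘(ℝ, E) 𝓘(ℝ, E) φ (φ.symm (φ 1) * φ.symm a)) := by
    refine (mdifferentiableAt_extChartAt ?_).hasMFDerivAt
    rw [extChartAt_one_symm_self, one_mul]; exact hs
  have h5 := (HasMFDerivAt.comp (φ 1) h4 (HasMFDerivAt.comp (φ 1) h3 h2)).hasFDerivAt
  have h6 := h1.unique h5
  have h7 := congrArg (fun f : E →L[ℝ] E => f y) h6
  rw [extChartAt_one_symm_self, one_mul] at h7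
  exact h7

end LieGroupChart

/-! ### The derivative of the adjoint representation is the bracket -/

section LieAdDeriv

variable {E : Type*} [NormedAddCommGroup E] [NormedSpace ℝ E]
  {G : Type*} [TopologicalSpace G] [ChartedSpace E G] [Group G] 

variable (E G) in
/-- Left-invariant vector fields in the chart at `1`: `chartLeft a y` is the value at `a` of the
field with value `y` at `1`. -/
def chartLeft (a : E) : E →L[ℝ] E :=
  (fderiv ℝ (chartMul E G) (a, extChartAt 𝓘(ℝ, E) (1 : G) 1)).comp (ContinuousLinearMap.inr ℝ E E)

variable (E G) in
/-- Right-invariant vector fields in the chart at `1`. -/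
def chartRight (a : E) : E →L[ℝ] E :=
  (fderiv ℝ (chartMul E G) (extChartAt 𝓘(ℝ, E) (1 : G) 1, a)).comp (ContinuousLinearMap.inl ℝ E E)

variable [LieGroup 𝓘(ℝ, E) ∞ G]

/-- From `g x = (g x g⁻¹) g`: left translation by `g` is conjugation by `g` followed by right
translation. Differentiating this relation in `g` is what links `Ad` to the bracket. -/
theorem chartRight_comp_lieAd {a : E} (ha : a ∈ (extChartAt 𝓘(ℝ, E) (1 : G)).target) :
    (chartRight E G a).comp (lieAd E ((extChartAt 𝓘(ℝ, E) (1 : G)).symm a)) = chartLeft E G a := by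
  ext y
  set g := (extChartAt 𝓘(ℝ, E) (1 : G)).symm a with hg
  have h1 : HasMFDerivAt 𝓘(ℝ, E) 𝓘(ℝ, E) (fun x : G => g * x * g⁻¹) 1
      (mfderiv 𝓘(ℝ, E) 𝓘(ℝ, E) (fun x : G => g * x * g⁻¹) 1) := by
    have hs : ContMDiff 𝓘(ℝ, E) 𝓘(ℝ, E) ∞ (fun x : G => g * x * g⁻¹) :=
      (contMDiff_mul_right (a := g⁻¹)).comp (contMDiff_mul_left (a := g))
    exact (hs.contMDiffAt.mdifferentiableAt (by simp)).hasMFDerivAt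
  have h2 : HasMFDerivAt 𝓘(ℝ, E) 𝓘(ℝ, E) (fun x : G => x * g) (g * 1 * g⁻¹)
      (mfderiv 𝓘(ℝ, E) 𝓘(ℝ, E) (fun x : G => x * g) (g * 1 * g⁻¹)) :=
    ((contMDiff_mul_right (n := ∞)).contMDiffAt.mdifferentiableAt (by simp)).hasMFDerivAt
  have h3 := (HasMFDerivAt.comp (1 : G) h2 h1).mfderiv
  have h4 : (fun x : G => x * g) ∘ (fun x : G => g * x * g⁻¹) = fun x => g * x := by
    ext x; simp
  rw [h4] at h3
  have h5 : g * 1 * g⁻¹ = 1 := by simp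
  rw [h5] at h3
  have h6 : (mfderiv 𝓘(ℝ, E) 𝓘(ℝ, E) (fun x : G => g * x) 1 : E →L[ℝ] E) y =
      (mfderiv 𝓘(ℝ, E) 𝓘(ℝ, E) (fun x : G => x * g) 1 : E →L[ℝ] E)
      ((lieAd E g : E →L[ℝ] E) y) := congrArg (fun f : E →L[ℝ] E => f y) h3
  have h7 := fderiv_chartMul_inl (G := G) ha ((lieAd E g : E →L[ℝ] E) y)
  have h8 := fderiv_chartMul_inr (G := G) ha y
  rw [← hg] at h7 h8
  rw [h6] at h8
  exact h7.trans h8.symm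

theorem contDiffAt_fderiv_chartMul :
    ContDiffAt ℝ ∞ (fderiv ℝ (chartMul E G))
      (extChartAt 𝓘(ℝ, E) (1 : G) 1, extChartAt 𝓘(ℝ, E) (1 : G) 1) := by
  have he := mem_extChartAt_target (I := 𝓘(ℝ, E)) (1 : G)
  refine (contDiffAt_chartMul he he ?_).fderiv_right (m := ∞) (by norm_cast)
  rw [extChartAt_one_symm_self, mul_one]
  exact mem_chart_source E 1

theorem contDiffOn_chartLeft :
    ContDiffOn ℝ ∞ (chartLeft E G) (extChartAt 𝓘(ℝ, E) (1 : G)).target := by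
  intro a ha
  refine ContDiffAt.contDiffWithinAt (ContDiffAt.clm_comp ?_ contDiffAt_const)
  refine ContDiffAt.comp (f := fun a : E => (a, extChartAt 𝓘(ℝ, E) (1 : G) 1)) a ?_
    (contDiffAt_id.prodMk contDiffAt_const)
  refine (contDiffAt_chartMul ha (mem_extChartAt_target (1 : G)) ?_).fderiv_right (m := ∞)
    (by norm_cast)
  rw [extChartAt_one_symm_self, mul_one]
  have := (extChartAt 𝓘(ℝ, E) (1 : G)).map_target ha
  rwa [extChartAt_source] at this

theorem contDiffAt_chartLeft :
    ContDiffAt ℝ ∞ (chartLeft E G) (extChartAt 𝓘(ℝ, E) (1 : G) 1) :=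
  contDiffOn_chartLeft.contDiffAt ((isOpen_extChartAt_target (1 : G)).mem_nhds
    (mem_extChartAt_target (1 : G)))

theorem contDiffAt_chartRight :
    ContDiffAt ℝ ∞ (chartRight E G) (extChartAt 𝓘(ℝ, E) (1 : G) 1) := by
  refine ContDiffAt.clm_comp ?_ contDiffAt_const
  exact contDiffAt_fderiv_chartMul.comp (f := fun a : E => (extChartAt 𝓘(ℝ, E) (1 : G) 1, a)) _
    (contDiffAt_const.prodMk contDiffAt_id)

theorem chartLeft_one : chartLeft E G (extChartAt 𝓘(ℝ, E) (1 : G) 1) = .id ℝ E := by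
  have : IsManifold 𝓘(ℝ, E) 1 G := IsManifold.of_le (n := ∞) (by simp)
  ext y
  have := fderiv_chartMul_inr (G := G) (mem_extChartAt_target (I := 𝓘(ℝ, E)) (1 : G)) y
  rw [extChartAt_one_symm_self, mfderiv_extChartAt_self] at this
  have h1 : (fun x : G => 1 * x) = id := by ext x; simp
  rw [h1] at this
  have h2 : mfderiv 𝓘(ℝ, E) 𝓘(ℝ, E) (id : G → G) 1 = ContinuousLinearMap.id ℝ E := mfderiv_id
  exact this.trans (congrArg (fun f : E →L[ℝ] E => f y) h2)

theorem chartRight_one : chartRight E G (extChartAt 𝓘(ℝ, E) (1 : G) 1) = .id ℝ E := by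
  have h := chartRight_comp_lieAd (E := E) (mem_extChartAt_target (I := 𝓘(ℝ, E)) (1 : G))
  rw [extChartAt_one_symm_self, lieAd_one, chartLeft_one] at h
  exact h

theorem fderiv_chartLeft_apply (x y : E) :
    fderiv ℝ (chartLeft E G) (extChartAt 𝓘(ℝ, E) (1 : G) 1) x y =
      fderiv ℝ (fderiv ℝ (chartMul E G))
        (extChartAt 𝓘(ℝ, E) (1 : G) 1, extChartAt 𝓘(ℝ, E) (1 : G) 1) (x, 0) (0, y) := by
  have h := ((contDiffAt_fderiv_chartMul (E := E) (G := G)).differentiableAt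
    (by simp)).hasFDerivAt.comp (f := fun a : E => (a, extChartAt 𝓘(ℝ, E) (1 : G) 1)) _
    (hasFDerivAt_prodMk_left _ _)
  have h2 := h.clm_comp (hasFDerivAt_const (ContinuousLinearMap.inr ℝ E E) _)
  have h3 : fderiv ℝ (chartLeft E G) (extChartAt 𝓘(ℝ, E) (1 : G) 1) = _ := h2.fderiv
  rw [h3]; simp

/-- Both sides are mixed second derivatives of the multiplication, taken in opposite orders. -/
theorem fderiv_chartRight_apply (x y : E) :
    fderiv ℝ (chartRight E G) (extChartAt 𝓘(ℝ, E) (1 : G) 1) x y =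
      fderiv ℝ (chartLeft E G) (extChartAt 𝓘(ℝ, E) (1 : G) 1) y x := by
  rw [fderiv_chartLeft_apply]
  have hsym : IsSymmSndFDerivAt ℝ (chartMul E G)
      (extChartAt 𝓘(ℝ, E) (1 : G) 1, extChartAt 𝓘(ℝ, E) (1 : G) 1) := by
    have he := mem_extChartAt_target (I := 𝓘(ℝ, E)) (1 : G)
    refine (contDiffAt_chartMul he he ?_).isSymmSndFDerivAt (by simp only [minSmoothness_of_isRCLikeNormedField]; norm_cast)
    rw [extChartAt_one_symm_self, mul_one]
    exact mem_chart_source E 1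
  rw [hsym.eq]
  have h := ((contDiffAt_fderiv_chartMul (E := E) (G := G)).differentiableAt
    (by simp)).hasFDerivAt.comp (f := fun a : E => (extChartAt 𝓘(ℝ, E) (1 : G) 1, a)) _
    (hasFDerivAt_prodMk_right _ _)
  have h2 := h.clm_comp (hasFDerivAt_const (ContinuousLinearMap.inl ℝ E E) _)
  have h3 : fderiv ℝ (chartRight E G) (extChartAt 𝓘(ℝ, E) (1 : G) 1) = _ := h2.fderiv
  rw [h3]; simp

theorem lieBracket_chartLeft (x y : E) :
    lieBracket ℝ (fun a => chartLeft E G a x) (fun a => chartLeft E G a y)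
      (extChartAt 𝓘(ℝ, E) (1 : G) 1) =
    fderiv ℝ (chartLeft E G) (extChartAt 𝓘(ℝ, E) (1 : G) 1) x y -
      fderiv ℝ (chartLeft E G) (extChartAt 𝓘(ℝ, E) (1 : G) 1) y x := by
  have hd : ∀ z : E, HasFDerivAt (fun a => chartLeft E G a z)
      ((fderiv ℝ (chartLeft E G) (extChartAt 𝓘(ℝ, E) (1 : G) 1)).flip z)
      (extChartAt 𝓘(ℝ, E) (1 : G) 1) := by
    intro z
    have h := ((contDiffAt_chartLeft (E := E) (G := G)).differentiableAt (by simp)).hasFDerivAt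
    have h2 := h.clm_apply (hasFDerivAt_const z _)
    convert h2 using 1
    ext; simp
  rw [lieBracket_eq]
  dsimp only
  rw [(hd x).fderiv, (hd y).fderiv, chartLeft_one]
  simp

/-- The bracket of the Lie algebra of a Lie group in the chart at `1`. -/
theorem lie_eq_fderiv_chartLeft (x y : GroupLieAlgebra 𝓘(ℝ, E) G) :
    (⁅x, y⁆ : GroupLieAlgebra 𝓘(ℝ, E) G) =
      (fderiv ℝ (chartLeft E G) (extChartAt 𝓘(ℝ, E) (1 : G) 1) (x : E) (y : E) -
      fderiv ℝ (chartLeft E G) (extChartAt 𝓘(ℝ, E) (1 : G) 1) (y : E) (x : E) : E) := by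
  have : IsManifold 𝓘(ℝ, E) 1 G := IsManifold.of_le (n := ∞) (by simp)
  rw [GroupLieAlgebra.bracket_def, ← mlieBracketWithin_univ, mlieBracketWithin_apply]
  have key : ∀ z : E, mpullbackWithin 𝓘(ℝ, E) 𝓘(ℝ, E) (extChartAt 𝓘(ℝ, E) (1 : G)).symm
      (mulInvariantVectorField (z : GroupLieAlgebra 𝓘(ℝ, E) G)) (Set.range 𝓘(ℝ, E)) =ᶠ[𝓝 (extChartAt 𝓘(ℝ, E) (1 : G) 1)] fun a => chartLeft E G a z := by
    intro z
    filter_upwards [(isOpen_extChartAt_target (I := 𝓘(ℝ, E)) (1 : G)).mem_nhds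
      (mem_extChartAt_target (1 : G))] with a ha
    have h1 := mfderiv_extChartAt_comp_mfderivWithin_extChartAt_symm (I := 𝓘(ℝ, E)) ha
    have h2 := mfderivWithin_extChartAt_symm_comp_mfderiv_extChartAt (I := 𝓘(ℝ, E)) ha
    rw [mpullbackWithin_apply, ContinuousLinearMap.inverse_eq h2 h1]
    exact (fderiv_chartMul_inr ha z).symm
  have h3 := Filter.EventuallyEq.lieBracket_vectorField_eq (𝕜 := ℝ) (key x) (key y)
  have h5 : (extChartAt 𝓘(ℝ, E) (1 : G)).symm ⁻¹' Set.univ ∩ Set.range 𝓘(ℝ, E) = Set.univ := by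
    simp
  have h6 : ∀ v : E, (mfderiv 𝓘(ℝ, E) 𝓘(ℝ, E) (extChartAt 𝓘(ℝ, E) (1 : G)) 1 :
      E →L[ℝ] E).inverse v = v := by
    intro v
    have h7 : (mfderiv 𝓘(ℝ, E) 𝓘(ℝ, E) (extChartAt 𝓘(ℝ, E) (1 : G)) 1 : E →L[ℝ] E) = .id ℝ E :=
      mfderiv_extChartAt_self
    have h9 : (ContinuousLinearMap.id ℝ E).inverse v = v := by
      rw [ContinuousLinearMap.inverse_id]; rfl
    exact (congrArg (fun f : E →L[ℝ] E => f.inverse v) h7).trans h9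
  have h8 : ∀ (s : Set E) (V W : E → E), s = Set.univ → lieBracketWithin ℝ V W s
      (extChartAt 𝓘(ℝ, E) (1 : G) 1) = lieBracket ℝ V W (extChartAt 𝓘(ℝ, E) (1 : G) 1) := by
    rintro s V W rfl
    rw [lieBracketWithin_univ]
  exact (h6 _).trans ((h8 _ _ _ h5).trans (h3.trans (lieBracket_chartLeft (E := E) (G := G) x y)))

variable [FiniteDimensional ℝ E]

/-- The derivative at `1` of the adjoint representation, in the chart at `1`. -/
theorem exists_hasFDerivAt_lieAd : ∃ D : E →L[ℝ] E →L[ℝ] E, 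
    HasFDerivAt (fun a => (lieAd E ((extChartAt 𝓘(ℝ, E) (1 : G)).symm a) : E →L[ℝ] E)) D
      (extChartAt 𝓘(ℝ, E) (1 : G) 1) ∧ 
    ∀ x y : GroupLieAlgebra 𝓘(ℝ, E) G, D x y = (⁅x, y⁆ : GroupLieAlgebra 𝓘(ℝ, E) G) := by
  have : CompleteSpace E := FiniteDimensional.complete ℝ E
  set e := extChartAt 𝓘(ℝ, E) (1 : G) 1 with he
  have hL := ((contDiffAt_chartLeft (E := E) (G := G)).differentiableAt (by simp)).hasFDerivAt
  have hR := ((contDiffAt_chartRight (E := E) (G := G)).differentiableAt (by simp)).hasFDerivAt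
  have hinv : DifferentiableAt ℝ (fun a => (chartRight E G a).inverse) e := by
    have h1 := contDiffAt_map_inverse (𝕜 := ℝ) (n := 1) (ContinuousLinearEquiv.refl ℝ E)
    have h2 : ((ContinuousLinearEquiv.refl ℝ E : E ≃L[ℝ] E) : E →L[ℝ] E) = chartRight E G e :=
      chartRight_one.symm
    rw [h2] at h1
    exact (h1.differentiableAt (by simp)).comp e hR.differentiableAt
  have hunit : ∀ᶠ a in 𝓝 e, (chartRight E G a).IsInvertible := by
    have h1 := ContinuousLinearEquiv.nhds (𝕜 := ℝ) (ContinuousLinearEquiv.refl ℝ E)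
    have h2 : ((ContinuousLinearEquiv.refl ℝ E : E ≃L[ℝ] E) : E →L[ℝ] E) = chartRight E G e :=
      chartRight_one.symm
    rw [h2] at h1
    filter_upwards [hR.continuousAt.preimage_mem_nhds h1] with a ⟨f, hf⟩
    exact ⟨f, hf⟩
  have htgt := (isOpen_extChartAt_target (I := 𝓘(ℝ, E)) (1 : G)).mem_nhds
      (mem_extChartAt_target (1 : G))
  set A : E → E →L[ℝ] E := fun a => lieAd E ((extChartAt 𝓘(ℝ, E) (1 : G)).symm a) with hA
  -- Near the identity the right-invariant frame is invertible, so `Ad` inherits differentiability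
  -- from the two frames.
  have hAeq : A =ᶠ[𝓝 e] fun a => (chartRight E G a).inverse.comp (chartLeft E G a) := by
    filter_upwards [hunit, htgt] with a ⟨f, hf⟩ ha
    have := chartRight_comp_lieAd (E := E) ha
    change (chartRight E G a).comp (A a) = _ at this
    rw [← this, ← hf, ContinuousLinearMap.inverse_equiv]
    ext; simp
  have hAd : DifferentiableAt ℝ A e :=
    (hinv.clm_comp hL.differentiableAt).congr_of_eventuallyEq hAeq
  have hAe : A e = .id ℝ E := by
    simp only [hA]
    rw [he, extChartAt_one_symm_self, lieAd_one]
    rfl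
  refine ⟨fderiv ℝ A e, hAd.hasFDerivAt, fun x y => ?_⟩
  -- Product rule for `R ∘ Ad = L` at the identity, where `R` and `Ad` are the identity map: `dAd =
  -- dL - dR`, and `dR` is `dL` with its arguments exchanged.
  have h1 := hR.clm_comp hAd.hasFDerivAt
  have h2 : (fun a => (chartRight E G a).comp (A a)) =ᶠ[𝓝 e] chartLeft E G := by
    filter_upwards [htgt] with a ha
    exact chartRight_comp_lieAd (E := E) ha
  have h3 := (hL.congr_of_eventuallyEq h2).unique h1
  have h4 : ∀ x y : E, fderiv ℝ A e x y =
      fderiv ℝ (chartLeft E G) e x y - fderiv ℝ (chartLeft E G) e y x := by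
    intro x y
    have h5 := congrArg (fun f : E →L[ℝ] E →L[ℝ] E => f x y) h3
    have h6 := fderiv_chartRight_apply (E := E) (G := G) x y
    have h7 : chartRight E G e = .id ℝ E := chartRight_one
    simp only [← he] at h5 h6
    rw [h7, hAe] at h5
    simp only [add_apply, ContinuousLinearMap.comp_apply,
      ContinuousLinearMap.compL_apply, ContinuousLinearMap.flip_apply,
      ContinuousLinearMap.id_apply] at h5
    rw [h5, ← h6]
    exact (add_sub_cancel_right _ _).symm
  exact (h4 x y).trans (lie_eq_fderiv_chartLeft x y).symm

end LieAdDeriv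

/-! ### Regularity of solutions of autonomous equations -/

section ODE

variable {E : Type*} [NormedAddCommGroup E] [NormedSpace ℝ E]

/-- Solutions of an autonomous ordinary differential equation with smooth right-hand side are
smooth. -/
theorem contDiffOn_of_hasDerivAt_comp {f : E → E} {U : Set E} (hf : ContDiffOn ℝ ∞ f U)
    {u : ℝ → E} {s : Set ℝ} (hs : IsOpen s) (hu : ∀ t ∈ s, u t ∈ U)
    (hd : ∀ t ∈ s, HasDerivAt u (f (u t)) t) : ContDiffOn ℝ ∞ u s := by
  have key : ∀ n : ℕ, ContDiffOn ℝ n u s := by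
    intro n
    induction n with
    | zero =>
      exact contDiffOn_zero.2 fun t ht => (hd t ht).continuousAt.continuousWithinAt
    | succ n ih =>
      push_cast
      rw [contDiffOn_succ_iff_deriv_of_isOpen hs]
      refine ⟨fun t ht => (hd t ht).differentiableAt.differentiableWithinAt, by simp, ?_⟩
      refine ContDiffOn.congr ((hf.of_le (by norm_cast; exact le_top)).comp ih hu) ?_
      intro t ht
      exact (hd t ht).deriv
  exact contDiffOn_infty.2 key

end ODE

/-! ### Integral curves of left-invariant fields -/

section OneParameterSubgroup

variable {E : Type*} [NormedAddCommGroup E] [NormedSpace ℝ E]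
  {G : Type*} [TopologicalSpace G] [ChartedSpace E G] [Group G]

variable (E) in
/-- The adjoint action of `g`, as an endomorphism of the model space. -/
def adModel (g : G) : E →L[ℝ] E := lieAd E g

theorem adModel_one : adModel E (1 : G) = .id ℝ E := lieAd_one

variable [LieGroup 𝓘(ℝ, E) ∞ G]

theorem adModel_mul (g h : G) : adModel E (g * h) = (adModel E g).comp (adModel E h) :=
  lieAd_mul g h

section

variable [FiniteDimensional ℝ E]

/-- The derivative at `1` of the adjoint representation, in the chart at `1`. -/
theorem exists_hasFDerivAt_adModel : ∃ D : E →L[ℝ] E →L[ℝ] E,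
    HasFDerivAt (fun a => adModel E ((extChartAt 𝓘(ℝ, E) (1 : G)).symm a)) D
      (extChartAt 𝓘(ℝ, E) (1 : G) 1) ∧
    ∀ x y : GroupLieAlgebra 𝓘(ℝ, E) G, D x y = (⁅x, y⁆ : GroupLieAlgebra 𝓘(ℝ, E) G) :=
  exists_hasFDerivAt_lieAd

/-- Differentiability in the chart gives continuity at `1`, and multiplicativity carries it to every
point. -/
theorem continuous_adModel : Continuous fun g : G => adModel E g := by
  have h1 : ContinuousAt (fun g : G => adModel E g) 1 := by
    obtain ⟨D, hD, -⟩ := exists_hasFDerivAt_adModel (E := E) (G := G)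
    have h2 : ContinuousAt (fun g : G => adModel E ((extChartAt 𝓘(ℝ, E) (1 : G)).symm
        (extChartAt 𝓘(ℝ, E) (1 : G) g))) 1 :=
      ContinuousAt.comp (g := fun a => adModel E ((extChartAt 𝓘(ℝ, E) (1 : G)).symm a))
        (f := extChartAt 𝓘(ℝ, E) (1 : G)) hD.continuousAt (continuousAt_extChartAt 1)
    refine h2.congr ?_
    filter_upwards [extChartAt_source_mem_nhds (I := 𝓘(ℝ, E)) (1 : G)] with g hg
    rw [(extChartAt 𝓘(ℝ, E) (1 : G)).left_inv hg]
  have : IsTopologicalGroup G := topologicalGroup_of_lieGroup 𝓘(ℝ, E) ∞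
  rw [continuous_iff_continuousAt]
  intro g
  have h2 : ContinuousAt (fun h : G => (adModel E g).comp
      (adModel E (g⁻¹ * h))) g := by
    refine ContinuousAt.clm_comp continuousAt_const ?_
    refine ContinuousAt.comp (g := fun g : G => adModel E g) (f := fun h => g⁻¹ * h) ?_
      (continuous_const_mul _).continuousAt
    simpa using h1
  refine h2.congr (Eventually.of_forall fun h => ?_)
  have := adModel_mul (E := E) g (g⁻¹ * h)
  rw [mul_inv_cancel_left] at this
  exact this.symm

end

theorem mulInvariantVectorField_mul (x : GroupLieAlgebra 𝓘(ℝ, E) G) (g h : G) :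
    (mulInvariantVectorField x (g * h) : E) =
      (mfderiv 𝓘(ℝ, E) 𝓘(ℝ, E) (fun y : G => g * y) h : E →L[ℝ] E)
        (mulInvariantVectorField x h : E) := by
  have hd : ∀ a b : G, MDifferentiableAt 𝓘(ℝ, E) 𝓘(ℝ, E) (fun x : G => a * x) b := fun a b =>
    (contMDiff_mul_left (n := ∞)).contMDiffAt.mdifferentiableAt (by simp)
  have h1 := mfderiv_comp (1 : G) (hd g (h * 1)) (hd h 1)
  have h2 : (fun x : G => g * x) ∘ (fun x : G => h * x) = fun x => g * h * x := by
    ext x; simp [mul_assoc]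
  rw [h2, mul_one] at h1
  exact congrArg (fun f : E →L[ℝ] E => f x) h1

theorem contMDiff_mulInvariantVectorField_one (x : GroupLieAlgebra 𝓘(ℝ, E) G) :
    ContMDiff 𝓘(ℝ, E) 𝓘(ℝ, E).tangent 1
      (fun g : G => (⟨g, mulInvariantVectorField x g⟩ : TangentBundle 𝓘(ℝ, E) G)) := by
  have : LieGroup 𝓘(ℝ, E) (minSmoothness ℝ 3) G :=
    LieGroup.of_le (n := ∞) (by simp only [minSmoothness_of_isRCLikeNormedField]; norm_cast)
  refine (contMDiff_mulInvariantVectorField x).of_le ?_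
  simp only [minSmoothness_of_isRCLikeNormedField]; norm_cast

theorem IsMIntegralCurveOn.left_mul {γ : ℝ → G} {x : GroupLieAlgebra 𝓘(ℝ, E) G} {s : Set ℝ}
    (h : IsMIntegralCurveOn γ (mulInvariantVectorField (I := 𝓘(ℝ, E)) x) s) (g : G) :
    IsMIntegralCurveOn (fun t => g * γ t) (mulInvariantVectorField (I := 𝓘(ℝ, E)) x) s := by
  intro t ht
  have h1 : HasMFDerivAt 𝓘(ℝ, E) 𝓘(ℝ, E) (fun x : G => g * x) (γ t) _ :=
    ((contMDiff_mul_left (n := ∞)).contMDiffAt.mdifferentiableAt (by simp)).hasMFDerivAt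
  refine (h1.comp_hasMFDerivWithinAt t (h t ht)).congr_mfderiv ?_
  ext
  have h2 := mulInvariantVectorField_mul x g (γ t)
  have h3 : ∀ (L : E →L[ℝ] E) (v w : E), w = L v → L (((1 : ℝ →L[ℝ] ℝ).smulRight v) 1) =
      ((1 : ℝ →L[ℝ] ℝ).smulRight w) 1 := by
    rintro L v w rfl; simp
  exact h3 _ _ _ h2

/-- Near time `t` the curve is `γ t * γ (s - t)`, a left translate of its germ at `0`. -/
theorem isMIntegralCurve_of_map_add {γ : ℝ → G} {x : GroupLieAlgebra 𝓘(ℝ, E) G}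
    (h : ∀ s t, γ (s + t) = γ s * γ t) (hd : MDifferentiableAt 𝓘(ℝ, ℝ) 𝓘(ℝ, E) γ 0) 
    (hx : (mfderiv 𝓘(ℝ, ℝ) 𝓘(ℝ, E) γ 0 : ℝ →L[ℝ] E) 1 = x) :
    IsMIntegralCurve γ (mulInvariantVectorField (I := 𝓘(ℝ, E)) x) := by
  have h0 : γ 0 = 1 := by simpa using h 0 0
  intro t
  have h1 : HasMFDerivAt 𝓘(ℝ, E) 𝓘(ℝ, E) (fun x : G => γ t * x) (γ (t - t)) 
      (mfderiv 𝓘(ℝ, E) 𝓘(ℝ, E) (fun x : G => γ t * x) (γ (t - t))) :=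
    ((contMDiff_mul_left (n := ∞)).contMDiffAt.mdifferentiableAt (by simp)).hasMFDerivAt
  have h2 : HasMFDerivAt 𝓘(ℝ, ℝ) 𝓘(ℝ, ℝ) (fun s : ℝ => s - t) t (.id ℝ ℝ) :=
    ((hasFDerivAt_id t).sub_const t).hasMFDerivAt
  have h3 : HasMFDerivAt 𝓘(ℝ, ℝ) 𝓘(ℝ, E) γ (t - t) (mfderiv 𝓘(ℝ, ℝ) 𝓘(ℝ, E) γ (t - t)) := by
    have : MDifferentiableAt 𝓘(ℝ, ℝ) 𝓘(ℝ, E) γ (t - t) := by rwa [sub_self]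
    exact this.hasMFDerivAt
  have h4 := HasMFDerivAt.comp t h1 (HasMFDerivAt.comp (f := fun s : ℝ => s - t) t h3 h2)
  have h5 : (fun x => γ t * x) ∘ γ ∘ (fun s => s - t) = γ := by
    ext s; simp [← h]
  rw [h5] at h4
  refine h4.congr_mfderiv ?_
  ext
  have h6 : ∀ (L : E →L[ℝ] E) (M : ℝ →L[ℝ] E) (v w : E), M 1 = v → w = L v → 
      (L.comp (M.comp (.id ℝ ℝ))) 1 = ((1 : ℝ →L[ℝ] ℝ).smulRight w) 1 := by
    rintro L M v w rfl rfl; simp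
  refine h6 _ _ x _ ?_ ?_
  · rw [sub_self]; exact hx
  · rw [sub_self, h0]; rfl

variable [T2Space G]

/-- As functions of `t`, both sides are integral curves of the same left-invariant field with the
same value at `0`, so uniqueness applies. -/
theorem IsMIntegralCurve.map_add {γ : ℝ → G} {x : GroupLieAlgebra 𝓘(ℝ, E) G}
    (h : IsMIntegralCurve γ (mulInvariantVectorField (I := 𝓘(ℝ, E)) x)) (h0 : γ 0 = 1) (s t : ℝ) :
    γ (s + t) = γ s * γ t := by
  have : IsManifold 𝓘(ℝ, E) 1 G := IsManifold.of_le (n := ∞) (by simp)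
  have h1 := h.comp_add s
  have h2 : IsMIntegralCurve (fun t => γ s * γ t) (mulInvariantVectorField (I := 𝓘(ℝ, E)) x) := by
    rw [isMIntegralCurve_iff_isMIntegralCurveOn] at h ⊢
    exact h.left_mul (γ s)
  have h3 := isMIntegralCurve_Ioo_eq_of_contMDiff_boundaryless (t₀ := 0)
    (contMDiff_mulInvariantVectorField_one x) h1 h2 (by simp [h0])
  have := congrFun h3 t
  simpa [add_comm] using this

/-- In the chart at `1` the curve solves a smooth autonomous equation, so it is smooth near `0`; the
homomorphism law spreads this to all times. -/
theorem contMDiff_of_isMIntegralCurve {γ : ℝ → G} {x : GroupLieAlgebra 𝓘(ℝ, E) G}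
    (h : IsMIntegralCurve γ (mulInvariantVectorField (I := 𝓘(ℝ, E)) x)) (h0 : γ 0 = 1) :
    ContMDiff 𝓘(ℝ, ℝ) 𝓘(ℝ, E) ∞ γ := by
  have : IsManifold 𝓘(ℝ, E) 1 G := IsManifold.of_le (n := ∞) (by simp)
  set φ := extChartAt 𝓘(ℝ, E) (1 : G) with hφ
  have hsrc : IsOpen (γ ⁻¹' φ.source) := (isOpen_extChartAt_source (1 : G)).preimage h.continuous
  have h0s : (0 : ℝ) ∈ γ ⁻¹' φ.source := by
    change γ 0 ∈ φ.source
    rw [h0]; exact mem_extChartAt_source (1 : G)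
  have h1 : ContDiffOn ℝ ∞ (φ ∘ γ) (γ ⁻¹' φ.source) := by
    refine contDiffOn_of_hasDerivAt_comp (f := fun a => chartLeft E G a (x : E)) (U := φ.target)
      (contDiffOn_chartLeft.clm_apply contDiffOn_const) hsrc (fun t ht => φ.map_source ht) ?_
    intro t ht
    have h2 := HasMFDerivAt.comp t ((mdifferentiableAt_extChartAt (I := 𝓘(ℝ, E)) (x := (1 : G)) 
      (y := γ t) (by rwa [← extChartAt_source 𝓘(ℝ, E)])).hasMFDerivAt) (h t)
    have h3 : HasFDerivAt (𝕜 := ℝ) (E := ℝ) (F := E) (φ ∘ γ) _ t := h2.hasFDerivAt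
    replace h3 := h3.hasDerivAt
    have h4 : chartLeft E G (φ (γ t)) (x : E) = _ := fderiv_chartMul_inr (φ.map_source ht) x
    rw [φ.left_inv ht] at h4
    refine h3.congr_deriv ?_
    have h6 : ∀ (L : E →L[ℝ] E) (w z : E), z = L w → 
      (L.comp ((1 : ℝ →L[ℝ] ℝ).smulRight w)) 1 = z := by
      rintro L w _ rfl; simp
    exact h6 _ _ _ h4
  have h2 : ContMDiffAt 𝓘(ℝ, ℝ) 𝓘(ℝ, E) ∞ γ 0 := by
    have h3 : ContMDiffAt 𝓘(ℝ, ℝ) 𝓘(ℝ, E) ∞ (φ.symm ∘ (φ ∘ γ)) 0 := 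
      (contMDiffAt_extChartAt_one_symm (φ.map_source h0s)).comp 0
        (h1.contDiffAt (hsrc.mem_nhds h0s)).contMDiffAt
    refine h3.congr_of_eventuallyEq ?_
    filter_upwards [hsrc.mem_nhds h0s] with t ht
    exact (φ.left_inv ht).symm
  intro t
  have h3 : ContMDiffAt 𝓘(ℝ, ℝ) 𝓘(ℝ, E) ∞ (fun s => γ t * γ (s - t)) t := by
    refine (contMDiff_mul_left (a := γ t)).contMDiffAt.comp t 
      (ContMDiffAt.comp (g := γ) (f := fun s : ℝ => s - t) t ?_ (contDiffAt_id.sub contDiffAt_const).contMDiffAt)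
    simpa using h2
  refine h3.congr_of_eventuallyEq (Eventually.of_forall fun s => ?_)
  change γ s = γ t * γ (s - t)
  rw [← h.map_add h0]; simp

variable [FiniteDimensional ℝ E]

theorem exists_isMIntegralCurve_mulInvariantVectorField (x : GroupLieAlgebra 𝓘(ℝ, E) G) :
    ∃ γ : ℝ → G, γ 0 = 1 ∧ IsMIntegralCurve γ (mulInvariantVectorField (I := 𝓘(ℝ, E)) x) := by
  have : CompleteSpace E := FiniteDimensional.complete ℝ E
  have : IsManifold 𝓘(ℝ, E) 1 G := IsManifold.of_le (n := ∞) (by simp)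
  have hv := contMDiff_mulInvariantVectorField_one x
  obtain ⟨γ, h0, hγ⟩ := exists_isMIntegralCurveAt_of_contMDiffAt_boundaryless (t₀ := 0)
    (hv.contMDiffAt (x := (1 : G)))
  obtain ⟨ε, hε, hγ⟩ := isMIntegralCurveAt_iff'.1 hγ
  rw [Real.ball_zero_eq_Ioo] at hγ
  -- Left translation gives the same existence time `ε` at every starting point, which makes the
  -- field complete.
  exact exists_isMIntegralCurve_of_isMIntegralCurveOn hv hε
    (fun g => ⟨fun t => g * γ t, by simp [h0], hγ.left_mul g⟩) 1

end OneParameterSubgroup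

/-! ### One-parameter groups in Banach algebras -/

section ExpUnique

variable {A : Type*} [NormedRing A] [NormedAlgebra ℝ A] [CompleteSpace A]

/-- A differentiable one-parameter group in a Banach algebra is an exponential. -/
theorem eq_exp_smul_of_map_add {f : ℝ → A} (hf : ∀ s t, f (s + t) = f s * f t) (h0 : f 0 = 1)
    {X : A} (hX : HasDerivAt f X 0) (s : ℝ) : f s = NormedSpace.exp (s • X) := by
  have hd : ∀ t, HasDerivAt f (f t * X) t := by
    intro t
    have h1 : HasDerivAt (fun r => f (r - t)) X t := by
      refine HasDerivAt.comp_sub_const t t ?_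
      simpa using hX
    have h2 := h1.const_mul (f t)
    refine h2.congr_of_eventuallyEq (Eventually.of_forall fun r => ?_)
    change f r = f t * f (r - t)
    rw [← hf]; simp
  have he : ∀ t : ℝ, HasDerivAt (fun r : ℝ => NormedSpace.exp (r • (-X)))
      ((-X) * NormedSpace.exp (t • (-X))) t := fun t => hasDerivAt_exp_smul_const' (-X) t
  have hc : ∀ t, HasDerivAt (fun r => f r * NormedSpace.exp (r • (-X))) 0 t := by
    intro t
    refine ((hd t).mul (he t)).congr_deriv ?_
    noncomm_ring
  have h1 := is_const_of_deriv_eq_zero (fun t => (hc t).differentiableAt) (fun t => (hc t).deriv) s 0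
  simp only [h0, zero_smul, NormedSpace.exp_zero, mul_one] at h1
  have h2 : NormedSpace.exp (s • (-X)) * NormedSpace.exp (s • X) = 1 := by
    rw [smul_neg]
    let _ : NormedAlgebra ℚ A := NormedAlgebra.restrictScalars ℚ ℝ A
    rw [← NormedSpace.exp_add_of_commute (Commute.neg_left rfl)]
    simp
  calc f s = f s * (NormedSpace.exp (s • (-X)) * NormedSpace.exp (s • X)) := by rw [h2, mul_one]
    _ = NormedSpace.exp (s • X) := by rw [← mul_assoc, h1, one_mul]

/-- The generator of a one-parameter group in a Banach algebra is unique. -/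
theorem eq_of_exp_smul_eq {X Y : A} (h : ∀ s : ℝ, NormedSpace.exp (s • X) = NormedSpace.exp (s • Y)) :
    X = Y := by
  have h1 := hasDerivAt_exp_smul_const X (0 : ℝ)
  have h2 := hasDerivAt_exp_smul_const Y (0 : ℝ)
  simp only [zero_smul, NormedSpace.exp_zero, one_mul] at h1 h2
  rw [funext h] at h1
  exact h1.unique h2

end ExpUnique

/-! ### One-parameter subgroups and the Lie algebra of a commutative subgroup -/

section OneParameterSubgroup

variable {E : Type*} [NormedAddCommGroup E] [NormedSpace ℝ E] [FiniteDimensional ℝ E]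
  {G : Type*} [TopologicalSpace G] [ChartedSpace E G] [Group G] [LieGroup 𝓘(ℝ, E) ∞ G]

variable (E G) in
/-- The Lie bracket of a Lie group, as a continuous bilinear map on the model space. -/
def bracketModel : E →L[ℝ] E →L[ℝ] E := (exists_hasFDerivAt_adModel (E := E) (G := G)).choose

theorem hasFDerivAt_adModel :
    HasFDerivAt (fun a => adModel E ((extChartAt 𝓘(ℝ, E) (1 : G)).symm a)) (bracketModel E G)
      (extChartAt 𝓘(ℝ, E) (1 : G) 1) :=
  (exists_hasFDerivAt_adModel (E := E) (G := G)).choose_spec.1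

theorem bracketModel_apply (x y : GroupLieAlgebra 𝓘(ℝ, E) G) :
    bracketModel E G x y = (⁅x, y⁆ : GroupLieAlgebra 𝓘(ℝ, E) G) :=
  (exists_hasFDerivAt_adModel (E := E) (G := G)).choose_spec.2 x y

variable (E) in
/-- `γ` is a smooth one-parameter subgroup with velocity `x` at `0`. -/
structure IsOneParam (γ : ℝ → G) (x : E) : Prop where
  contMDiff : ContMDiff 𝓘(ℝ, ℝ) 𝓘(ℝ, E) ∞ γ
  map_add : ∀ s t, γ (s + t) = γ s * γ t
  velocity : (mfderiv 𝓘(ℝ, ℝ) 𝓘(ℝ, E) γ 0 : ℝ →L[ℝ] E) 1 = x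

namespace IsOneParam

variable {γ δ : ℝ → G} {x y : E}

theorem map_zero (h : IsOneParam E γ x) : γ 0 = 1 := by simpa using h.map_add 0 0

theorem isMIntegralCurve (h : IsOneParam E γ x) :
    IsMIntegralCurve γ (mulInvariantVectorField (I := 𝓘(ℝ, E)) (x : GroupLieAlgebra 𝓘(ℝ, E) G)) :=
  isMIntegralCurve_of_map_add h.map_add (h.contMDiff.contMDiffAt.mdifferentiableAt (by simp))
    h.velocity

/-- `Ad ∘ γ` is a one-parameter group of operators with derivative `ad x` at `0`, hence an
exponential. -/
theorem adModel_eq (h : IsOneParam E γ x) (s : ℝ) :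
    adModel E (γ s) = NormedSpace.exp (s • bracketModel E G x) := by
  have : CompleteSpace E := FiniteDimensional.complete ℝ E
  have : IsManifold 𝓘(ℝ, E) 1 G := IsManifold.of_le (n := ∞) (by simp)
  refine eq_exp_smul_of_map_add (f := fun s => adModel E (γ s)) (fun s t => ?_) ?_ ?_ s
  · rw [h.map_add, adModel_mul]; rfl
  · rw [h.map_zero, adModel_one]; rfl
  · set φ := extChartAt 𝓘(ℝ, E) (1 : G) with hφ
    have h1 : HasMFDerivAt 𝓘(ℝ, ℝ) 𝓘(ℝ, E) γ 0 (mfderiv 𝓘(ℝ, ℝ) 𝓘(ℝ, E) γ 0) :=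
      (h.contMDiff.contMDiffAt.mdifferentiableAt (by simp)).hasMFDerivAt
    have h2 := HasMFDerivAt.comp 0 ((mdifferentiableAt_extChartAt (I := 𝓘(ℝ, E)) (x := (1 : G))
      (y := γ 0) (by rw [h.map_zero]; exact mem_chart_source E 1)).hasMFDerivAt) h1
    have h3 : HasFDerivAt (𝕜 := ℝ) (E := ℝ) (F := E) (φ ∘ γ) _ 0 := h2.hasFDerivAt
    have h4 : HasFDerivAt (fun a => adModel E (φ.symm a)) (bracketModel E G) ((φ ∘ γ) 0) := by
      simp only [Function.comp, h.map_zero]; exact hasFDerivAt_adModel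
    have h5 := (h4.comp 0 h3).hasDerivAt
    have h6 : HasDerivAt (fun s => adModel E (φ.symm (φ (γ s)))) (bracketModel E G x) 0 := by
      refine h5.congr_deriv ?_
      have h7 : ∀ (L : E →L[ℝ] E) (M : ℝ →L[ℝ] E), L = .id ℝ E → M 1 = x →
          ((bracketModel E G).comp (L.comp M)) 1 = bracketModel E G x := by
        rintro L M rfl rfl; simp
      refine h7 _ _ ?_ h.velocity
      rw [h.map_zero]; exact mfderiv_extChartAt_self
    refine h6.congr_of_eventuallyEq ?_
    have h8 : φ.source ∈ 𝓝 (γ 0) := by rw [h.map_zero]; exact extChartAt_source_mem_nhds (1 : G)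
    filter_upwards [h.contMDiff.continuous.continuousAt.preimage_mem_nhds h8] with s hs
    rw [φ.left_inv hs]

theorem unique [T2Space G] (h : IsOneParam E γ x) (h' : IsOneParam E δ x) : γ = δ := by
  have : IsManifold 𝓘(ℝ, E) 1 G := IsManifold.of_le (n := ∞) (by simp)
  exact isMIntegralCurve_Ioo_eq_of_contMDiff_boundaryless (t₀ := 0)
    (contMDiff_mulInvariantVectorField_one x) h.isMIntegralCurve h'.isMIntegralCurve
    (by rw [h.map_zero, h'.map_zero])

theorem conj (h : IsOneParam E γ x) (g : G) :
    IsOneParam E (fun s => g * γ s * g⁻¹) (adModel E g x) where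
  contMDiff := (contMDiff_mul_right (a := g⁻¹)).comp ((contMDiff_mul_left (a := g)).comp h.contMDiff)
  map_add s t := by rw [h.map_add]; group
  velocity := by
    have h1 : HasMFDerivAt 𝓘(ℝ, E) 𝓘(ℝ, E) (fun x : G => g * x * g⁻¹) (γ 0)
        (mfderiv 𝓘(ℝ, E) 𝓘(ℝ, E) (fun x : G => g * x * g⁻¹) (γ 0)) := by
      have hs : ContMDiff 𝓘(ℝ, E) 𝓘(ℝ, E) ∞ (fun x : G => g * x * g⁻¹) :=
        (contMDiff_mul_right (a := g⁻¹)).comp (contMDiff_mul_left (a := g))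
      exact (hs.contMDiffAt.mdifferentiableAt (by simp)).hasMFDerivAt
    have h2 : HasMFDerivAt 𝓘(ℝ, ℝ) 𝓘(ℝ, E) γ 0 (mfderiv 𝓘(ℝ, ℝ) 𝓘(ℝ, E) γ 0) :=
      (h.contMDiff.contMDiffAt.mdifferentiableAt (by simp)).hasMFDerivAt
    have h3 := (HasMFDerivAt.comp 0 h1 h2).mfderiv
    have h4 : ∀ (L L' : E →L[ℝ] E) (M N : ℝ →L[ℝ] E), N = L.comp M → L = L' → M 1 = x →
        N 1 = L' x := by
      rintro L L' M N rfl rfl rfl; rfl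
    refine h4 _ _ _ _ h3 ?_ h.velocity
    rw [h.map_zero]; rfl

/-- When `ad` is injective, a velocity can be read off from `Ad ∘ γ`. This lets velocities of
rescaled curves and of products be computed in the linear group. -/
theorem of_adModel_eq (hinj : Function.Injective (bracketModel E G)) (h : IsOneParam E γ x)
    (hy : ∀ s, adModel E (γ s) = NormedSpace.exp (s • bracketModel E G y)) : IsOneParam E γ y := by
  have : CompleteSpace E := FiniteDimensional.complete ℝ E
  have h1 : bracketModel E G x = bracketModel E G y :=
    eq_of_exp_smul_eq fun s => by rw [← h.adModel_eq, hy]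
  rwa [← hinj h1]

theorem comp_mul (hinj : Function.Injective (bracketModel E G)) (h : IsOneParam E γ x) (c : ℝ) :
    IsOneParam E (fun s => γ (c * s)) (c • x) := by
  have h1 : IsOneParam E (fun s => γ (c * s)) _ :=
    ⟨h.contMDiff.comp (contDiff_const.mul contDiff_id).contMDiff,
      fun s t => by rw [mul_add, h.map_add], rfl⟩
  refine h1.of_adModel_eq hinj fun s => ?_
  rw [h.adModel_eq, map_smul, smul_smul, mul_comm]

/-- The product is a one-parameter group because the factors commute. Its image under `Ad` is `exp(s
ad x) exp(s ad y)`, with derivative `ad x + ad y` at `0`, and injectivity of `ad` identifies the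
velocity. -/
theorem mul (hinj : Function.Injective (bracketModel E G)) (h : IsOneParam E γ x)
    (h' : IsOneParam E δ y) (hc : ∀ s t, Commute (γ s) (δ t)) :
    IsOneParam E (fun s => γ s * δ s) (x + y) := by
  have : CompleteSpace E := FiniteDimensional.complete ℝ E
  have h1 : IsOneParam E (fun s => γ s * δ s) _ :=
    ⟨h.contMDiff.mul h'.contMDiff, fun s t => by
      rw [h.map_add, h'.map_add, mul_assoc, ← mul_assoc (γ t), (hc t s).eq]
      simp only [mul_assoc], rfl⟩
  have h2 : bracketModel E G ((mfderiv 𝓘(ℝ, ℝ) 𝓘(ℝ, E) (fun s => γ s * δ s) 0 : ℝ →L[ℝ] E) 1) =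
      bracketModel E G x + bracketModel E G y := by
    have h3 := hasDerivAt_exp_smul_const (bracketModel E G x) (0 : ℝ)
    have h4 := hasDerivAt_exp_smul_const (bracketModel E G y) (0 : ℝ)
    have h5 := h3.mul h4
    have h6 : (fun s : ℝ => NormedSpace.exp (s • bracketModel E G x)) *
        (fun s : ℝ => NormedSpace.exp (s • bracketModel E G y)) =
        fun s : ℝ => NormedSpace.exp (s • bracketModel E G
          ((mfderiv 𝓘(ℝ, ℝ) 𝓘(ℝ, E) (fun s => γ s * δ s) 0 : ℝ →L[ℝ] E) 1)) := by
      ext1 s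
      rw [← h1.adModel_eq, Pi.mul_apply, ← h.adModel_eq, ← h'.adModel_eq, adModel_mul]
      rfl
    rw [h6] at h5
    have h7 := (hasDerivAt_exp_smul_const (bracketModel E G
          ((mfderiv 𝓘(ℝ, ℝ) 𝓘(ℝ, E) (fun s => γ s * δ s) 0 : ℝ →L[ℝ] E) 1)) (0 : ℝ)).unique h5
    simp only [zero_smul, NormedSpace.exp_zero, one_mul, mul_one] at h7
    exact h7
  have h3 := hinj (h2.trans (_root_.map_add _ _ _).symm)
  exact ⟨h1.1, h1.2, h3⟩

end IsOneParam

theorem exists_isOneParam [T2Space G] (x : E) : ∃ γ : ℝ → G, IsOneParam E γ x := by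
  have : IsManifold 𝓘(ℝ, E) 1 G := IsManifold.of_le (n := ∞) (by simp)
  obtain ⟨γ, h0, hγ⟩ := exists_isMIntegralCurve_mulInvariantVectorField (E := E) (G := G)
    (x : GroupLieAlgebra 𝓘(ℝ, E) G)
  refine ⟨γ, contMDiff_of_isMIntegralCurve hγ h0, hγ.map_add h0, ?_⟩
  rw [(hγ 0).mfderiv]
  have h1 : ∀ v : E, v = x → ((1 : ℝ →L[ℝ] ℝ).smulRight v) 1 = x := by
    rintro v rfl; simp
  refine h1 _ ?_
  rw [h0]
  have h2 : (mfderiv 𝓘(ℝ, E) 𝓘(ℝ, E) (fun y : G => 1 * y) 1 : E →L[ℝ] E) = .id ℝ E := by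
    have h3 : (fun y : G => 1 * y) = id := by ext y; simp
    rw [h3]; exact mfderiv_id
  exact congrArg (fun f : E →L[ℝ] E => f x) h2

variable (G) in
/-- The one-parameter subgroup with velocity `x`. -/
def oneParam [T2Space G] (x : E) : ℝ → G := (exists_isOneParam (G := G) x).choose

theorem isOneParam_oneParam [T2Space G] (x : E) : IsOneParam E (oneParam G x) x :=
  (exists_isOneParam x).choose_spec

theorem IsOneParam.eq_oneParam [T2Space G] {γ : ℝ → G} {x : E} (h : IsOneParam E γ x) : γ = oneParam G x :=
  h.unique (isOneParam_oneParam x)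

/-- The Lie algebra of a commutative subgroup consists of the velocities of its one-parameter
subgroups. -/
theorem mem_subgroupLieAlgebra_iff [T2Space G]
    (hinj : Function.Injective (bracketModel E G)) {H : Subgroup G}
    (hH : ∀ x ∈ H, ∀ y ∈ H, x * y = y * x) (x : GroupLieAlgebra 𝓘(ℝ, E) G) :
    x ∈ subgroupLieAlgebra E H ↔ ∀ s, oneParam (E := E) G (x : E) s ∈ H := by
  constructor
  · intro hx
    refine Submodule.span_induction (p := fun x _ => ∀ s, oneParam (E := E) G (x : E) s ∈ H)
      ?_ ?_ ?_ ?_ hx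
    · rintro v ⟨γ, h1, h2, h3, h4⟩ s
      have h5 : IsOneParam E γ v := ⟨h1, h2, h4⟩
      rw [← h5.eq_oneParam]; exact h3 s
    · intro s
      -- Rescaling time by `0` shows that the one-parameter group with velocity `0` is constant.
      have h1 := (isOneParam_oneParam (E := E) (G := G) (0 : E)).comp_mul hinj 0
      rw [smul_zero] at h1
      change oneParam (E := E) G (0 : E) s ∈ H
      rw [← h1.eq_oneParam]
      beta_reduce
      rw [zero_mul, (isOneParam_oneParam (E := E) (G := G) (0 : E)).map_zero]
      exact H.one_mem
    · intro x y _ _ hx hy s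
      have h1 := (isOneParam_oneParam (E := E) (G := G) (x : E)).mul hinj
        (isOneParam_oneParam (E := E) (G := G) (y : E))
        (fun s t => hH _ (hx s) _ (hy t))
      change oneParam (E := E) G ((x : E) + (y : E)) s ∈ H
      rw [← h1.eq_oneParam]
      exact H.mul_mem (hx s) (hy s)
    · intro c x _ hx s
      have h1 := (isOneParam_oneParam (E := E) (G := G) (x : E)).comp_mul hinj c
      change oneParam (E := E) G (c • (x : E)) s ∈ H
      rw [← h1.eq_oneParam]
      exact hx _
  · intro hx
    exact Submodule.subset_span ⟨oneParam (E := E) G (x : E),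
      (isOneParam_oneParam (E := E) (G := G) x).contMDiff,
      (isOneParam_oneParam (E := E) (G := G) x).map_add, hx,
      (isOneParam_oneParam (E := E) (G := G) x).velocity⟩

end OneParameterSubgroup

/-! ### Invariant inner products and inner derivations -/

section InvariantInnerProduct

/-- A Lie algebra with trivial center and an invariant inner product has nondegenerate Killing
form. -/
theorem isKilling_of_inner_lie {L V : Type*} [LieRing L] [LieAlgebra ℝ L] [NormedAddCommGroup V]
    [InnerProductSpace ℝ V] [FiniteDimensional ℝ V] (e : L ≃ₗ[ℝ] V)
    (h : ∀ x y z : L, ⟪e ⁅x, y⁆, e z⟫_ℝ = -⟪e y, e ⁅x, z⁆⟫_ℝ)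
    (hz : ∀ x : L, (∀ y : L, ⁅x, y⁆ = 0) → x = 0) : LieAlgebra.IsKilling ℝ L := by
  constructor
  rw [eq_bot_iff]
  intro x hx
  rw [LieIdeal.mem_killingCompl] at hx
  have h1 := hx x (LieSubmodule.mem_top x)
  rw [killingForm_apply_apply, ← LinearMap.trace_conj' _ e,
    LinearMap.trace_eq_sum_inner _ (stdOrthonormalBasis ℝ V)] at h1
  -- Since `ad x` is skew, the trace of `(ad x)²` is minus a sum of squared norms; its vanishing
  -- forces `ad x = 0`.
  have h2 : ∀ v : V, ⟪v, e.conj (LieAlgebra.ad ℝ L x ∘ₗ LieAlgebra.ad ℝ L x) v⟫_ℝ =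
      -⟪e ⁅x, e.symm v⁆, e ⁅x, e.symm v⁆⟫_ℝ := by
    intro v
    rw [h, neg_neg]; simp [LinearEquiv.conj_apply]
  simp only [h2, Finset.sum_neg_distrib, neg_eq_zero] at h1
  rw [Finset.sum_eq_zero_iff_of_nonneg (fun i _ => real_inner_self_nonneg)] at h1
  have h3 : e.conj (LieAlgebra.ad ℝ L x) = 0 := by
    refine (stdOrthonormalBasis ℝ V).toBasis.ext fun i => ?_
    have := h1 i (Finset.mem_univ i)
    rw [inner_self_eq_zero] at this
    simpa [LinearEquiv.conj_apply] using this
  refine (LieSubmodule.mem_bot x).2 (hz x fun y => ?_)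
  have h4 := congrArg (fun f : V →ₗ[ℝ] V => e.symm (f (e y))) h3
  simpa [LinearEquiv.conj_apply] using h4

theorem eq_zero_of_forall_lie_eq_zero {L : Type*} [LieRing L] [LieAlgebra ℝ L]
    [LieAlgebra.IsSemisimple ℝ L] (x : L) (hx : ∀ y : L, ⁅x, y⁆ = 0) : x = 0 := by
  have h1 : x ∈ LieAlgebra.center ℝ L := by
    rw [LieModule.mem_maxTrivSubmodule]
    intro y
    rw [← lie_skew, hx, neg_zero]
  rw [LieAlgebra.center_eq_bot] at h1
  exact (LieSubmodule.mem_bot x).1 h1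

/-- The centre is trivial, so the invariant inner product makes the Killing form nondegenerate, and
then every derivation is inner. -/
theorem exists_lie_eq_of_leibniz {L V : Type*} [LieRing L] [LieAlgebra ℝ L]
    [LieAlgebra.IsSemisimple ℝ L] [NormedAddCommGroup V]
    [InnerProductSpace ℝ V] [FiniteDimensional ℝ V] (e : L ≃ₗ[ℝ] V)
    (h : ∀ x y z : L, ⟪e ⁅x, y⁆, e z⟫_ℝ = -⟪e y, e ⁅x, z⁆⟫_ℝ)
    (D : L →ₗ[ℝ] L) (hD : ∀ x y, D ⁅x, y⁆ = ⁅D x, y⁆ + ⁅x, D y⁆) : ∃ x : L, ∀ y, ⁅x, y⁆ = D y := by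
  have hK := isKilling_of_inner_lie e h eq_zero_of_forall_lie_eq_zero
  have hf : Module.Finite ℝ L := Module.Finite.equiv e.symm
  let D' : LieDerivation ℝ L L :=
    { toLinearMap := D
      leibniz' := fun x y => by
        rw [← lie_skew y, sub_neg_eq_add, add_comm]
        exact hD x y }
  obtain ⟨x, hx⟩ := LieDerivation.IsKilling.exists_eq_ad D'
  refine ⟨x, fun y => ?_⟩
  have h1 := congrArg (fun F : LieDerivation ℝ L L => F y) hx
  rw [LieDerivation.ad_apply_apply] at h1
  exact h1

theorem exists_linearEquiv_of_core {W : Type*} [AddCommGroup W] [Module ℝ W]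
    [FiniteDimensional ℝ W] (c : InnerProductSpace.Core ℝ W) :
    ∃ e : W ≃ₗ[ℝ] EuclideanSpace ℝ (Fin (Module.finrank ℝ W)),
      ∀ v w, ⟪e v, e w⟫_ℝ = c.inner v w := by
  let _ : NormedAddCommGroup W := c.toNormedAddCommGroup
  let _ : InnerProductSpace ℝ W := InnerProductSpace.ofCore c.toCore
  exact ⟨(stdOrthonormalBasis ℝ W).repr.toLinearEquiv,
    fun v w => (stdOrthonormalBasis ℝ W).repr.inner_map_map v w⟩

open MeasureTheory in
/-- A continuous representation of a compact group preserves an inner product. -/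
theorem exists_invariant_inner {E G : Type*} [NormedAddCommGroup E] [NormedSpace ℝ E]
    [FiniteDimensional ℝ E] [Group G] [TopologicalSpace G] [IsTopologicalGroup G] [CompactSpace G]
    (ρ : G →* (E →L[ℝ] E)) (hρ : Continuous ρ) :
    ∃ e : E ≃ₗ[ℝ] EuclideanSpace ℝ (Fin (Module.finrank ℝ E)),
      ∀ g v w, ⟪e (ρ g v), e (ρ g w)⟫_ℝ = ⟪e v, e w⟫_ℝ := by
  let _ : MeasurableSpace G := borel G
  have : BorelSpace G := ⟨rfl⟩
  let μ : Measure G := Measure.haar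
  let e₀ : E ≃L[ℝ] EuclideanSpace ℝ (Fin (Module.finrank ℝ E)) := toEuclidean
  -- The average uses `g⁻¹` so that invariance of `B` under `ρ` becomes left invariance of Haar
  -- measure.
  let B : E → E → ℝ := fun v w => ∫ g, ⟪e₀ (ρ g⁻¹ v), e₀ (ρ g⁻¹ w)⟫_ℝ ∂μ
  have hcont : ∀ v w, Continuous fun g => ⟪e₀ (ρ g⁻¹ v), e₀ (ρ g⁻¹ w)⟫_ℝ := by
    intro v w
    have h1 : ∀ v, Continuous fun g => e₀ (ρ g⁻¹ v) := fun v =>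
      e₀.continuous.comp ((hρ.comp continuous_inv).clm_apply continuous_const)
    exact (h1 v).inner (h1 w)
  have hint : ∀ v w, Integrable (fun g => ⟪e₀ (ρ g⁻¹ v), e₀ (ρ g⁻¹ w)⟫_ℝ) μ := fun v w =>
    (hcont v w).integrable_of_hasCompactSupport (HasCompactSupport.of_compactSpace _)
  let c : InnerProductSpace.Core ℝ E :=
    { inner := B
      conj_inner_symm := fun x y => by
        simp only [B, conj_trivial]
        exact integral_congr_ae (Eventually.of_forall fun g => real_inner_comm _ _)
      re_inner_nonneg := fun x => by
        exact integral_nonneg fun g => real_inner_self_nonneg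
      add_left := fun x y z => by
        simp only [B, ← integral_add (hint _ _) (hint _ _), map_add, inner_add_left]
      smul_left := fun x y r => by
        simp only [B, map_smul, real_inner_smul_left, integral_const_mul, conj_trivial]
      definite := fun x hx => by
        by_contra hne
        refine (Continuous.integral_pos_of_hasCompactSupport_nonneg_nonzero (μ := μ) (x := 1)
          (hcont x x) (HasCompactSupport.of_compactSpace _) (fun g => real_inner_self_nonneg)
          ?_).ne' hx
        simpa using hne }
  obtain ⟨e, he⟩ := exists_linearEquiv_of_core c
  refine ⟨e, fun g v w => ?_⟩
  rw [he, he]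
  change ∫ h, ⟪e₀ (ρ h⁻¹ (ρ g v)), e₀ (ρ h⁻¹ (ρ g w))⟫_ℝ ∂μ = ∫ h, ⟪e₀ (ρ h⁻¹ v), e₀ (ρ h⁻¹ w)⟫_ℝ ∂μ
  rw [← integral_mul_left_eq_self (fun h => ⟪e₀ (ρ h⁻¹ v), e₀ (ρ h⁻¹ w)⟫_ℝ) g⁻¹]
  refine integral_congr_ae (Eventually.of_forall fun h => ?_)
  simp [mul_inv_rev]

end InvariantInnerProduct

/-- The adjoint representation of a compact semisimple Lie group on its Lie algebra with an
invariant inner product, together with the bracket and the one-parameter subgroups. -/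
structure AdjointData (G V : Type*) [Group G] [TopologicalSpace G] [NormedAddCommGroup V]
    [InnerProductSpace ℝ V] where
  Ad : G →* (V →L[ℝ] V)
  continuous_Ad : Continuous Ad
  inner_Ad : ∀ g v w, ⟪Ad g v, Ad g w⟫_ℝ = ⟪v, w⟫_ℝ
  ad : V →L[ℝ] V →L[ℝ] V
  ad_self : ∀ x, ad x x = 0
  jacobi : ∀ x y z, ad x (ad y z) = ad (ad x y) z + ad y (ad x z)
  injective_ad : Function.Injective ad
  exists_ad_eq : ∀ D : V →L[ℝ] V, (∀ x y, D (ad x y) = ad (D x) y + ad x (D y)) → ∃ x, ad x = D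
  oneParam : V → ℝ → G
  continuous_oneParam : ∀ x, Continuous (oneParam x)
  oneParam_add : ∀ x s t, oneParam x (s + t) = oneParam x s * oneParam x t
  Ad_oneParam : ∀ x s, Ad (oneParam x s) = NormedSpace.exp (s • ad x)
  conj_oneParam : ∀ g x s, g * oneParam x s * g⁻¹ = oneParam (Ad g x) s

/-! ### Construction of the adjoint data of a compact semisimple group -/

section Construction

variable {E : Type*} [NormedAddCommGroup E] [NormedSpace ℝ E] [FiniteDimensional ℝ E]
  {G : Type*} [TopologicalSpace G] [ChartedSpace E G] [Group G] [LieGroup 𝓘(ℝ, E) ∞ G]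

variable (E G) in
/-- The adjoint representation on the model space. -/
def adModelHom : G →* (E →L[ℝ] E) where
  toFun := adModel E
  map_one' := adModel_one
  map_mul' := adModel_mul

end Construction

section Construction

variable {E : Type*} [NormedAddCommGroup E] [NormedSpace ℝ E]
  {G : Type*} [TopologicalSpace G] [ChartedSpace E G] [Group G] [LieGroup 𝓘(ℝ, E) ∞ G]

theorem lieGroup_minSmoothness_three : LieGroup 𝓘(ℝ, E) (minSmoothness ℝ 3) G :=
  LieGroup.of_le (n := ∞) (by simp only [minSmoothness_of_isRCLikeNormedField]; norm_cast)

variable [FiniteDimensional ℝ E]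

theorem injective_bracketModel (hG : IsSemisimpleLieGroup E G) :
    Function.Injective (bracketModel E G) := by
  have : CompleteSpace E := FiniteDimensional.complete ℝ E
  have : LieGroup 𝓘(ℝ, E) (minSmoothness ℝ 3) G := lieGroup_minSmoothness_three
  have hS : LieAlgebra.IsSemisimple ℝ (GroupLieAlgebra 𝓘(ℝ, E) G) := hG
  rw [injective_iff_map_eq_zero]
  intro x hx
  refine eq_zero_of_forall_lie_eq_zero (L := GroupLieAlgebra 𝓘(ℝ, E) G) x fun y => ?_
  exact (bracketModel_apply (E := E) (G := G) x y).symm.trans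
    (congrArg (fun f : E →L[ℝ] E => f y) hx)

theorem bracketModel_self (x : E) : bracketModel E G x x = 0 := by
  have : CompleteSpace E := FiniteDimensional.complete ℝ E
  have : LieGroup 𝓘(ℝ, E) (minSmoothness ℝ 3) G := lieGroup_minSmoothness_three
  exact (bracketModel_apply (E := E) (G := G) x x).trans
    (lie_self (L := GroupLieAlgebra 𝓘(ℝ, E) G) x)

theorem bracketModel_jacobi (x y z : E) : bracketModel E G x (bracketModel E G y z) =
    bracketModel E G (bracketModel E G x y) z + bracketModel E G y (bracketModel E G x z) := by
  have : CompleteSpace E := FiniteDimensional.complete ℝ E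
  have : LieGroup 𝓘(ℝ, E) (minSmoothness ℝ 3) G := lieGroup_minSmoothness_three
  -- Proved for an abstract Lie ring first, because the carrier of the Lie algebra is `E` itself by
  -- definition.
  have key : ∀ (L : Type _) [LieRing L] (β : L → L → L) (_ : ∀ x y, β x y = ⁅x, y⁆) (x y z : L),
      β x (β y z) = β (β x y) z + β y (β x z) := by
    intro L _ β hβ x y z
    simp only [hβ]
    exact leibniz_lie x y z
  exact key (GroupLieAlgebra 𝓘(ℝ, E) G) (fun x y => bracketModel E G x y)
    (bracketModel_apply (E := E) (G := G)) x y z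

theorem exists_bracketModel_eq (hG : IsSemisimpleLieGroup E G) {V : Type*} [NormedAddCommGroup V]
    [InnerProductSpace ℝ V] [FiniteDimensional ℝ V] (e : E ≃ₗ[ℝ] V)
    (h : ∀ x y z, ⟪e (bracketModel E G x y), e z⟫_ℝ = -⟪e y, e (bracketModel E G x z)⟫_ℝ)
    (D : E →ₗ[ℝ] E) (hD : ∀ x y, D (bracketModel E G x y) =
      bracketModel E G (D x) y + bracketModel E G x (D y)) :
    ∃ x, ∀ y, bracketModel E G x y = D y := by
  have : CompleteSpace E := FiniteDimensional.complete ℝ E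
  have : LieGroup 𝓘(ℝ, E) (minSmoothness ℝ 3) G := lieGroup_minSmoothness_three
  have hS : LieAlgebra.IsSemisimple ℝ (GroupLieAlgebra 𝓘(ℝ, E) G) := hG
  have key : ∀ (L : Type _) [LieRing L] [LieAlgebra ℝ L] [LieAlgebra.IsSemisimple ℝ L]
      (β : L → L → L) (_ : ∀ x y, β x y = ⁅x, y⁆) (e : L ≃ₗ[ℝ] V)
      (_ : ∀ x y z : L, ⟪e (β x y), e z⟫_ℝ = -⟪e y, e (β x z)⟫_ℝ)
      (D : L →ₗ[ℝ] L) (_ : ∀ x y, D (β x y) = β (D x) y + β x (D y)), ∃ x, ∀ y, β x y = D y := by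
    intro L _ _ _ β hβ e h D hD
    simp only [hβ] at h hD ⊢
    exact exists_lie_eq_of_leibniz e h D hD
  exact key (GroupLieAlgebra 𝓘(ℝ, E) G) (fun x y => bracketModel E G x y)
    (bracketModel_apply (E := E) (G := G)) e h D hD

/-- The invariance of an inner product under the adjoint action, infinitesimally. -/
theorem inner_bracketModel [T2Space G] {V : Type*} [NormedAddCommGroup V]
    [InnerProductSpace ℝ V] (e : E ≃L[ℝ] V)
    (h : ∀ g v w, ⟪e (adModel E (g : G) v), e (adModel E g w)⟫_ℝ = ⟪e v, e w⟫_ℝ) (x y z : E) :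
    ⟪e (bracketModel E G x y), e z⟫_ℝ = -⟪e y, e (bracketModel E G x z)⟫_ℝ := by
  have : CompleteSpace E := FiniteDimensional.complete ℝ E
  have h1 : ∀ v : E, HasDerivAt (fun s : ℝ => e (adModel E (oneParam G x s) v))
      (e (bracketModel E G x v)) 0 := by
    intro v
    have h2 := hasDerivAt_exp_smul_const (bracketModel E G x) (0 : ℝ)
    simp only [zero_smul, NormedSpace.exp_zero, one_mul] at h2
    have h3 := e.toContinuousLinearMap.hasFDerivAt.comp_hasDerivAt (0 : ℝ)
      (h2.clm_apply (hasDerivAt_const (0 : ℝ) v))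
    simp only [(isOneParam_oneParam (E := E) (G := G) x).adModel_eq]
    refine h3.congr_deriv ?_
    simp
  have h2 := (h1 y).inner ℝ (h1 z)
  simp only [h, (isOneParam_oneParam (E := E) (G := G) x).map_zero, adModel_one] at h2
  have h3 := h2.unique (hasDerivAt_const (0 : ℝ) _)
  simp only [ContinuousLinearMap.id_apply] at h3
  linarith

/-- Compactness supplies the invariant inner product, and semisimplicity supplies injectivity of
`ad` and inner derivations. The isomorphism `e` carries everything from `E`, whose norm need not be
Euclidean, to a Euclidean space. -/
theorem exists_adjointData [T2Space G] [CompactSpace G] (hG : IsSemisimpleLieGroup E G) :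
    ∃ (D : AdjointData G (EuclideanSpace ℝ (Fin (Module.finrank ℝ E))))
      (e : E ≃L[ℝ] EuclideanSpace ℝ (Fin (Module.finrank ℝ E))),
      (∀ g v, D.Ad g (e v) = e (adModel E g v)) ∧ ∀ x, D.oneParam (e x) = oneParam G x := by
  have : CompleteSpace E := FiniteDimensional.complete ℝ E
  have : IsTopologicalGroup G := topologicalGroup_of_lieGroup 𝓘(ℝ, E) ∞
  obtain ⟨e₀, he₀⟩ := exists_invariant_inner (adModelHom E G) continuous_adModel
  let e := e₀.toContinuousLinearEquiv
  have he : ∀ g v w, ⟪e (adModel E (g : G) v), e (adModel E g w)⟫_ℝ = ⟪e v, e w⟫_ℝ := he₀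
  have hskew := inner_bracketModel e he
  have hP := fun x => isOneParam_oneParam (E := E) (G := G) x
  let conj := e.conjContinuousAlgEquiv
  have hconj : ∀ (f : E →L[ℝ] E) v, conj f v = e (f (e.symm v)) := fun f v => rfl
  refine ⟨{ Ad := (conj : _ →* _).comp (adModelHom E G)
            continuous_Ad := conj.continuous.comp continuous_adModel
            inner_Ad := fun g v w => ?_
            ad :=
              { toFun := fun x => conj (bracketModel E G (e.symm x))
                map_add' := fun x y => by simp only [map_add]
                map_smul' := fun c x => by simp only [map_smul, RingHom.id_apply]
                cont := conj.continuous.comp ((bracketModel E G).continuous.comp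
                  e.symm.continuous) }
            ad_self := fun x => ?_
            jacobi := fun x y z => ?_
            injective_ad := fun x y hxy => ?_
            exists_ad_eq := fun D hD => ?_
            oneParam := fun x => oneParam G (e.symm x)
            continuous_oneParam := fun x => (hP _).contMDiff.continuous
            oneParam_add := fun x => (hP _).map_add
            Ad_oneParam := fun x s => ?_
            conj_oneParam := fun g x s => ?_ }, e, fun g v => ?_, fun x => ?_⟩
  · change ⟪e (adModel E g (e.symm v)), e (adModel E g (e.symm w))⟫_ℝ = _
    rw [he, e.apply_symm_apply, e.apply_symm_apply]
  · change e (bracketModel E G (e.symm x) (e.symm x)) = 0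
    rw [bracketModel_self, map_zero]
  · change e (bracketModel E G (e.symm x) (e.symm (e (bracketModel E G (e.symm y) (e.symm z))))) =
      e (bracketModel E G (e.symm (e (bracketModel E G (e.symm x) (e.symm y)))) (e.symm z)) +
      e (bracketModel E G (e.symm y) (e.symm (e (bracketModel E G (e.symm x) (e.symm z)))))
    simp only [e.symm_apply_apply]
    rw [bracketModel_jacobi, map_add]
  · exact e.symm.injective (injective_bracketModel hG (conj.injective hxy))
  · obtain ⟨x, hx⟩ := exists_bracketModel_eq hG e.toLinearEquiv hskew
      (conj.symm D : E →L[ℝ] E).toLinearMap (fun x y => by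
        have h := congrArg e.symm (hD (e x) (e y))
        change e.symm (D (e (bracketModel E G (e.symm (e x)) (e.symm (e y))))) =
          e.symm (e (bracketModel E G (e.symm (D (e x))) (e.symm (e y))) +
            e (bracketModel E G (e.symm (e x)) (e.symm (D (e y))))) at h
        simp only [e.symm_apply_apply, map_add] at h
        exact h)
    refine ⟨e x, ?_⟩
    ext1 v
    change e (bracketModel E G (e.symm (e x)) (e.symm v)) = D v
    have h : bracketModel E G x (e.symm v) = e.symm (D (e (e.symm v))) := hx (e.symm v)
    rw [e.symm_apply_apply, h, e.apply_symm_apply, e.apply_symm_apply]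
  · change conj (adModel E (oneParam G (e.symm x) s)) =
      NormedSpace.exp (s • conj (bracketModel E G (e.symm x)))
    rw [(hP _).adModel_eq, ← map_smul conj]
    let _ : NormedAlgebra ℚ (E →L[ℝ] E) := NormedAlgebra.restrictScalars ℚ ℝ _
    exact NormedSpace.map_exp conj conj.continuous _
  · change _ = oneParam G (e.symm (e (adModel E g (e.symm x)))) s
    rw [e.symm_apply_apply, ← ((hP (e.symm x)).conj g).eq_oneParam]
  · change e (adModel E g (e.symm (e v))) = _
    rw [e.symm_apply_apply]
  · change oneParam G (e.symm (e x)) = _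
    rw [e.symm_apply_apply]

end Construction

/-! ### Calculus of `Ad` and `ad`; maximal tori -/

namespace AdjointData

variable {G V : Type*} [Group G] [TopologicalSpace G] [NormedAddCommGroup V]
  [InnerProductSpace ℝ V] [FiniteDimensional ℝ V] (D : AdjointData G V)

theorem ad_swap (x y : V) : D.ad x y = -D.ad y x := by
  have h := D.ad_self (x + y)
  simp only [map_add, add_apply, D.ad_self, zero_add, add_zero] at h
  exact eq_neg_of_add_eq_zero_right h

theorem ad_comm_eq_zero {x y : V} (h : D.ad x y = 0) : D.ad y x = 0 := by
  rw [D.ad_swap, h, neg_zero]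

theorem Ad_inv_apply (g : G) (v : V) : D.Ad g⁻¹ (D.Ad g v) = v := by
  change (D.Ad g⁻¹ * D.Ad g) v = v
  rw [← map_mul]; simp

theorem Ad_apply_inv (g : G) (v : V) : D.Ad g (D.Ad g⁻¹ v) = v := by
  simpa using D.Ad_inv_apply g⁻¹ v

theorem norm_Ad (g : G) (v : V) : ‖D.Ad g v‖ = ‖v‖ := by
  rw [@norm_eq_sqrt_real_inner V, D.inner_Ad, ← norm_eq_sqrt_real_inner]

theorem hasDerivAt_Ad_oneParam (x v : V) (s : ℝ) :
    HasDerivAt (fun s => D.Ad (D.oneParam x s) v) (D.Ad (D.oneParam x s) (D.ad x v)) s := by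
  have : CompleteSpace V := FiniteDimensional.complete ℝ V
  have h := (hasDerivAt_exp_smul_const (D.ad x) s).clm_apply (hasDerivAt_const s v)
  simp only [← D.Ad_oneParam] at h
  refine h.congr_deriv ?_
  simp

theorem oneParam_zero (x : V) : D.oneParam x 0 = 1 := by simpa using D.oneParam_add x 0 0

theorem oneParam_neg (x : V) (s : ℝ) : D.oneParam x (-s) = (D.oneParam x s)⁻¹ := by
  rw [eq_inv_iff_mul_eq_one, ← D.oneParam_add, neg_add_cancel, D.oneParam_zero]

theorem Ad_oneParam_apply_of_ad_eq_zero {x v : V} (h : D.ad x v = 0) (s : ℝ) :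
    D.Ad (D.oneParam x s) v = v := by
  have h1 := is_const_of_deriv_eq_zero
    (fun s => (D.hasDerivAt_Ad_oneParam x v s).differentiableAt)
    (fun s => by rw [(D.hasDerivAt_Ad_oneParam x v s).deriv, h, map_zero]) s 0
  rw [h1, D.oneParam_zero, map_one]
  rfl

theorem hasDerivAt_Ad_oneParam_zero (x v : V) :
    HasDerivAt (fun s => D.Ad (D.oneParam x s) v) (D.ad x v) 0 := by
  have h1 := D.hasDerivAt_Ad_oneParam x v 0
  rw [D.oneParam_zero, map_one] at h1
  exact h1

theorem ad_eq_zero_of_Ad_oneParam_apply {x v : V} (h : ∀ s, D.Ad (D.oneParam x s) v = v) :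
    D.ad x v = 0 := by
  have h1 := D.hasDerivAt_Ad_oneParam_zero x v
  simp only [h] at h1
  exact h1.unique (hasDerivAt_const _ _)

theorem inner_ad_left (x y z : V) : ⟪D.ad x y, z⟫_ℝ = -⟪y, D.ad x z⟫_ℝ := by
  have h := (D.hasDerivAt_Ad_oneParam_zero x y).inner ℝ (D.hasDerivAt_Ad_oneParam_zero x z)
  simp only [D.inner_Ad, D.oneParam_zero, map_one] at h
  have h3 := h.unique (hasDerivAt_const (0 : ℝ) _)
  simp only [one_apply_eq_self] at h3
  linarith

/-- The derivative at `s = 0` of `Ad` applied to `g exp(sx) g⁻¹ = exp(s Ad(g)x)`. -/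
theorem ad_Ad_mul (g : G) (x : V) : D.ad (D.Ad g x) * D.Ad g = D.Ad g * D.ad x := by
  have : CompleteSpace V := FiniteDimensional.complete ℝ V
  ext y
  have h1 := D.hasDerivAt_Ad_oneParam_zero (D.Ad g x) (D.Ad g y)
  have h2 := (D.Ad g).hasFDerivAt.comp_hasDerivAt (0 : ℝ) (D.hasDerivAt_Ad_oneParam_zero x y)
  refine h1.unique (h2.congr_of_eventuallyEq (Eventually.of_forall fun s => ?_))
  simp only [← D.conj_oneParam, map_mul, mul_apply_eq_comp, D.Ad_inv_apply,
    Function.comp]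

theorem Ad_ad (g : G) (x y : V) : D.Ad g (D.ad x y) = D.ad (D.Ad g x) (D.Ad g y) :=
  (congrArg (fun f : V →L[ℝ] V => f y) (D.ad_Ad_mul g x)).symm

theorem eq_of_Ad_oneParam_eq {x y : V}
    (h : ∀ s, D.Ad (D.oneParam x s) = D.Ad (D.oneParam y s)) : x = y := by
  have : CompleteSpace V := FiniteDimensional.complete ℝ V
  refine D.injective_ad (eq_of_exp_smul_eq fun s => ?_)
  rw [← D.Ad_oneParam, ← D.Ad_oneParam, h]

theorem commute_oneParam {g : G} {x : V} (h : D.Ad g x = x) (s : ℝ) :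
    Commute g (D.oneParam x s) := by
  have h1 := D.conj_oneParam g x s
  rw [h] at h1
  exact mul_inv_eq_iff_eq_mul.1 h1

variable {D} {T : Subgroup G} {t : Submodule ℝ V}

theorem Ad_eq_self (hT : IsCartanSubgroup T) (ht : ∀ x, x ∈ t ↔ ∀ s, D.oneParam x s ∈ T)
    {x : V} (hx : x ∈ t) {g : G} (hg : g ∈ T) : D.Ad g x = x := by
  refine D.eq_of_Ad_oneParam_eq fun s => ?_
  rw [← D.conj_oneParam, hT.1.mul_comm _ hg _ ((ht x).1 hx s), mul_inv_cancel_right]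

theorem ad_eq_zero (hT : IsCartanSubgroup T) (ht : ∀ x, x ∈ t ↔ ∀ s, D.oneParam x s ∈ T)
    {x y : V} (hx : x ∈ t) (hy : y ∈ t) : D.ad x y = 0 :=
  D.ad_eq_zero_of_Ad_oneParam_apply fun s => Ad_eq_self hT ht hy ((ht x).1 hx s)

variable [IsTopologicalGroup G]

/-- A one-parameter group commuting with a maximal torus is contained in it. -/
theorem _root_.IsCartanSubgroup.mem_of_commute [T2Space G] (hT : IsCartanSubgroup T) {γ : ℝ → G}
    (hγ : Continuous γ) (hadd : ∀ s t, γ (s + t) = γ s * γ t)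
    (hcomm : ∀ g ∈ T, ∀ s, Commute g (γ s)) (s : ℝ) : γ s ∈ T := by
  have h0 : γ 0 = 1 := by simpa using hadd 0 0
  have hneg : ∀ s, γ (-s) = (γ s)⁻¹ := fun s => by
    rw [eq_inv_iff_mul_eq_one, ← hadd, neg_add_cancel, h0]
  have hcomm2 : ∀ r s, Commute (γ r) (γ s) := fun r s => by
    rw [commute_iff_eq, ← hadd, ← hadd, add_comm]
  -- The group `T · γ(ℝ)` is commutative, and connected as an image of `T × ℝ`. Its closure is a
  -- torus containing `T`, hence contained in `T` by maximality.
  let S : Subgroup G :=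
    { carrier := (fun p : G × ℝ => p.1 * γ p.2) '' ((T : Set G) ×ˢ Set.univ)
      one_mem' := ⟨(1, 0), ⟨T.one_mem, trivial⟩, by simp [h0]⟩
      mul_mem' := by
        rintro _ _ ⟨⟨g, r⟩, ⟨hg, -⟩, rfl⟩ ⟨⟨h, q⟩, ⟨hh, -⟩, rfl⟩
        refine ⟨(g * h, r + q), ⟨T.mul_mem hg hh, trivial⟩, ?_⟩
        simp only [hadd]
        rw [mul_assoc, mul_assoc, ← mul_assoc h, (hcomm h hh r).eq, mul_assoc]
      inv_mem' := by
        rintro _ ⟨⟨g, r⟩, ⟨hg, -⟩, rfl⟩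
        refine ⟨(g⁻¹, -r), ⟨T.inv_mem hg, trivial⟩, ?_⟩
        simp only [hneg, mul_inv_rev]
        exact ((hcomm g hg r).inv_inv).eq }
  have hScomm : ∀ x ∈ S, ∀ y ∈ S, x * y = y * x := by
    rintro _ ⟨⟨g, r⟩, ⟨hg, -⟩, rfl⟩ _ ⟨⟨h, q⟩, ⟨hh, -⟩, rfl⟩
    have h1 : Commute g h := hT.1.mul_comm g hg h hh
    exact ((h1.mul_right (hcomm g hg q)).mul_left
      ((hcomm h hh r).symm.mul_right (hcomm2 r q))).eq
  have htorus : IsTorusSubgroup S.topologicalClosure := by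
    refine ⟨S.isClosed_topologicalClosure, ?_, ?_⟩
    · rw [Subgroup.topologicalClosure_coe]
      refine IsConnected.closure ?_
      refine (hT.1.isConnected.prod isConnected_univ).image _ ?_
      exact (continuous_fst.mul (hγ.comp continuous_snd)).continuousOn
    · let _ := S.commGroupTopologicalClosure (fun x y => Subtype.ext (hScomm x x.2 y y.2))
      intro x hx y hy
      exact congrArg Subtype.val (mul_comm (⟨x, hx⟩ : S.topologicalClosure) ⟨y, hy⟩)
  have hle : T ≤ S.topologicalClosure := fun g hg =>
    S.le_topologicalClosure ⟨(g, 0), ⟨hg, trivial⟩, by simp [h0]⟩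
  exact hT.2 htorus hle (S.le_topologicalClosure ⟨(1, s), ⟨T.one_mem, trivial⟩, by simp⟩)

/-- If `Ad(T)` fixes `x`, then `T` commutes with the one-parameter group of `x`, which maximality
puts inside `T`. -/
theorem mem_of_Ad_eq_self [T2Space G] (hT : IsCartanSubgroup T)
    (ht : ∀ x, x ∈ t ↔ ∀ s, D.oneParam x s ∈ T) {x : V} (h : ∀ g ∈ T, D.Ad g x = x) : x ∈ t :=
  (ht x).2 (hT.mem_of_commute (D.continuous_oneParam x) (D.oneParam_add x)
    fun g hg => D.commute_oneParam (h g hg))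

end AdjointData

/-! ### Exponentials in closed sets of operators -/

section ClosedSubgroup

variable {A : Type*} [NormedRing A] [NormedAlgebra ℝ A] [FiniteDimensional ℝ A]

theorem exp_smul_mul_exp_neg_smul (X : A) (s : ℝ) :
    NormedSpace.exp (s • X) * NormedSpace.exp ((-s) • X) = 1 := by
  have : CompleteSpace A := FiniteDimensional.complete ℝ A
  let _ : NormedAlgebra ℚ A := NormedAlgebra.restrictScalars ℚ ℝ A
  rw [neg_smul, ← NormedSpace.exp_add_of_commute (Commute.neg_right rfl)]
  simp

/-- The product of the exponentials of complementary subspaces is onto a neighbourhood of `1`. -/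
theorem map_nhds_exp_mul_exp {a m : Submodule ℝ A} (h : IsCompl a m) :
    map (fun p : a × m => NormedSpace.exp (p.1 : A) * NormedSpace.exp (p.2 : A)) (𝓝 0) = 𝓝 1 := by
  have : CompleteSpace A := FiniteDimensional.complete ℝ A
  have : CompleteSpace a := FiniteDimensional.complete ℝ a
  have : CompleteSpace m := FiniteDimensional.complete ℝ m
  have he : HasStrictFDerivAt (NormedSpace.exp : A → A) (1 : A →L[ℝ] A) 0 :=
    hasStrictFDerivAt_exp_zero
  have h1 : HasStrictFDerivAt (fun p : a × m => NormedSpace.exp (p.1 : A))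
      (a.subtypeL.comp (ContinuousLinearMap.fst ℝ a m)) 0 := by
    have := he.comp (f := fun p : a × m => (p.1 : A)) (0 : a × m)
      (a.subtypeL.comp (ContinuousLinearMap.fst ℝ a m)).hasStrictFDerivAt
    exact this
  have h2 : HasStrictFDerivAt (fun p : a × m => NormedSpace.exp (p.2 : A))
      (m.subtypeL.comp (ContinuousLinearMap.snd ℝ a m)) 0 := by
    have := he.comp (f := fun p : a × m => (p.2 : A)) (0 : a × m)
      (m.subtypeL.comp (ContinuousLinearMap.snd ℝ a m)).hasStrictFDerivAt
    exact this
  have h3 := (h1.mul' h2).map_nhds_eq_of_surj (by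
    rw [LinearMap.range_eq_top]
    intro x
    obtain ⟨y, hy, z, hz, rfl⟩ := Submodule.mem_sup.1 (h.sup_eq_top ▸ Submodule.mem_top (x := x))
    refine ⟨(⟨y, hy⟩, ⟨z, hz⟩), ?_⟩
    simp [add_comm])
  have h4 : (fun p : a × m => NormedSpace.exp (p.1 : A) * NormedSpace.exp (p.2 : A)) =
      (fun p : a × m => NormedSpace.exp (p.1 : A)) * fun p => NormedSpace.exp (p.2 : A) := rfl
  rw [h4]
  simpa using h3

/-- A closed set closed under powers which contains exponentials of arbitrarily short nonzero
vectors of a subspace contains the exponentials of a whole half-line in the subspace. -/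
theorem exists_exp_smul_mem {S : Set A} (hS : IsClosed S)
    (hpow : ∀ x ∈ S, ∀ n : ℕ, x ^ n ∈ S) {m : Submodule ℝ A}
    (h : ∀ ε > 0, ∃ b ∈ m, b ≠ 0 ∧ ‖b‖ < ε ∧ NormedSpace.exp b ∈ S) :
    ∃ Y ∈ m, Y ≠ 0 ∧ ∀ s : ℝ, 0 ≤ s → NormedSpace.exp (s • Y) ∈ S := by
  have : CompleteSpace A := FiniteDimensional.complete ℝ A
  have : ProperSpace A := FiniteDimensional.proper_real A
  let _ : NormedAlgebra ℚ A := NormedAlgebra.restrictScalars ℚ ℝ A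
  have h' : ∀ n : ℕ, ∃ b ∈ m, b ≠ 0 ∧ ‖b‖ < 1 / ((n : ℝ) + 1) ∧ NormedSpace.exp b ∈ S :=
    fun n => h _ Nat.one_div_pos_of_nat
  choose b hbm hb0 hbn hbS using h'
  have hK : IsCompact ((m : Set A) ∩ Metric.sphere 0 1) :=
    (isCompact_sphere (0 : A) 1).inter_left m.closed_of_finiteDimensional
  have hu : ∀ n, ‖b n‖⁻¹ • b n ∈ (m : Set A) ∩ Metric.sphere 0 1 := by
    intro n
    refine ⟨m.smul_mem _ (hbm n), ?_⟩
    rw [mem_sphere_zero_iff_norm, norm_smul, norm_inv, norm_norm]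
    exact inv_mul_cancel₀ (norm_ne_zero_iff.2 (hb0 n))
  obtain ⟨Y, ⟨hYm, hY1⟩, φ, hφ, hlim⟩ := hK.tendsto_subseq hu
  refine ⟨Y, hYm, ?_, fun s hs => ?_⟩
  · rintro rfl
    simp at hY1
  have hb : Tendsto (fun n => ‖b (φ n)‖) atTop (𝓝 0) := by
    have h1 : Tendsto (fun n => ‖b n‖) atTop (𝓝 0) :=
      squeeze_zero (fun n => norm_nonneg _) (fun n => (hbn n).le)
        tendsto_one_div_add_atTop_nhds_zero_nat
    exact h1.comp hφ.tendsto_atTop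
  -- With `k = ⌊s / ‖b‖⌋`, the multiples `k b` tend to `s Y`, where `Y` is a limit of the directions
  -- `b / ‖b‖`; the powers `exp(b)ᵏ` stay in the closed set `S`.
  have hk : Tendsto (fun n => (⌊s / ‖b (φ n)‖⌋₊ : ℝ) * ‖b (φ n)‖) atTop (𝓝 s) := by
    have h1 : Tendsto (fun n => s - ‖b (φ n)‖) atTop (𝓝 s) := by
      simpa using tendsto_const_nhds.sub hb
    refine tendsto_of_tendsto_of_tendsto_of_le_of_le h1 tendsto_const_nhds (fun n => ?_)
      (fun n => ?_)
    · have hpos : 0 < ‖b (φ n)‖ := norm_pos_iff.2 (hb0 _)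
      have h2 := Nat.lt_floor_add_one (s / ‖b (φ n)‖)
      rw [div_lt_iff₀ hpos] at h2
      dsimp only
      linarith
    · have hpos : 0 < ‖b (φ n)‖ := norm_pos_iff.2 (hb0 _)
      have h2 := Nat.floor_le (div_nonneg hs hpos.le)
      rwa [le_div_iff₀ hpos] at h2
  have hlim2 : Tendsto (fun n => (⌊s / ‖b (φ n)‖⌋₊ : ℕ) • b (φ n)) atTop (𝓝 (s • Y)) := by
    refine (hk.smul hlim).congr fun n => ?_
    have hpos : ‖b (φ n)‖ ≠ 0 := norm_ne_zero_iff.2 (hb0 _)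
    rw [Function.comp, smul_smul, mul_assoc, mul_inv_cancel₀ hpos, mul_one, Nat.cast_smul_eq_nsmul]
  refine hS.mem_of_tendsto ((NormedSpace.exp_continuous.tendsto _).comp hlim2)
    (Eventually.of_forall fun n => ?_)
  rw [Function.comp, NormedSpace.exp_nsmul]
  exact hpow _ (hbS _) _

end ClosedSubgroup

/-! ### The Lie algebra of a maximal torus is self-centralizing -/

namespace AdjointData

variable {G V : Type*} [Group G] [TopologicalSpace G] [NormedAddCommGroup V]
  [InnerProductSpace ℝ V] [FiniteDimensional ℝ V] {D : AdjointData G V}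
  [IsTopologicalGroup G] [CompactSpace G] [T2Space G] {T : Subgroup G} {t : Submodule ℝ V}

/-- The generator of a one-parameter group of automorphisms in `Ad T` comes from the Lie algebra
of `T`. -/
theorem exists_mem_ad_eq (hT : IsCartanSubgroup T) (ht : ∀ x, x ∈ t ↔ ∀ s, D.oneParam x s ∈ T)
    {Y : V →L[ℝ] V} (hY : ∀ s : ℝ, ∃ g ∈ T, D.Ad g = NormedSpace.exp (s • Y)) :
    ∃ x ∈ t, D.ad x = Y := by
  have : CompleteSpace V := FiniteDimensional.complete ℝ V
  have hd : ∀ v : V, HasDerivAt (fun s : ℝ => NormedSpace.exp (s • Y) v) (Y v) 0 := by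
    intro v
    have h := (hasDerivAt_exp_smul_const Y (0 : ℝ)).clm_apply (hasDerivAt_const (0 : ℝ) v)
    simpa using h
  -- Each `exp(sY)` is some `Ad(g)`, an automorphism of the bracket; differentiating at `s = 0`
  -- gives a derivation.
  have hder : ∀ x y, Y (D.ad x y) = D.ad (Y x) y + D.ad x (Y y) := by
    intro x y
    have h1 := (D.ad.hasFDerivAt.comp_hasDerivAt (0 : ℝ) (hd x)).clm_apply (hd y)
    refine (hd (D.ad x y)).unique ((h1.congr_deriv (by simp)).congr_of_eventuallyEq
      (Eventually.of_forall fun s => ?_))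
    obtain ⟨g, -, hg⟩ := hY s
    simp only [← hg, D.Ad_ad, Function.comp]
  obtain ⟨x, hx⟩ := D.exists_ad_eq Y hder
  -- `T` fixes `x`: the operators `exp(s ad x)` lie in `Ad(T)`, so they commute with `Ad(g)` for `g
  -- ∈ T`.
  refine ⟨x, mem_of_Ad_eq_self hT ht fun g hg => D.eq_of_Ad_oneParam_eq fun s => ?_, hx⟩
  obtain ⟨h, hh, hhs⟩ := hY s
  rw [← D.conj_oneParam, map_mul, map_mul, D.Ad_oneParam, hx, ← hhs, ← map_mul, ← map_mul,
    hT.1.mul_comm g hg h hh, mul_inv_cancel_right]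

/-- A closed-subgroup argument for `Ad(T)`. Let `m` be a complement of `ad(t)` among the operators.
If `Ad(T)` contains no `exp(b)` with `b ∈ m` small and nonzero, then near the identity `Ad(T)`
consists of elements of `exp(ad t)`, so the stabilizer of `v` is an open subgroup of the connected
group `T`. Otherwise rescaling produces a one-parameter group in `Ad(T)` with a nonzero generator in
`m`; by `exists_mem_ad_eq` this generator lies in `ad(t)`, a contradiction. -/
theorem Ad_eq_self_of_ad_eq_zero (hT : IsCartanSubgroup T)
    (ht : ∀ x, x ∈ t ↔ ∀ s, D.oneParam x s ∈ T) {v : V} (hv : ∀ x ∈ t, D.ad x v = 0) {g : G}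
    (hg : g ∈ T) : D.Ad g v = v := by
  have : CompleteSpace V := FiniteDimensional.complete ℝ V
  obtain ⟨m, hm⟩ := (t.map D.ad.toLinearMap).exists_isCompl
  let S : Set (V →L[ℝ] V) := D.Ad '' T
  have hS : IsClosed S := (hT.1.isClosed.isCompact.image D.continuous_Ad).isClosed
  have hpow : ∀ x ∈ S, ∀ n : ℕ, x ^ n ∈ S := by
    rintro _ ⟨g, hg, rfl⟩ n
    exact ⟨g ^ n, T.pow_mem hg n, map_pow _ _ _⟩
  by_contra hne
  have hsmall : ∀ ε > 0, ∃ b ∈ m, b ≠ 0 ∧ ‖b‖ < ε ∧ NormedSpace.exp b ∈ S := by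
    intro ε hε
    by_contra hcon
    push Not at hcon
    have hN : {p : t.map D.ad.toLinearMap × m | ‖(p.2 : V →L[ℝ] V)‖ < ε} ∈ 𝓝 0 := by
      refine IsOpen.mem_nhds ?_ (by simpa using hε)
      exact isOpen_lt (continuous_subtype_val.comp continuous_snd).norm continuous_const
    have hN2 := image_mem_map (m := fun p : t.map D.ad.toLinearMap × m =>
      NormedSpace.exp (p.1 : V →L[ℝ] V) * NormedSpace.exp (p.2 : V →L[ℝ] V)) hN
    rw [map_nhds_exp_mul_exp hm] at hN2
    let K : Subgroup T :=
      { carrier := {g | D.Ad g v = v}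
        one_mem' := by simp
        mul_mem' := by
          intro a b (ha : _ = _) (hb : _ = _)
          simp [ha, hb]
        inv_mem' := by
          intro a (ha : _ = _)
          have h := D.Ad_inv_apply a v
          rw [ha] at h
          simpa using h }
    have hK : IsOpen (K : Set T) := by
      refine K.isOpen_of_mem_nhds (g := 1) ?_
      have h1 : Tendsto (fun g : T => D.Ad g) (𝓝 1) (𝓝 1) := by
        have := (D.continuous_Ad.comp continuous_subtype_val).tendsto (1 : T)
        rw [Function.comp, OneMemClass.coe_one, map_one] at this
        exact this
      filter_upwards [h1 hN2] with g hg
      obtain ⟨⟨⟨_, x, hx, rfl⟩, b⟩, hb, hgb⟩ := hg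
      dsimp only at hgb hb
      have hb0 : (b : V →L[ℝ] V) = 0 := by
        by_contra hb0
        refine hcon b b.2 hb0 hb ⟨(D.oneParam x 1)⁻¹ * g,
          T.mul_mem (T.inv_mem ((ht x).1 hx 1)) g.2, ?_⟩
        rw [map_mul, ← hgb, ← mul_assoc, ← D.oneParam_neg, D.Ad_oneParam]
        have h2 := exp_smul_mul_exp_neg_smul (D.ad x) (-1)
        rw [neg_neg, one_smul] at h2
        change _ * NormedSpace.exp (D.ad x) * _ = _
        rw [h2, one_mul]
      rw [hb0, NormedSpace.exp_zero, mul_one] at hgb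
      change D.Ad g v = v
      rw [← hgb]
      have h3 := D.Ad_oneParam_apply_of_ad_eq_zero (hv x hx) 1
      rw [D.Ad_oneParam, one_smul] at h3
      exact h3
    have : ConnectedSpace T := isConnected_iff_connectedSpace.1 hT.1.isConnected
    have h2 : (K : Set T) = Set.univ := IsClopen.eq_univ ⟨K.isClosed_of_isOpen hK, hK⟩ ⟨1, K.one_mem⟩
    have h3 : (⟨g, hg⟩ : T) ∈ (K : Set T) := h2 ▸ Set.mem_univ _
    exact hne h3
  obtain ⟨Y, hYm, hY0, hY⟩ := exists_exp_smul_mem hS hpow hsmall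
  have hY' : ∀ s : ℝ, ∃ g ∈ T, D.Ad g = NormedSpace.exp (s • Y) := by
    intro s
    rcases le_total 0 s with hs | hs
    · exact hY s hs
    · obtain ⟨g, hg, hgs⟩ := hY (-s) (neg_nonneg.2 hs)
      refine ⟨g⁻¹, T.inv_mem hg, ?_⟩
      have h1 := exp_smul_mul_exp_neg_smul Y s
      rw [← hgs] at h1
      calc D.Ad g⁻¹ = (NormedSpace.exp (s • Y) * D.Ad g) * D.Ad g⁻¹ := by rw [h1, one_mul]
        _ = _ := by rw [mul_assoc, ← map_mul, mul_inv_cancel, map_one, mul_one]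
  obtain ⟨x, hx, hxY⟩ := exists_mem_ad_eq hT ht hY'
  exact hY0 (Submodule.disjoint_def.1 hm.disjoint Y ⟨x, hx, hxY⟩ hYm)

/-- The Lie algebra of a maximal torus is its own centralizer. -/
theorem mem_of_ad_eq_zero (hT : IsCartanSubgroup T)
    (ht : ∀ x, x ∈ t ↔ ∀ s, D.oneParam x s ∈ T) {v : V} (hv : ∀ x ∈ t, D.ad x v = 0) : v ∈ t :=
  mem_of_Ad_eq_self hT ht fun _ hg => Ad_eq_self_of_ad_eq_zero hT ht hv hg

end AdjointData

/-! ### Spectra of differences of commuting skew operators -/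

section CommutingSkew

variable {V : Type*} [NormedAddCommGroup V] [InnerProductSpace ℝ V] [FiniteDimensional ℝ V]

theorem LinearMap.IsSymmetric.exists_eigenvector_mem {S : Module.End ℝ V} (hS : S.IsSymmetric)
    {W : Submodule ℝ V} (hW : W ≠ ⊥) (hSW : ∀ w ∈ W, S w ∈ W) :
    ∃ μ : ℝ, W ⊓ Module.End.eigenspace S μ ≠ ⊥ := by
  have : Nontrivial W := Submodule.nontrivial_iff_ne_bot.2 hW
  obtain ⟨μ, h1⟩ : ∃ μ : ℝ, Module.End.HasEigenvalue (S.restrict hSW) μ :=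
    ⟨_, (hS.restrict_invariant hSW).hasEigenvalue_iSup_of_finiteDimensional⟩
  obtain ⟨w, hw⟩ := h1.exists_hasEigenvector
  refine ⟨μ, (Submodule.ne_bot_iff _).2 ⟨w, ⟨w.2, ?_⟩, fun h => hw.2 (Subtype.ext h)⟩⟩
  exact Module.End.mem_eigenspace_iff.2 (congrArg Subtype.val hw.apply_eq_smul)

/-- For two distinct commuting skew-symmetric endomorphisms `A` and `B`, there is a common
eigenvector of `(A - B)²`, `A²` and `B²`, with a nonzero eigenvalue of `(A - B)²`. -/
theorem exists_common_eigenvector {A B : Module.End ℝ V} (hA : ∀ v w, ⟪A v, w⟫_ℝ = -⟪v, A w⟫_ℝ)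
    (hB : ∀ v w, ⟪B v, w⟫_ℝ = -⟪v, B w⟫_ℝ) (hAB : A * B = B * A) (hne : A ≠ B) :
    ∃ (w : V) (σ α β : ℝ), w ≠ 0 ∧ σ ≠ 0 ∧ (A - B) ((A - B) w) = σ • w ∧ A (A w) = α • w ∧
      B (B w) = β • w ∧ (σ - (α + β)) ^ 2 = 4 * α * β := by
  set N := A - B with hN
  have hBN : B = A - N := by rw [hN]; abel
  have hAN : A * N = N * A := by rw [hN, mul_sub, sub_mul, hAB]
  have hNs : ∀ v w, ⟪N v, w⟫_ℝ = -⟪v, N w⟫_ℝ := by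
    intro v w
    simp only [hN, LinearMap.sub_apply, inner_sub_left, inner_sub_right, hA, hB]; ring
  have hANv : ∀ v, A (N v) = N (A v) := fun v => congrArg (fun f : Module.End ℝ V => f v) hAN
  -- A skew operator is injective on its range. Searching for the eigenvector inside the range of
  -- `N` therefore guarantees `σ ≠ 0`.
  have hker : ∀ w ∈ LinearMap.range N, N w = 0 → w = 0 := by
    rintro _ ⟨u, rfl⟩ h
    have h1 := hNs u (N u)
    rw [h, inner_zero_right, neg_zero] at h1
    exact inner_self_eq_zero.1 h1
  have hW0 : LinearMap.range N ≠ ⊥ := by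
    rw [Ne, LinearMap.range_eq_bot]
    exact fun h => hne (sub_eq_zero.1 h)
  have hsN : (N * N).IsSymmetric := fun v w => by
    simp only [Module.End.mul_apply, hNs, neg_neg]
  have hsA : (A * A).IsSymmetric := fun v w => by
    simp only [Module.End.mul_apply, hA, neg_neg]
  have hsAN : (A * N).IsSymmetric := fun v w => by
    simp only [Module.End.mul_apply, hA, hNs, neg_neg, hANv]
  obtain ⟨σ, hσ⟩ := hsN.exists_eigenvector_mem hW0 (by
    rintro _ ⟨u, rfl⟩
    exact ⟨N (N u), rfl⟩)
  obtain ⟨α, hα⟩ := hsA.exists_eigenvector_mem hσ (by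
    rintro _ ⟨⟨u, rfl⟩, hu⟩
    rw [SetLike.mem_coe, Module.End.mem_eigenspace_iff] at hu
    refine ⟨⟨A (A u), by simp [hANv]⟩, ?_⟩
    rw [SetLike.mem_coe, Module.End.mem_eigenspace_iff]
    simp only [Module.End.mul_apply] at hu ⊢
    rw [← hANv, ← hANv, ← hANv, ← hANv, hu, map_smul, map_smul])
  obtain ⟨κ, hκ⟩ := hsAN.exists_eigenvector_mem hα (by
    rintro _ ⟨⟨⟨u, rfl⟩, hu⟩, hu2⟩
    rw [SetLike.mem_coe, Module.End.mem_eigenspace_iff] at hu hu2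
    refine ⟨⟨⟨A (N u), by simp [hANv]⟩, ?_⟩, ?_⟩
    · rw [SetLike.mem_coe, Module.End.mem_eigenspace_iff]
      simp only [Module.End.mul_apply] at hu ⊢
      rw [← hANv, ← hANv, hu, map_smul, map_smul]
    · rw [SetLike.mem_coe, Module.End.mem_eigenspace_iff]
      simp only [Module.End.mul_apply] at hu2 ⊢
      rw [hANv (N u), hANv (A (N u)), hu2, map_smul, map_smul, hANv (N u)])
  obtain ⟨w, ⟨⟨⟨hwr, h1⟩, h2⟩, h3⟩, hw0⟩ := (Submodule.ne_bot_iff _).1 hκ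
  rw [SetLike.mem_coe, Module.End.mem_eigenspace_iff, Module.End.mul_apply] at h1 h2
  rw [SetLike.mem_coe, Module.End.mem_eigenspace_iff, Module.End.mul_apply] at h3
  have hσ0 : σ ≠ 0 := by
    rintro rfl
    rw [zero_smul] at h1
    exact hw0 (hker w hwr (hker _ ⟨w, rfl⟩ h1))
  -- From `(AN)² = A²N²`. The value of `β` below comes from `B² = A² - 2AN + N²`.
  have hk : κ ^ 2 = α * σ := by
    have h4 : A (N (A (N w))) = (κ ^ 2) • w := by
      rw [h3, map_smul, map_smul, h3, smul_smul, sq]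
    have h5 : A (N (A (N w))) = (α * σ) • w := by
      rw [← hANv (N w), h1, map_smul, map_smul, h2, smul_smul, mul_comm]
    exact smul_left_injective ℝ hw0 (h4.symm.trans h5)
  refine ⟨w, σ, α, α - 2 * κ + σ, hw0, hσ0, h1, h2, ?_, ?_⟩
  · rw [hBN]
    simp only [LinearMap.sub_apply, map_sub, h1, h2, ← hANv, h3]
    module
  · linear_combination 4 * hk

end CommutingSkew

/-! ### Finiteness of the intersection of an orbit with an abelian subspace -/

namespace AdjointData

variable {G V : Type*} [Group G] [TopologicalSpace G] [NormedAddCommGroup V]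
  [InnerProductSpace ℝ V] [FiniteDimensional ℝ V] {D : AdjointData G V}

theorem hasEigenvalue_ad_sq {ξ w : V} {g : G} {α : ℝ} (hw : w ≠ 0)
    (h : D.ad (D.Ad g ξ) (D.ad (D.Ad g ξ) w) = α • w) :
    Module.End.HasEigenvalue ((D.ad ξ).toLinearMap * (D.ad ξ).toLinearMap) α := by
  refine Module.End.hasEigenvalue_of_hasEigenvector (x := D.Ad g⁻¹ w)
    ⟨Module.End.mem_eigenspace_iff.2 ?_, fun h0 => hw ?_⟩
  · have h1 := congrArg (D.Ad g⁻¹) h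
    rw [D.Ad_ad, D.Ad_ad, D.Ad_inv_apply, map_smul] at h1
    exact h1
  · rw [← D.Ad_apply_inv g w, h0, map_zero]

/-- For commuting `x ≠ y` in the orbit, `(ad x)²` and `(ad y)²` have the spectrum of `(ad ξ)²`.
Hence some nonzero eigenvalue `σ` of `(ad (x - y))²` satisfies `(σ - α - β)² = 4αβ` with `α`, `β` in
that finite spectrum. Only finitely many `σ` are possible, so `|σ|`, and with it the norm of `x -
y`, is bounded below. -/
theorem exists_separation (D : AdjointData G V) (ξ : V) : ∃ r > 0, ∀ g h : G,
    D.ad (D.Ad g ξ) (D.Ad h ξ) = 0 → D.Ad g ξ ≠ D.Ad h ξ → r ≤ dist (D.Ad g ξ) (D.Ad h ξ) := by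
  set Λ : Set ℝ := Module.End.HasEigenvalue ((D.ad ξ).toLinearMap * (D.ad ξ).toLinearMap)
  have hΛ : Λ.Finite := Module.End.finite_hasEigenvalue _
  set F : Set ℝ := ((fun p : ℝ × ℝ => p.1 + p.2 + √(4 * p.1 * p.2)) '' (Λ ×ˢ Λ) ∪
    (fun p : ℝ × ℝ => p.1 + p.2 - √(4 * p.1 * p.2)) '' (Λ ×ˢ Λ)) \ {0}
  have hF : F.Finite := (((hΛ.prod hΛ).image _).union ((hΛ.prod hΛ).image _)).sdiff
  obtain ⟨δ, hδ, hδF⟩ := Metric.isOpen_iff.1 hF.isClosed.isOpen_compl 0 (by simp [F])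
  -- Obtained by solving `δ ≤ |σ| ≤ ((‖ad‖ + 1) · dist)²`; the `+ 1` keeps the denominator positive.
  refine ⟨√δ / (‖D.ad‖ + 1), by positivity, fun g h hgh hne => ?_⟩
  set x := D.Ad g ξ with hx
  set y := D.Ad h ξ with hy
  obtain ⟨w, σ, α, β, hw, hσ, h1, h2, h3, h4⟩ := exists_common_eigenvector
    (A := (D.ad x).toLinearMap) (B := (D.ad y).toLinearMap) (D.inner_ad_left x)
    (D.inner_ad_left y) (by
      ext v
      have := D.jacobi x y v
      rw [hgh] at this
      simpa using this)
    (fun h0 => hne (D.injective_ad (ContinuousLinearMap.coe_injective h0)))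
  have hα : α ∈ Λ := hasEigenvalue_ad_sq hw h2
  have hβ : β ∈ Λ := hasEigenvalue_ad_sq hw h3
  have hσF : σ ∈ F := by
    refine ⟨?_, hσ⟩
    have h5 := Real.sqrt_sq_eq_abs (σ - (α + β))
    rw [h4] at h5
    rcases abs_choice (σ - (α + β)) with h6 | h6
    · exact Or.inl ⟨(α, β), ⟨hα, hβ⟩, by dsimp only; linarith⟩
    · exact Or.inr ⟨(α, β), ⟨hα, hβ⟩, by dsimp only; linarith⟩
  have hσδ : δ ≤ |σ| := by
    by_contra hlt
    exact hδF (by simpa using hlt) hσF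
  have hN : ∀ v, ‖((D.ad x).toLinearMap - (D.ad y).toLinearMap) v‖ ≤
      (‖D.ad‖ + 1) * dist x y * ‖v‖ := by
    intro v
    have h5 : ((D.ad x).toLinearMap - (D.ad y).toLinearMap) v = D.ad (x - y) v := by simp
    rw [h5, dist_eq_norm]
    refine (D.ad.le_opNorm₂ _ _).trans ?_
    gcongr
    linarith
  have h6 : |σ| * ‖w‖ ≤ ((‖D.ad‖ + 1) * dist x y) ^ 2 * ‖w‖ := by
    rw [← Real.norm_eq_abs, ← norm_smul, ← h1]
    refine (hN _).trans ?_
    rw [sq, mul_assoc (_ * _)]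
    gcongr
    exact hN w
  have h7 := hσδ.trans (le_of_mul_le_mul_right h6 (norm_pos_iff.2 hw))
  rw [div_le_iff₀ (by positivity), mul_comm]
  exact Real.sqrt_le_iff.2 ⟨by positivity, h7⟩

theorem isCompact_orbit [CompactSpace G] (D : AdjointData G V) (ξ : V) :
    IsCompact (Set.range fun g => D.Ad g ξ) :=
  isCompact_range (D.continuous_Ad.clm_apply continuous_const)

/-- An adjoint orbit contains only finitely many elements of an abelian subspace. -/
theorem finite_orbit_inter [CompactSpace G] (D : AdjointData G V) (ξ : V) {t : Submodule ℝ V}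
    (ht : ∀ x ∈ t, ∀ y ∈ t, D.ad x y = 0) : ((Set.range fun g => D.Ad g ξ) ∩ t).Finite := by
  obtain ⟨r, hr, h⟩ := D.exists_separation ξ
  have hc := (D.isCompact_orbit ξ).inter_right t.closed_of_finiteDimensional
  refine hc.finite ⟨DiscreteTopology.of_forall_le_dist hr ?_⟩
  rintro ⟨_, ⟨g, rfl⟩, hg⟩ ⟨_, ⟨k, rfl⟩, hk⟩ hne
  exact h g k (ht _ hg _ hk) fun h0 => hne (Subtype.ext h0)

end AdjointData

/-! ### Hyperplanes of `t` and their unit normals -/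

/-- `h` is a unit normal vector of the hyperplane `a` in `t`. -/
structure IsUnitNormal {V : Type*} [NormedAddCommGroup V] [InnerProductSpace ℝ V]
    (a t : Submodule ℝ V) (h : V) : Prop where
  le : a ≤ t
  mem : h ∈ t
  norm_eq : ‖h‖ = 1
  inner_eq : ∀ x ∈ a, ⟪x, h⟫_ℝ = 0
  exists_eq : ∀ x ∈ t, ∃ y ∈ a, ∃ c : ℝ, x = y + c • h

namespace IsUnitNormal

variable {V : Type*} [NormedAddCommGroup V] [InnerProductSpace ℝ V] {a t : Submodule ℝ V} {h : V}

theorem neg (H : IsUnitNormal a t h) : IsUnitNormal a t (-h) where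
  le := H.le
  mem := t.neg_mem H.mem
  norm_eq := by rw [norm_neg, H.norm_eq]
  inner_eq x hx := by rw [inner_neg_right, H.inner_eq x hx, neg_zero]
  exists_eq x hx := by
    obtain ⟨y, hy, c, rfl⟩ := H.exists_eq x hx
    exact ⟨y, hy, -c, by simp⟩

theorem ne_zero (H : IsUnitNormal a t h) : h ≠ 0 := by
  rintro rfl
  simpa using H.norm_eq

theorem inner_self (H : IsUnitNormal a t h) : ⟪h, h⟫_ℝ = 1 := by
  rw [real_inner_self_eq_norm_sq, H.norm_eq, one_pow]

theorem inner_add_smul (H : IsUnitNormal a t h) {y : V} (hy : y ∈ a) (c : ℝ) :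
    ⟪y + c • h, h⟫_ℝ = c := by
  rw [inner_add_left, H.inner_eq y hy, real_inner_smul_left, H.inner_self]; ring

theorem inner_add_smul_of_mem (H : IsUnitNormal a t h) (y : V) (c : ℝ) {x : V} (hx : x ∈ a) :
    ⟪y + c • h, x⟫_ℝ = ⟪y, x⟫_ℝ := by
  rw [inner_add_left, real_inner_smul_left, real_inner_comm x h, H.inner_eq x hx]; ring

theorem norm_add_smul_sq (H : IsUnitNormal a t h) {y : V} (hy : y ∈ a) (c : ℝ) :
    ‖y + c • h‖ ^ 2 = ‖y‖ ^ 2 + c ^ 2 := by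
  rw [norm_add_sq_real, real_inner_smul_right, H.inner_eq y hy, norm_smul, H.norm_eq]
  simp

theorem mem_iff (H : IsUnitNormal a t h) {x : V} : x ∈ a ↔ x ∈ t ∧ ⟪x, h⟫_ℝ = 0 := by
  refine ⟨fun hx => ⟨H.le hx, H.inner_eq x hx⟩, fun ⟨hx, hxh⟩ => ?_⟩
  obtain ⟨y, hy, c, rfl⟩ := H.exists_eq x hx
  rw [H.inner_add_smul hy] at hxh
  simpa [hxh] using hy

theorem _root_.exists_isUnitNormal [FiniteDimensional ℝ V] (hat : a ≤ t)
    (hf : Module.finrank ℝ a + 1 = Module.finrank ℝ t) : ∃ h, IsUnitNormal a t h := by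
  have h1 : ∃ x ∈ t, x ∉ a := by
    by_contra hcon
    push Not at hcon
    have : a = t := le_antisymm hat hcon
    subst this
    omega
  obtain ⟨x, hxt, hxa⟩ := h1
  obtain ⟨y, hy, z, hz, rfl⟩ := Submodule.exists_add_mem_mem_orthogonal (K := a) x
  have hzt : z ∈ t := by simpa using t.sub_mem hxt (hat hy)
  have hz0 : z ≠ 0 := by
    rintro rfl
    exact hxa (by simpa using hy)
  have hn : ‖z‖ ≠ 0 := norm_ne_zero_iff.2 hz0
  have hin : ∀ x ∈ a, ⟪x, ‖z‖⁻¹ • z⟫_ℝ = 0 := fun x hx => by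
    rw [real_inner_smul_right, (Submodule.mem_orthogonal a z).1 hz x hx, mul_zero]
  refine ⟨‖z‖⁻¹ • z, hat, t.smul_mem _ hzt, ?_, hin, fun x hx => ?_⟩
  · rw [norm_smul, norm_inv, norm_norm, inv_mul_cancel₀ hn]
  · have h2 : Disjoint a (ℝ ∙ z) := by
      rw [Submodule.disjoint_def]
      intro w hw hwz
      obtain ⟨c, rfl⟩ := Submodule.mem_span_singleton.1 hwz
      have := (Submodule.mem_orthogonal a z).1 hz _ hw
      rw [real_inner_smul_left, mul_eq_zero, inner_self_eq_zero] at this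
      rcases this with h | h
      · simp [h]
      · exact absurd h hz0
    have h3 : a ⊔ (ℝ ∙ z) = t := by
      refine Submodule.eq_of_le_of_finrank_eq
        (sup_le hat (by rwa [Submodule.span_singleton_le_iff_mem])) ?_
      have h4 := Submodule.finrank_sup_add_finrank_inf_eq a (ℝ ∙ z)
      rw [h2.eq_bot, finrank_bot, add_zero, finrank_span_singleton hz0] at h4
      rw [h4, hf]
    rw [← h3] at hx
    obtain ⟨y, hy, w, hw, rfl⟩ := Submodule.mem_sup.1 hx
    obtain ⟨c, rfl⟩ := Submodule.mem_span_singleton.1 hw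
    refine ⟨y, hy, c * ‖z‖, ?_⟩
    rw [smul_smul, mul_assoc, mul_inv_cancel₀ hn, mul_one]

end IsUnitNormal

/-! ### Root spheres -/

namespace AdjointData

variable {G V : Type*} [Group G] [TopologicalSpace G] [NormedAddCommGroup V]
  [InnerProductSpace ℝ V] [FiniteDimensional ℝ V]

/-- The centralizer of a set of elements of the Lie algebra. -/
def centralizer (D : AdjointData G V) (a : Submodule ℝ V) : Submodule ℝ V where
  carrier := {v | ∀ x ∈ a, D.ad x v = 0}
  zero_mem' := fun x _ => map_zero _
  add_mem' := fun {v w} hv hw x hx => by rw [map_add, hv x hx, hw x hx, add_zero]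
  smul_mem' := fun c v hv x hx => by rw [map_smul, hv x hx, smul_zero]

/-- The sphere of elements `v` of the centralizer of `a` with prescribed inner products with the
elements of `a`, and prescribed norm. -/
def rootSphere (D : AdjointData G V) (a : Submodule ℝ V) (p : V) (r : ℝ) : Set V :=
  {v | v ∈ D.centralizer a ∧ (∀ x ∈ a, ⟪v, x⟫_ℝ = ⟪p, x⟫_ℝ) ∧ ‖v‖ ^ 2 = ‖p‖ ^ 2 + r ^ 2}

variable {D : AdjointData G V} {T : Subgroup G} {a t : Submodule ℝ V} {h : V}

theorem Ad_mem_centralizer {v : V} (hv : v ∈ D.centralizer a) {g : G}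
    (hg : ∀ x ∈ a, D.Ad g x = x) : D.Ad g v ∈ D.centralizer a := by
  intro x hx
  have h1 := D.Ad_ad g x v
  rw [hg x hx, hv x hx, map_zero] at h1
  exact h1.symm

theorem ad_mem_centralizer {y v : V} (hy : ∀ x ∈ a, D.ad x y = 0) (hv : v ∈ D.centralizer a) :
    D.ad y v ∈ D.centralizer a := by
  intro x hx
  rw [D.jacobi, hy x hx, hv x hx]
  simp

theorem inner_Ad_of_fixed {g : G} {x : V} (hg : D.Ad g x = x) (v : V) :
    ⟪D.Ad g v, x⟫_ℝ = ⟪v, x⟫_ℝ := by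
  conv_lhs => rw [← hg]
  exact D.inner_Ad g v x

section Torus

variable [IsTopologicalGroup G] [CompactSpace G] [T2Space G]

theorem mem_of_mem_centralizer (hT : IsCartanSubgroup T)
    (ht : ∀ x, x ∈ t ↔ ∀ s, D.oneParam x s ∈ T) (H : IsUnitNormal a t h) {v : V}
    (hv : v ∈ D.centralizer a) (hhv : D.ad h v = 0) : v ∈ t := by
  refine mem_of_ad_eq_zero hT ht fun x hx => ?_
  obtain ⟨y, hy, c, rfl⟩ := H.exists_eq x hx
  simp [hv y hy, hhv]

/-- Every element of the centralizer of the wall `a` can be moved into `t` by an element of the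
group fixing `a`, so that the inner product with a normal vector of `a` becomes maximal. -/
theorem exists_Ad_mem (hT : IsCartanSubgroup T)
    (ht : ∀ x, x ∈ t ↔ ∀ s, D.oneParam x s ∈ T) (H : IsUnitNormal a t h) {v : V}
    (hv : v ∈ D.centralizer a) : ∃ g, (∀ x ∈ a, D.Ad g x = x) ∧ D.Ad g v ∈ t ∧
      ⟪v, h⟫_ℝ ≤ ⟪D.Ad g v, h⟫_ℝ := by
  have hcont : ∀ v, Continuous fun g => D.Ad g v := fun v =>
    D.continuous_Ad.clm_apply continuous_const
  have hcl : IsClosed {g : G | ∀ x ∈ a, D.Ad g x = x} := by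
    simp only [Set.ofPred_forall]
    exact isClosed_biInter fun x _ => isClosed_eq (hcont x) continuous_const
  obtain ⟨g, hg, hmax⟩ := hcl.isCompact.exists_isMaxOn ⟨1, fun x _ => by simp⟩
    ((hcont v).inner (𝕜 := ℝ) (continuous_const (y := h))).continuousOn
  refine ⟨g, hg, mem_of_mem_centralizer hT ht H (Ad_mem_centralizer hv hg) ?_, ?_⟩
  · set w := D.Ad g v with hw
    have hwa : w ∈ D.centralizer a := Ad_mem_centralizer hv hg
    have hya : D.ad h w ∈ D.centralizer a :=
      ad_mem_centralizer (fun x hx => ad_eq_zero hT ht (H.le hx) H.mem) hwa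
    set y := D.ad h w with hy
    -- Vary the maximizer along `exp(sy)` with `y = [h, w]`, which still fixes `a`. The derivative
    -- of the height is `⟪[y, w], h⟫ = -‖y‖²`, so `y = 0` and `w` commutes with `h` as well as with
    -- `a`.
    have hd := (D.hasDerivAt_Ad_oneParam_zero y w).inner ℝ (hasDerivAt_const (0 : ℝ) h)
    have hloc : IsLocalMax (fun s => ⟪D.Ad (D.oneParam y s) w, h⟫_ℝ) 0 := by
      refine Eventually.of_forall fun s => ?_
      have h2 := hmax (show D.oneParam y s * g ∈ {g : G | ∀ x ∈ a, D.Ad g x = x} by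
        intro x hx
        rw [map_mul, mul_apply_eq_comp, hg x hx]
        exact D.Ad_oneParam_apply_of_ad_eq_zero (D.ad_comm_eq_zero (hya x hx)) s)
      dsimp only
      rw [D.oneParam_zero, map_one, one_apply_eq_self]
      simpa [hw] using h2
    have h3 := hloc.hasDerivAt_eq_zero hd
    rw [inner_zero_right, zero_add, D.ad_swap, inner_neg_left, D.inner_ad_left, neg_neg,
      D.ad_swap, inner_neg_right, neg_eq_zero, ← hy] at h3
    exact inner_self_eq_zero.1 h3
  · have h2 := hmax (show (1 : G) ∈ {g : G | ∀ x ∈ a, D.Ad g x = x} from fun x _ => by simp)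
    simpa using h2

/-- The elements of `t` in a root sphere are its two poles. -/
theorem eq_pole_of_mem (H : IsUnitNormal a t h) {p : V} (hp : p ∈ a) {r : ℝ} {v : V}
    (hv : v ∈ D.rootSphere a p r) (hvt : v ∈ t) : v = p + r • h ∨ v = p - r • h := by
  obtain ⟨-, h1, h2⟩ := hv
  obtain ⟨y, hy, c, rfl⟩ := H.exists_eq v hvt
  have hyp : y = p := by
    rw [← sub_eq_zero, ← inner_self_eq_zero (𝕜 := ℝ)]
    have h3 := h1 (y - p) (a.sub_mem hy hp)
    rw [H.inner_add_smul_of_mem _ _ (a.sub_mem hy hp)] at h3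
    rw [inner_sub_left, h3, sub_self]
  subst hyp
  rw [H.norm_add_smul_sq hy, add_right_inj, sq_eq_sq_iff_eq_or_eq_neg] at h2
  rcases h2 with rfl | rfl
  · exact Or.inl rfl
  · right; module

theorem Ad_mem_rootSphere {p : V} {r : ℝ} {v : V} (hv : v ∈ D.rootSphere a p r) {g : G}
    (hg : ∀ x ∈ a, D.Ad g x = x) : D.Ad g v ∈ D.rootSphere a p r :=
  ⟨Ad_mem_centralizer hv.1 hg, fun x hx => by rw [inner_Ad_of_fixed (hg x hx), hv.2.1 x hx],
    by rw [D.norm_Ad, hv.2.2]⟩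

theorem pole_mem_rootSphere (hT : IsCartanSubgroup T)
    (ht : ∀ x, x ∈ t ↔ ∀ s, D.oneParam x s ∈ T) (H : IsUnitNormal a t h) {p : V} (hp : p ∈ a)
    (r : ℝ) : p + r • h ∈ D.rootSphere a p r :=
  ⟨fun _ hx => ad_eq_zero hT ht (H.le hx) (t.add_mem (H.le hp) (t.smul_mem _ H.mem)),
    fun _ hx => H.inner_add_smul_of_mem _ _ hx, H.norm_add_smul_sq hp r⟩

/-- The inner product with the normal vector on the root sphere is extremal only at the poles. -/
theorem eq_of_inner_eq (H : IsUnitNormal a t h) {p : V} (hp : p ∈ a) {r : ℝ}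
    {v : V} (hv : v ∈ D.rootSphere a p r) (hr : ⟪v, h⟫_ℝ = r) : v = p + r • h := by
  rw [← sub_eq_zero, ← norm_eq_zero, ← sq_eq_zero_iff, norm_sub_sq_real, hv.2.2,
    H.norm_add_smul_sq hp, inner_add_right, real_inner_smul_right, hr, hv.2.1 p hp,
    real_inner_self_eq_norm_sq]
  ring

/-- An element of the centralizer of a wall, outside `t`, lies on a root sphere, and is conjugate
to both its poles. -/
theorem exists_rootSphere (hT : IsCartanSubgroup T)
    (ht : ∀ x, x ∈ t ↔ ∀ s, D.oneParam x s ∈ T) (H : IsUnitNormal a t h) {v : V}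
    (hv : v ∈ D.centralizer a) (hvt : v ∉ t) : ∃ p ∈ a, ∃ r > 0, v ∈ D.rootSphere a p r ∧
      (∃ g, D.Ad g v = p + r • h) ∧ ∃ g, D.Ad g v = p - r • h := by
  obtain ⟨g, hga, hgt, hgm⟩ := exists_Ad_mem hT ht H hv
  obtain ⟨g', hga', hgt', hgm'⟩ := exists_Ad_mem hT ht H.neg hv
  obtain ⟨p, hp, r, hpr⟩ := H.exists_eq _ hgt
  have hvS : v ∈ D.rootSphere a p r := by
    refine ⟨hv, fun x hx => ?_, ?_⟩
    · rw [← inner_Ad_of_fixed (hga x hx), hpr, H.inner_add_smul_of_mem _ _ hx]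
    · rw [← D.norm_Ad g, hpr, H.norm_add_smul_sq hp]
  rw [hpr, H.inner_add_smul hp] at hgm
  rw [inner_neg_right, inner_neg_right, neg_le_neg_iff] at hgm'
  -- Height `r` occurs only at the upper pole, which lies in `t`. The strict inequality forces the
  -- minimizing element `g'` to reach the lower pole.
  have hlt : ⟪v, h⟫_ℝ < r := hgm.lt_of_ne fun h1 => hvt (by
    rw [eq_of_inner_eq H hp hvS h1]
    exact t.add_mem (H.le hp) (t.smul_mem _ H.mem))
  have h2 : D.Ad g' v = p - r • h := by
    rcases eq_pole_of_mem H hp (Ad_mem_rootSphere hvS hga') hgt' with h2 | h2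
    · rw [h2, H.inner_add_smul hp] at hgm'
      linarith
    · exact h2
  rw [h2, sub_eq_add_neg, ← neg_smul, H.inner_add_smul hp] at hgm'
  exact ⟨p, hp, r, by linarith, hvS, ⟨g, hpr⟩, ⟨g', h2⟩⟩

theorem exists_Ad_eq_of_mem_rootSphere (hT : IsCartanSubgroup T)
    (ht : ∀ x, x ∈ t ↔ ∀ s, D.oneParam x s ∈ T) (H : IsUnitNormal a t h) {p : V} (hp : p ∈ a)
    {r : ℝ} {v : V} (hv : v ∈ D.rootSphere a p r) :
    (∃ g, D.Ad g v = p + r • h) ∨ ∃ g, D.Ad g v = p - r • h := by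
  obtain ⟨g, hga, hgt, -⟩ := exists_Ad_mem hT ht H hv.1
  exact (eq_pole_of_mem H hp (Ad_mem_rootSphere hv hga) hgt).imp (fun h => ⟨g, h⟩)
    fun h => ⟨g, h⟩

/-- The root directions: the part of the centralizer of the wall orthogonal to `t`. -/
def rootSpace (D : AdjointData G V) (a t : Submodule ℝ V) : Submodule ℝ V := D.centralizer a ⊓ tᗮ

/-- `[h, u]` is again a root direction. It is orthogonal to `u` because `ad h` is skew, and nonzero
because otherwise `u` would lie in `t` and be orthogonal to itself. -/
theorem one_lt_rank_rootSpace (hT : IsCartanSubgroup T)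
    (ht : ∀ x, x ∈ t ↔ ∀ s, D.oneParam x s ∈ T) (H : IsUnitNormal a t h) {u : V}
    (hu : u ∈ D.rootSpace a t) (hu0 : u ≠ 0) : 1 < Module.rank ℝ (D.rootSpace a t) := by
  have hw : D.ad h u ∈ D.rootSpace a t := by
    refine ⟨ad_mem_centralizer (fun x hx => ad_eq_zero hT ht (H.le hx) H.mem) hu.1,
      (Submodule.mem_orthogonal _ _).2 fun x hx => ?_⟩
    rw [real_inner_comm, D.inner_ad_left, ad_eq_zero hT ht H.mem hx, inner_zero_right, neg_zero]
  have hw0 : D.ad h u ≠ 0 := fun h0 => hu0 (by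
    have h1 := mem_of_mem_centralizer hT ht H hu.1 h0
    exact inner_self_eq_zero.1 ((Submodule.mem_orthogonal _ _).1 hu.2 u h1))
  have huw : ⟪u, D.ad h u⟫_ℝ = 0 := by
    have h1 := D.inner_ad_left h u u
    rw [real_inner_comm] at h1
    linarith
  have hli : LinearIndependent ℝ ![(⟨u, hu⟩ : D.rootSpace a t), ⟨D.ad h u, hw⟩] := by
    rw [LinearIndependent.pair_iff]
    intro c d hcd
    have h1 : c • u + d • D.ad h u = 0 := congrArg Subtype.val hcd
    have h2 := congrArg (fun v => ⟪u, v⟫_ℝ) h1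
    have h3 := congrArg (fun v => ⟪D.ad h u, v⟫_ℝ) h1
    simp only [inner_add_right, real_inner_smul_right, huw, inner_zero_right, mul_zero,
      add_zero] at h2
    rw [inner_add_right, real_inner_smul_right, real_inner_smul_right, real_inner_comm, huw,
      inner_zero_right, mul_zero, zero_add] at h3
    exact ⟨(mul_eq_zero.1 h2).resolve_right (inner_self_ne_zero.2 hu0),
      (mul_eq_zero.1 h3).resolve_right (inner_self_ne_zero.2 hw0)⟩
  have h4 := hli.fintype_card_le_finrank
  rw [Fintype.card_fin] at h4
  rw [← Module.finrank_eq_rank]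
  exact_mod_cast h4

theorem exists_rootSpace_eq (H : IsUnitNormal a t h)
    (hT : IsCartanSubgroup T) (ht : ∀ x, x ∈ t ↔ ∀ s, D.oneParam x s ∈ T)
    {p : V} (hp : p ∈ a) {r : ℝ} {v : V} (hv : v ∈ D.rootSphere a p r) :
    ∃ w ∈ D.rootSpace a t, ∃ s : ℝ, v = p + s • h + w ∧ s ^ 2 + ‖w‖ ^ 2 = r ^ 2 := by
  have hpt : p + ⟪v, h⟫_ℝ • h ∈ t := t.add_mem (H.le hp) (t.smul_mem _ H.mem)
  have ho : ∀ x ∈ t, ⟪x, v - (p + ⟪v, h⟫_ℝ • h)⟫_ℝ = 0 := by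
    intro x hx
    obtain ⟨y, hy, c, rfl⟩ := H.exists_eq x hx
    rw [inner_add_left, real_inner_smul_left, inner_sub_right, inner_sub_right,
      real_inner_comm, hv.2.1 y hy, real_inner_comm _ y, H.inner_add_smul_of_mem _ _ hy,
      real_inner_comm _ h, real_inner_comm _ h, H.inner_add_smul hp]
    ring
  refine ⟨v - (p + ⟪v, h⟫_ℝ • h), ⟨Submodule.sub_mem _ hv.1 fun x hx =>
    ad_eq_zero hT ht (H.le hx) hpt, (Submodule.mem_orthogonal _ _).2 ho⟩, ⟪v, h⟫_ℝ, by abel, ?_⟩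
  have h1 : ‖(p + ⟪v, h⟫_ℝ • h) + (v - (p + ⟪v, h⟫_ℝ • h))‖ ^ 2 = ‖p‖ ^ 2 + r ^ 2 := by
    rw [← hv.2.2]; congr 2; abel
  rw [norm_add_sq_real, ho _ hpt, H.norm_add_smul_sq hp] at h1
  linarith

theorem add_mem_rootSphere (H : IsUnitNormal a t h)
    (hT : IsCartanSubgroup T) (ht : ∀ x, x ∈ t ↔ ∀ s, D.oneParam x s ∈ T)
    {p : V} (hp : p ∈ a) {r s : ℝ} {w : V} (hw : w ∈ D.rootSpace a t)
    (hs : s ^ 2 + ‖w‖ ^ 2 = r ^ 2) : p + s • h + w ∈ D.rootSphere a p r := by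
  have hpt : p + s • h ∈ t := t.add_mem (H.le hp) (t.smul_mem _ H.mem)
  have ho := (Submodule.mem_orthogonal _ _).1 hw.2
  refine ⟨Submodule.add_mem _ (fun x hx => ad_eq_zero hT ht (H.le hx) hpt) hw.1,
    fun x hx => ?_, ?_⟩
  · rw [inner_add_left, H.inner_add_smul_of_mem _ _ hx, real_inner_comm _ w, ho x (H.le hx),
      add_zero]
  · rw [norm_add_sq_real, ho _ hpt, H.norm_add_smul_sq hp]
    linarith

theorem add_notMem (H : IsUnitNormal a t h) {p : V} (hp : p ∈ a) {s : ℝ} {w : V}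
    (hw : w ∈ D.rootSpace a t) (hw0 : w ≠ 0) : p + s • h + w ∉ t := by
  intro h1
  have h2 : w ∈ t := by simpa using t.sub_mem h1 (t.add_mem (H.le hp) (t.smul_mem s H.mem))
  exact hw0 (inner_self_eq_zero.1 ((Submodule.mem_orthogonal _ _).1 hw.2 w h2))

/-- A root sphere without its poles, as an image of a cylinder. -/
theorem rootSphere_diff_eq (H : IsUnitNormal a t h)
    (hT : IsCartanSubgroup T) (ht : ∀ x, x ∈ t ↔ ∀ s, D.oneParam x s ∈ T)
    {p : V} (hp : p ∈ a) {r : ℝ} (hr : 0 < r) : D.rootSphere a p r \ t =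
      (fun q : ℝ × D.rootSpace a t => p + q.1 • h + √(r ^ 2 - q.1 ^ 2) • (q.2 : V)) ''
        (Set.Ioo (-r) r ×ˢ Metric.sphere 0 1) := by
  ext v
  constructor
  · rintro ⟨hv, hvt⟩
    obtain ⟨w, hw, s, rfl, hs⟩ := exists_rootSpace_eq H hT ht hp hv
    have hw0 : w ≠ 0 := by
      rintro rfl
      exact hvt (by simpa using t.add_mem (H.le hp) (t.smul_mem s H.mem))
    have hpos : 0 < ‖w‖ := norm_pos_iff.2 hw0
    refine ⟨(s, ‖w‖⁻¹ • ⟨w, hw⟩), ⟨?_, ?_⟩, ?_⟩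
    · exact abs_lt.1 (abs_lt_of_sq_lt_sq (by nlinarith) hr.le)
    · rw [mem_sphere_zero_iff_norm, norm_smul, norm_inv, norm_norm]
      exact inv_mul_cancel₀ hpos.ne'
    · have h1 : √(r ^ 2 - s ^ 2) = ‖w‖ := by
        rw [← hs, add_sub_cancel_left, Real.sqrt_sq hpos.le]
      dsimp only
      rw [h1, Submodule.coe_smul, smul_smul, mul_inv_cancel₀ hpos.ne', one_smul]
  · rintro ⟨⟨s, u, hu⟩, ⟨hs, hu1⟩, rfl⟩
    have hpos : 0 < r ^ 2 - s ^ 2 := by nlinarith [hs.1, hs.2]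
    have hu1' : ‖u‖ = 1 := mem_sphere_zero_iff_norm.1 hu1
    have hn : ‖√(r ^ 2 - s ^ 2) • u‖ ^ 2 = r ^ 2 - s ^ 2 := by
      rw [norm_smul, hu1', mul_one, Real.norm_eq_abs, sq_abs, Real.sq_sqrt hpos.le]
    refine ⟨add_mem_rootSphere H hT ht hp (Submodule.smul_mem _ _ hu) (by dsimp only; linarith),
      add_notMem H hp (Submodule.smul_mem _ _ hu) fun h0 => ?_⟩
    dsimp only at h0
    rw [h0] at hn
    simp at hn
    linarith

theorem exists_rootSpace_norm_eq_one (H : IsUnitNormal a t h)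
    (hT : IsCartanSubgroup T) (ht : ∀ x, x ∈ t ↔ ∀ s, D.oneParam x s ∈ T)
    {p : V} (hp : p ∈ a) {r : ℝ} (hr : 0 < r) (hne : (D.rootSphere a p r \ t).Nonempty) :
    ∃ u : D.rootSpace a t, ‖u‖ = 1 := by
  obtain ⟨v, hv⟩ := hne
  rw [rootSphere_diff_eq H hT ht hp hr] at hv
  obtain ⟨⟨s, u⟩, ⟨-, hu⟩, -⟩ := hv
  exact ⟨u, mem_sphere_zero_iff_norm.1 hu⟩

/-- An image of an open interval times a unit sphere, the latter connected because the root space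
has dimension greater than one. -/
theorem isPreconnected_rootSphere_diff (H : IsUnitNormal a t h)
    (hT : IsCartanSubgroup T) (ht : ∀ x, x ∈ t ↔ ∀ s, D.oneParam x s ∈ T)
    {p : V} (hp : p ∈ a) {r : ℝ} (hr : 0 < r) : IsPreconnected (D.rootSphere a p r \ t) := by
  rcases (D.rootSphere a p r \ t).eq_empty_or_nonempty with h0 | hne
  · rw [h0]; exact isPreconnected_empty
  obtain ⟨u, hu⟩ := exists_rootSpace_norm_eq_one H hT ht hp hr hne
  have hrank := one_lt_rank_rootSpace hT ht H u.2 (by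
    intro h0
    rw [Submodule.coe_eq_zero] at h0
    simp [h0] at hu)
  rw [rootSphere_diff_eq H hT ht hp hr]
  refine (isPreconnected_Ioo.prod (isPreconnected_sphere hrank 0 1)).image _
    (Continuous.continuousOn ?_)
  fun_prop

/-- Follow a meridian `s ↦ p + s h + √(r² - s²) u` as `s` tends to `r`. -/
theorem pole_mem_closure (H : IsUnitNormal a t h)
    (hT : IsCartanSubgroup T) (ht : ∀ x, x ∈ t ↔ ∀ s, D.oneParam x s ∈ T)
    {p : V} (hp : p ∈ a) {r : ℝ} (hr : 0 < r) (hne : (D.rootSphere a p r \ t).Nonempty) :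
    p + r • h ∈ closure (D.rootSphere a p r \ t) := by
  obtain ⟨u, hu⟩ := exists_rootSpace_norm_eq_one H hT ht hp hr hne
  have hc : Continuous fun s : ℝ => p + s • h + √(r ^ 2 - s ^ 2) • (u : V) := by fun_prop
  have h1 : r ∈ closure (Set.Ioo (-r) r) := by
    rw [closure_Ioo (by linarith : -r ≠ r)]
    exact ⟨by linarith, le_rfl⟩
  have h2 := image_closure_subset_closure_image hc ⟨r, h1, rfl⟩
  simp only [sub_self, Real.sqrt_zero, zero_smul, add_zero] at h2
  refine closure_mono ?_ h2
  rw [rootSphere_diff_eq H hT ht hp hr]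
  rintro _ ⟨s, hs, rfl⟩
  exact ⟨(s, u), ⟨hs, mem_sphere_zero_iff_norm.2 hu⟩, rfl⟩

end Torus

theorem isClosed_rootSphere (D : AdjointData G V) (a : Submodule ℝ V) (p : V) (r : ℝ) :
    IsClosed (D.rootSphere a p r) := by
  refine (D.centralizer a).closed_of_finiteDimensional.inter (IsClosed.inter ?_ ?_)
  · change IsClosed {v : V | ∀ x ∈ a, ⟪v, x⟫_ℝ = ⟪p, x⟫_ℝ}
    simp only [Set.ofPred_forall]
    exact isClosed_biInter fun x _ => isClosed_eq (by fun_prop) continuous_const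
  · exact isClosed_eq (by fun_prop) continuous_const

end AdjointData

/-! ### Infinitesimal isotropy and the local structure of the one-dimensional stratum -/

namespace AdjointData

section Isotropy

variable {G V : Type*} [Group G] [TopologicalSpace G] [NormedAddCommGroup V]
  [InnerProductSpace ℝ V] [FiniteDimensional ℝ V]

/-- The infinitesimal isotropy in `t` of an element of the Lie algebra. -/
def isotropy (D : AdjointData G V) (t : Submodule ℝ V) (v : V) : Submodule ℝ V where
  carrier := {x | x ∈ t ∧ D.ad x v = 0}
  zero_mem' := ⟨t.zero_mem, by simp⟩
  add_mem' := fun hx hy => ⟨t.add_mem hx.1 hy.1, by simp [hx.2, hy.2]⟩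
  smul_mem' := fun c _ hx => ⟨t.smul_mem c hx.1, by simp [hx.2]⟩

theorem isotropy_le (D : AdjointData G V) (t : Submodule ℝ V) (v : V) : D.isotropy t v ≤ t :=
  fun _ hx => hx.1

theorem mem_centralizer_isotropy (D : AdjointData G V) (t : Submodule ℝ V) (v : V) :
    v ∈ D.centralizer (D.isotropy t v) :=
  fun _ hx => hx.2

variable {D : AdjointData G V} {T : Subgroup G} {a t : Submodule ℝ V} {h : V}

variable [IsTopologicalGroup G] [CompactSpace G] [T2Space G]

theorem finrank_isotropy_eq_iff (hT : IsCartanSubgroup T)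
    (ht : ∀ x, x ∈ t ↔ ∀ s, D.oneParam x s ∈ T) {v : V} :
    Module.finrank ℝ (D.isotropy t v) = Module.finrank ℝ t ↔ v ∈ t := by
  refine ⟨fun hf => mem_of_ad_eq_zero hT ht fun x hx => ?_, fun hv => ?_⟩
  · rw [← Submodule.eq_of_le_of_finrank_eq (D.isotropy_le t v) hf] at hx
    exact hx.2
  · rw [(D.isotropy_le t v).antisymm fun x hx => ⟨hx, ad_eq_zero hT ht hx hv⟩]

theorem exists_wall (hT : IsCartanSubgroup T)
    (ht : ∀ x, x ∈ t ↔ ∀ s, D.oneParam x s ∈ T) {v : V}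
    (hv : Module.finrank ℝ (D.isotropy t v) + 1 = Module.finrank ℝ t) :
    ∃ h, IsUnitNormal (D.isotropy t v) t h ∧ v ∉ t := by
  obtain ⟨h, H⟩ := exists_isUnitNormal (D.isotropy_le t v) hv
  refine ⟨h, H, fun hvt => ?_⟩
  rw [← finrank_isotropy_eq_iff hT ht] at hvt
  omega

/-- Every point of the sphere is conjugate to one of the poles. -/
theorem rootSphere_subset (hT : IsCartanSubgroup T)
    (ht : ∀ x, x ∈ t ↔ ∀ s, D.oneParam x s ∈ T) (H : IsUnitNormal a t h) {p : V} (hp : p ∈ a)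
    {r : ℝ} {ξ : V} (h1 : p + r • h ∈ Set.range fun g => D.Ad g ξ)
    (h2 : p - r • h ∈ Set.range fun g => D.Ad g ξ) :
    D.rootSphere a p r ⊆ Set.range fun g => D.Ad g ξ := by
  intro v hv
  rcases exists_Ad_eq_of_mem_rootSphere hT ht H hp hv with ⟨g, hg⟩ | ⟨g, hg⟩
  · obtain ⟨k, hk⟩ := h1
    refine ⟨g⁻¹ * k, ?_⟩
    dsimp only at hk ⊢
    rw [map_mul, mul_apply_eq_comp, hk, ← hg, D.Ad_inv_apply]
  · obtain ⟨k, hk⟩ := h2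
    refine ⟨g⁻¹ * k, ?_⟩
    dsimp only at hk ⊢
    rw [map_mul, mul_apply_eq_comp, hk, ← hg, D.Ad_inv_apply]

/-- On elements of the root sphere without the poles, the isotropy is the wall. -/
theorem isotropy_eq_of_mem (hT : IsCartanSubgroup T)
    (ht : ∀ x, x ∈ t ↔ ∀ s, D.oneParam x s ∈ T) (H : IsUnitNormal a t h) {v : V}
    (hv : v ∈ D.centralizer a) (hvt : v ∉ t) : D.isotropy t v = a := by
  refine le_antisymm (fun x hx => ?_) fun x hx => ⟨H.le hx, hv x hx⟩
  obtain ⟨y, hy, c, rfl⟩ := H.exists_eq x hx.1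
  have h1 := hx.2
  rw [map_add, map_smul, add_apply, hv y hy, zero_add] at h1
  rcases smul_eq_zero.1 h1 with h2 | h2
  · simpa [h2] using hy
  · exact absurd (mem_of_mem_centralizer hT ht H hv h2) hvt

theorem IsUnitNormal.finrank_add_one (H : IsUnitNormal a t h) :
    Module.finrank ℝ a + 1 = Module.finrank ℝ t := by
  have h1 : a ⊔ (ℝ ∙ h) = t := by
    refine le_antisymm (sup_le H.le ((Submodule.span_singleton_le_iff_mem _ _).2 H.mem)) ?_
    intro x hx
    obtain ⟨y, hy, c, rfl⟩ := H.exists_eq x hx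
    exact Submodule.add_mem_sup hy (Submodule.smul_mem _ c (Submodule.mem_span_singleton_self h))
  have h2 : a ⊓ (ℝ ∙ h) = ⊥ := by
    rw [← disjoint_iff, Submodule.disjoint_def]
    intro w hw hwh
    obtain ⟨c, rfl⟩ := Submodule.mem_span_singleton.1 hwh
    have := H.inner_eq _ hw
    rw [real_inner_smul_left, H.inner_self, mul_one] at this
    rw [this, zero_smul]
  have h4 := Submodule.finrank_sup_add_finrank_inf_eq a (ℝ ∙ h)
  rw [h1, h2, finrank_bot, add_zero, finrank_span_singleton H.ne_zero] at h4
  exact h4.symm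

/-- A root sphere without its poles is open in the part of the orbit with isotropy of codimension
one. -/
theorem exists_isOpen_rootSphere (hT : IsCartanSubgroup T)
    (ht : ∀ x, x ∈ t ↔ ∀ s, D.oneParam x s ∈ T) (H : IsUnitNormal a t h) {p : V} {r : ℝ} {ξ : V}
    (hS : D.rootSphere a p r \ t ⊆ Set.range fun g => D.Ad g ξ)
    (hne : (D.rootSphere a p r \ t).Nonempty) :
    ∃ U : Set V, IsOpen U ∧ (∀ g ∈ T, ∀ v ∈ U, D.Ad g v ∈ U) ∧ D.rootSphere a p r \ t ⊆ U ∧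
      ∀ v ∈ Set.range fun g => D.Ad g ξ, v ∈ U →
        Module.finrank ℝ (D.isotropy t v) + 1 = Module.finrank ℝ t →
        v ∈ D.rootSphere a p r \ t := by
  -- `F` collects the finitely many points of the orbit in `t` whose projection to `a` differs from
  -- `p`. `U₂` excludes their projections, and `U₁` forces the isotropy into `a`.
  set F : Set V := {f | f ∈ ((Set.range fun g => D.Ad g ξ) ∩ t) ∧ ∃ x ∈ a, ⟪p, x⟫_ℝ ≠ ⟪f, x⟫_ℝ}
  have hF : F.Finite := (D.finite_orbit_inter ξ fun x hx y hy => ad_eq_zero hT ht hx hy).subset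
    fun f hf => hf.1
  set U₁ : Set V := {v | ∃ u ∈ D.centralizer a, ⟪D.ad h v, D.ad h u⟫_ℝ ≠ 0}
  set U₂ : Set V := ⋂ f ∈ F, {v | ∃ x ∈ a, ⟪v, x⟫_ℝ ≠ ⟪f, x⟫_ℝ}
  have hU₁ : IsOpen U₁ := by
    have : U₁ = ⋃ u ∈ D.centralizer a, {v | ⟪D.ad h v, D.ad h u⟫_ℝ ≠ 0} := by
      ext v; simp [U₁]
    rw [this]
    exact isOpen_biUnion fun u _ => isOpen_ne_fun (by fun_prop) continuous_const
  have hU₂ : IsOpen U₂ := by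
    refine hF.isOpen_biInter fun f _ => ?_
    have : {v : V | ∃ x ∈ a, ⟪v, x⟫_ℝ ≠ ⟪f, x⟫_ℝ} = ⋃ x ∈ a, {v | ⟪v, x⟫_ℝ ≠ ⟪f, x⟫_ℝ} := by
      ext v; simp
    rw [this]
    exact isOpen_biUnion fun u _ => isOpen_ne_fun (by fun_prop) continuous_const
  refine ⟨U₁ ∩ U₂, hU₁.inter hU₂, ?_, ?_, ?_⟩
  · rintro g hg v ⟨⟨u, hu, huv⟩, hv⟩
    have hfix : ∀ x ∈ a, D.Ad g x = x := fun x hx => Ad_eq_self hT ht (H.le hx) hg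
    refine ⟨⟨D.Ad g u, Ad_mem_centralizer hu hfix, ?_⟩, ?_⟩
    · have h1 := fun w => D.Ad_ad g h w
      rw [Ad_eq_self hT ht H.mem hg] at h1
      rw [← h1, ← h1, D.inner_Ad]
      exact huv
    · refine Set.mem_iInter₂.2 fun f hf => ?_
      obtain ⟨x, hx, hne⟩ := Set.mem_iInter₂.1 hv f hf
      exact ⟨x, hx, by rwa [inner_Ad_of_fixed (hfix x hx)]⟩
  · rintro v ⟨hv, hvt⟩
    refine ⟨⟨v, hv.1, fun h0 => hvt ?_⟩, Set.mem_iInter₂.2 fun f hf => ?_⟩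
    · exact mem_of_mem_centralizer hT ht H hv.1 (inner_self_eq_zero.1 h0)
    · obtain ⟨-, x, hx, hne⟩ := hf
      exact ⟨x, hx, by rwa [hv.2.1 x hx]⟩
  · rintro v hvO ⟨⟨u, hu, huv⟩, hv2⟩ hv
    -- If `y + c h` kills `v`, pair `[y, v] + c [h, v] = 0` with `[h, u]`. The first term vanishes
    -- because `[h, u]` centralizes `a`, so `c = 0` by the choice of `U₁`.
    have hle : D.isotropy t v ≤ a := by
      intro x hx
      obtain ⟨y, hy, c, rfl⟩ := H.exists_eq x hx.1
      by_cases hc : c = 0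
      · simpa [hc] using hy
      refine absurd ?_ huv
      have h1 := hx.2
      rw [map_add, map_smul, add_apply, smul_apply] at h1
      have h2 : D.ad y (D.ad h u) = 0 :=
        ad_mem_centralizer (fun x hx => ad_eq_zero hT ht (H.le hx) H.mem) hu y hy
      have h3 := congrArg (fun w => ⟪w, D.ad h u⟫_ℝ) h1
      rw [inner_add_left, D.inner_ad_left, h2, inner_zero_right, neg_zero, zero_add,
        real_inner_smul_left, inner_zero_left] at h3
      exact (mul_eq_zero.1 h3).resolve_left hc
    have heq : D.isotropy t v = a := Submodule.eq_of_le_of_finrank_eq hle (by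
      have := IsUnitNormal.finrank_add_one H
      omega)
    have hva : v ∈ D.centralizer a := heq ▸ D.mem_centralizer_isotropy t v
    have hvt : v ∉ t := by
      obtain ⟨-, -, h1⟩ := exists_wall hT ht hv
      exact h1
    refine ⟨⟨hva, ?_, ?_⟩, hvt⟩
    -- `v` has the projection `q` of a pole that lies in the orbit and in `t`; were it different
    -- from `p`, the pole would belong to `F`, against `v ∈ U₂`.
    · obtain ⟨q, hq, s, hs, hvq, ⟨g, hg⟩, -⟩ := exists_rootSphere hT ht H hva hvt
      by_contra hcon
      push Not at hcon
      obtain ⟨x, hx, hvx⟩ := hcon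
      have hfF : q + s • h ∈ F := by
        refine ⟨⟨?_, t.add_mem (H.le hq) (t.smul_mem _ H.mem)⟩, x, hx, ?_⟩
        · obtain ⟨k, rfl⟩ := hvO
          exact ⟨g * k, by rw [← hg, ← mul_apply_eq_comp, ← map_mul]⟩
        · rw [H.inner_add_smul_of_mem _ _ hx, ← hvq.2.1 x hx]
          exact hvx.symm
      obtain ⟨y, hy, hvy⟩ := Set.mem_iInter₂.1 hv2 _ hfF
      rw [H.inner_add_smul_of_mem _ _ hy] at hvy
      exact hvy (hvq.2.1 y hy)
    · obtain ⟨w, hw⟩ := hne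
      obtain ⟨k, rfl⟩ := hvO
      obtain ⟨k', rfl⟩ := hS hw
      rw [← hw.1.2.2]
      simp only [D.norm_Ad]

end Isotropy

/-! ### Edges in the orbit space as images of root spheres -/

section OrbitSpace

variable {G V : Type*} [Group G] [TopologicalSpace G] [NormedAddCommGroup V]
  [InnerProductSpace ℝ V] [FiniteDimensional ℝ V] {D : AdjointData G V} {T : Subgroup G}
  {a t : Submodule ℝ V} {h : V} {M : Type*} [TopologicalSpace M] [MulAction T M] {Φ : M → V}

variable (T) in
/-- The image in `M/T` of a subset of the Lie algebra. -/
def orbitImage (Φ : M → V) (S : Set V) : Set (OrbitSpace T M) :=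
  Quotient.mk (MulAction.orbitRel T M) '' (Φ ⁻¹' S)

theorem mk_mem_orbitImage (hΦ : ∀ (g : T) m, Φ (g • m) = D.Ad g (Φ m)) {S : Set V}
    (hS : ∀ g ∈ T, ∀ v ∈ S, D.Ad g v ∈ S) {m : M} :
    Quotient.mk (MulAction.orbitRel T M) m ∈ orbitImage T Φ S ↔ Φ m ∈ S := by
  refine ⟨?_, fun hm => ⟨m, hm, rfl⟩⟩
  rintro ⟨m', hm', hmm⟩
  obtain ⟨g, rfl⟩ := (MulAction.orbitRel_apply.1 (Quotient.exact hmm) : m' ∈ MulAction.orbit T m)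
  have h1 := hS _ (T.inv_mem g.2) _ hm'
  dsimp only at h1
  rwa [hΦ, D.Ad_inv_apply] at h1

theorem preimage_orbitImage (hΦ : ∀ (g : T) m, Φ (g • m) = D.Ad g (Φ m)) {S : Set V}
    (hS : ∀ g ∈ T, ∀ v ∈ S, D.Ad g v ∈ S) :
    Quotient.mk (MulAction.orbitRel T M) ⁻¹' orbitImage T Φ S = Φ ⁻¹' S :=
  Set.ext fun _ => mk_mem_orbitImage hΦ hS

theorem isOpen_orbitImage (hc : Continuous Φ) (hΦ : ∀ (g : T) m, Φ (g • m) = D.Ad g (Φ m))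
    {S : Set V} (hS : ∀ g ∈ T, ∀ v ∈ S, D.Ad g v ∈ S) (hSo : IsOpen S) :
    IsOpen (orbitImage T Φ S) := by
  rw [← isQuotientMap_quotient_mk'.isOpen_preimage]
  exact (preimage_orbitImage hΦ hS).symm ▸ hSo.preimage hc

theorem isClosed_orbitImage (hc : Continuous Φ) (hΦ : ∀ (g : T) m, Φ (g • m) = D.Ad g (Φ m))
    {S : Set V} (hS : ∀ g ∈ T, ∀ v ∈ S, D.Ad g v ∈ S) (hSo : IsClosed S) :
    IsClosed (orbitImage T Φ S) := by
  rw [← isQuotientMap_quotient_mk'.isClosed_preimage]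
  exact (preimage_orbitImage hΦ hS).symm ▸ hSo.preimage hc

theorem orbitImage_mono {S S' : Set V} (h : S ⊆ S') : orbitImage T Φ S ⊆ orbitImage T Φ S' :=
  Set.image_mono (Set.preimage_mono h)

/-- The elements of the Lie algebra with isotropy of codimension `k` in `t`. -/
def stratum (D : AdjointData G V) (t : Submodule ℝ V) (k : ℕ) : Set V :=
  {v | Module.finrank ℝ (D.isotropy t v) + k = Module.finrank ℝ t}

variable [IsTopologicalGroup G] [CompactSpace G] [T2Space G]

theorem Ad_mem_rootSphere_of_mem (hT : IsCartanSubgroup T)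
    (ht : ∀ x, x ∈ t ↔ ∀ s, D.oneParam x s ∈ T) (H : IsUnitNormal a t h) (p : V) (r : ℝ) :
    ∀ g ∈ T, ∀ v ∈ D.rootSphere a p r, D.Ad g v ∈ D.rootSphere a p r :=
  fun _ hg _ hv => Ad_mem_rootSphere hv fun _ hx => Ad_eq_self hT ht (H.le hx) hg

theorem stratum_zero (hT : IsCartanSubgroup T) (ht : ∀ x, x ∈ t ↔ ∀ s, D.oneParam x s ∈ T) :
    D.stratum t 0 = t :=
  Set.ext fun _ => finrank_isotropy_eq_iff hT ht

theorem rootSphere_diff_subset_stratum (hT : IsCartanSubgroup T)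
    (ht : ∀ x, x ∈ t ↔ ∀ s, D.oneParam x s ∈ T) (H : IsUnitNormal a t h) (p : V) (r : ℝ) :
    D.rootSphere a p r \ t ⊆ D.stratum t 1 := by
  intro v hv
  change _ = _
  rw [isotropy_eq_of_mem hT ht H hv.1.1 hv.2, IsUnitNormal.finrank_add_one H]

/-- A subset which is preconnected and relatively clopen is a connected component. -/
theorem _root_.connectedComponentIn_eq_of_isClopen {X : Type*} [TopologicalSpace X]
    {s C U F : Set X} {x : X} (hx : x ∈ C) (hC : IsPreconnected C) (hCs : C ⊆ s) (hU : IsOpen U)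
    (hF : IsClosed F) (hCU : C ⊆ U) (hCF : s ∩ F ⊆ C) (hUC : s ∩ U ⊆ F) :
    connectedComponentIn s x = C := by
  refine Set.Subset.antisymm ?_ (hC.subset_connectedComponentIn hx hCs)
  have hsub := connectedComponentIn_subset s x
  intro y hy
  by_contra hyC
  -- A point outside `C` would let `U` and `Fᶜ` disconnect the component: they cover it, both meet
  -- it, and they are disjoint on `s`.
  have h1 := isPreconnected_connectedComponentIn (x := x) (F := s) U Fᶜ hU hF.isOpen_compl
    (fun z hz => ?_) ⟨x, mem_connectedComponentIn (hCs hx), hCU hx⟩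
    ⟨y, hy, fun hyF => hyC (hCF ⟨hsub hy, hyF⟩)⟩
  · obtain ⟨z, hz, hzU, hzF⟩ := h1
    exact hzF (hUC ⟨hsub hz, hzU⟩)
  · by_cases hzF : z ∈ F
    · exact Or.inl (hCU (hCF ⟨hsub hz, hzF⟩))
    · exact Or.inr hzF

variable {ξ : V}

/-- The components of the set of one-dimensional orbits are images of root spheres. -/
theorem exists_connectedComponentIn_eq (hT : IsCartanSubgroup T)
    (ht : ∀ x, x ∈ t ↔ ∀ s, D.oneParam x s ∈ T) (hi : Topology.IsEmbedding Φ)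
    (hr : Set.range Φ = Set.range fun g => D.Ad g ξ)
    (hΦ : ∀ (g : T) m, Φ (g • m) = D.Ad g (Φ m)) {x : OrbitSpace T M}
    (hx : x ∈ orbitImage T Φ (D.stratum t 1)) :
    ∃ (a : Submodule ℝ V) (h p : V) (r : ℝ), IsUnitNormal a t h ∧ p ∈ a ∧ 0 < r ∧
      (D.rootSphere a p r \ t).Nonempty ∧ D.rootSphere a p r ⊆ Set.range Φ ∧
      connectedComponentIn (orbitImage T Φ (D.stratum t 1)) x =
        orbitImage T Φ (D.rootSphere a p r \ t) := by
  obtain ⟨m, hm, rfl⟩ := hx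
  obtain ⟨h, H, hmt⟩ := exists_wall hT ht hm
  set a := D.isotropy t (Φ m) with ha
  obtain ⟨p, hp, r, hr0, hmS, ⟨g, hg⟩, ⟨g', hg'⟩⟩ :=
    exists_rootSphere hT ht H (D.mem_centralizer_isotropy t (Φ m)) hmt
  obtain ⟨k, hk⟩ : Φ m ∈ Set.range fun g => D.Ad g ξ := hr ▸ Set.mem_range_self m
  dsimp only at hk
  have hsub : D.rootSphere a p r ⊆ Set.range fun g => D.Ad g ξ :=
    rootSphere_subset hT ht H hp
      ⟨g * k, by dsimp only; rw [map_mul, mul_apply_eq_comp, hk, hg]⟩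
      ⟨g' * k, by dsimp only; rw [map_mul, mul_apply_eq_comp, hk, hg']⟩
  have hne : (D.rootSphere a p r \ t).Nonempty := ⟨Φ m, hmS, hmt⟩
  refine ⟨a, h, p, r, H, hp, hr0, hne, hr ▸ hsub, ?_⟩
  obtain ⟨U, hU, hTU, hSU, hUS⟩ :=
    exists_isOpen_rootSphere hT ht H (Set.sdiff_subset.trans hsub) hne
  refine connectedComponentIn_eq_of_isClopen ⟨m, ⟨hmS, hmt⟩, rfl⟩ ?_
    (orbitImage_mono (rootSphere_diff_subset_stratum hT ht H p r))
    (isOpen_orbitImage hi.continuous hΦ hTU hU)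
    (isClosed_orbitImage hi.continuous hΦ (Ad_mem_rootSphere_of_mem hT ht H p r)
      (D.isClosed_rootSphere a p r)) (orbitImage_mono hSU) ?_ ?_
  · refine IsPreconnected.image ?_ _ continuous_quotient_mk'.continuousOn
    rw [← hi.isInducing.isPreconnected_image, Set.image_preimage_eq_of_subset
      (hr ▸ Set.sdiff_subset.trans hsub)]
    exact isPreconnected_rootSphere_diff H hT ht hp hr0
  · rintro _ ⟨⟨m', hm', rfl⟩, hF⟩
    rw [mk_mem_orbitImage hΦ (Ad_mem_rootSphere_of_mem hT ht H p r)] at hF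
    obtain ⟨-, -, hmt'⟩ := exists_wall hT ht hm'
    exact ⟨m', ⟨hF, hmt'⟩, rfl⟩
  · rintro _ ⟨⟨m', hm', rfl⟩, hF⟩
    rw [mk_mem_orbitImage hΦ hTU] at hF
    exact ⟨m', (hUS _ (hr ▸ Set.mem_range_self m') hF hm').1, rfl⟩

/-- The zero-dimensional orbits in the closure of the image of a root sphere are its poles. -/
theorem closure_inter_eq (hT : IsCartanSubgroup T)
    (ht : ∀ x, x ∈ t ↔ ∀ s, D.oneParam x s ∈ T) (hi : Topology.IsEmbedding Φ)
    (hΦ : ∀ (g : T) m, Φ (g • m) = D.Ad g (Φ m))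
    (H : IsUnitNormal a t h) {p : V} (hp : p ∈ a) {r : ℝ} (hr : 0 < r)
    (hne : (D.rootSphere a p r \ t).Nonempty) (hS : D.rootSphere a p r ⊆ Set.range Φ) :
    closure (orbitImage T Φ (D.rootSphere a p r \ t)) ∩ orbitImage T Φ (D.stratum t 0) =
      orbitImage T Φ {p + r • h, p - r • h} := by
  have hpole := pole_mem_rootSphere hT ht H hp r
  have hclos : ∀ {h}, IsUnitNormal a t h → ∀ m, Φ m = p + r • h →
      Quotient.mk (MulAction.orbitRel T M) m ∈
        closure (orbitImage T Φ (D.rootSphere a p r \ t)) := by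
    intro h H m hm
    refine image_closure_subset_closure_image continuous_quotient_mk' ⟨m, ?_, rfl⟩
    rw [hi.isInducing.closure_eq_preimage_closure_image, Set.image_preimage_eq_of_subset
      (Set.sdiff_subset.trans hS)]
    change Φ m ∈ closure _
    rw [hm]
    exact pole_mem_closure H hT ht hp hr hne
  apply Set.Subset.antisymm
  · rintro _ ⟨hC, m, hm, rfl⟩
    rw [stratum_zero hT ht] at hm
    have h1 := closure_minimal (orbitImage_mono Set.sdiff_subset)
      (isClosed_orbitImage hi.continuous hΦ (Ad_mem_rootSphere_of_mem hT ht H p r)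
      (D.isClosed_rootSphere a p r)) hC
    rw [mk_mem_orbitImage hΦ (Ad_mem_rootSphere_of_mem hT ht H p r)] at h1
    exact ⟨m, eq_pole_of_mem H hp h1 hm, rfl⟩
  · rintro _ ⟨m, hm, rfl⟩
    refine ⟨?_, m, ?_, rfl⟩
    · rcases hm with hm | hm
      · exact hclos H m hm
      · exact hclos H.neg m (by rw [hm]; module)
    · rw [Set.mem_preimage, stratum_zero hT ht]
      rcases hm with hm | hm <;> rw [hm]
      · exact t.add_mem (H.le hp) (t.smul_mem _ H.mem)
      · exact t.sub_mem (H.le hp) (t.smul_mem _ H.mem)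

theorem Ad_mem_of_subset (hT : IsCartanSubgroup T)
    (ht : ∀ x, x ∈ t ↔ ∀ s, D.oneParam x s ∈ T) {S : Set V} (hS : S ⊆ t) :
    ∀ g ∈ T, ∀ v ∈ S, D.Ad g v ∈ S :=
  fun _ hg v hv => (Ad_eq_self hT ht (hS hv) hg).symm ▸ hv

theorem pole_subset (H : IsUnitNormal a t h) {p : V} (hp : p ∈ a) (r : ℝ) :
    {p + r • h, p - r • h} ⊆ (t : Set V) := by
  rintro v (rfl | rfl)
  · exact t.add_mem (H.le hp) (t.smul_mem _ H.mem)
  · exact t.sub_mem (H.le hp) (t.smul_mem _ H.mem)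

/-- The closure of each component of the set of one-dimensional orbits contains exactly two
zero-dimensional orbits. -/
theorem exists_closure_inter_eq_pair (hT : IsCartanSubgroup T)
    (ht : ∀ x, x ∈ t ↔ ∀ s, D.oneParam x s ∈ T) (hi : Topology.IsEmbedding Φ)
    (hr : Set.range Φ = Set.range fun g => D.Ad g ξ)
    (hΦ : ∀ (g : T) m, Φ (g • m) = D.Ad g (Φ m)) {x : OrbitSpace T M}
    (hx : x ∈ orbitImage T Φ (D.stratum t 1)) : ∃ y z : OrbitSpace T M, y ≠ z ∧
      closure (connectedComponentIn (orbitImage T Φ (D.stratum t 1)) x) ∩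
        orbitImage T Φ (D.stratum t 0) = {y, z} := by
  obtain ⟨a, h, p, r, H, hp, hr0, hne, hS, hC⟩ :=
    exists_connectedComponentIn_eq hT ht hi hr hΦ hx
  rw [hC, closure_inter_eq hT ht hi hΦ H hp hr0 hne hS]
  obtain ⟨m, hm⟩ := hS (pole_mem_rootSphere hT ht H hp r)
  obtain ⟨m', hm'⟩ := hS (pole_mem_rootSphere hT ht H.neg hp r)
  rw [smul_neg, ← sub_eq_add_neg] at hm'
  have hmt : Φ m ∈ t := hm ▸ pole_subset H hp r (Set.mem_insert _ _)
  refine ⟨Quotient.mk _ m, Quotient.mk _ m', fun heq => ?_, ?_⟩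
  · have h1 : Quotient.mk _ m ∈ orbitImage T Φ {p - r • h} := heq ▸ ⟨m', hm', rfl⟩
    rw [mk_mem_orbitImage hΦ (Ad_mem_of_subset hT ht fun _ hv => pole_subset H hp r (Or.inr hv)),
      Set.mem_singleton_iff, hm, ← sub_eq_zero] at h1
    have h2 : (2 * r) • h = 0 := by rw [← h1]; module
    rcases smul_eq_zero.1 h2 with h3 | h3
    · linarith
    · exact H.ne_zero h3
  · have h1 : Φ ⁻¹' {p + r • h, p - r • h} = {m, m'} := by
      ext q
      rw [Set.mem_preimage, Set.mem_insert_iff, Set.mem_singleton_iff, ← hm, ← hm',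
        hi.injective.eq_iff, hi.injective.eq_iff]
      rfl
    rw [orbitImage, h1, Set.image_pair]

/-- `Ad(T)` is trivial on `t`, so subsets of `t` are invariant and are recovered from their images
in the orbit space. -/
theorem eq_of_orbitImage_eq (hT : IsCartanSubgroup T)
    (ht : ∀ x, x ∈ t ↔ ∀ s, D.oneParam x s ∈ T) (hΦ : ∀ (g : T) m, Φ (g • m) = D.Ad g (Φ m))
    {S S' : Set V} (hS : S ⊆ t) (hS' : S' ⊆ t) (hSr : S ⊆ Set.range Φ) (hSr' : S' ⊆ Set.range Φ)
    (heq : orbitImage T Φ S = orbitImage T Φ S') : S = S' := by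
  have h1 := preimage_orbitImage hΦ (Ad_mem_of_subset hT ht hS)
  rw [heq, preimage_orbitImage hΦ (Ad_mem_of_subset hT ht hS')] at h1
  rw [← Set.image_preimage_eq_of_subset hSr, ← h1, Set.image_preimage_eq_of_subset hSr']

/-- A component of the set of one-dimensional orbits is determined by the zero-dimensional orbits
in its closure. -/
theorem connectedComponentIn_eq_of_closure_inter_eq (hT : IsCartanSubgroup T)
    (ht : ∀ x, x ∈ t ↔ ∀ s, D.oneParam x s ∈ T) (hi : Topology.IsEmbedding Φ)
    (hr : Set.range Φ = Set.range fun g => D.Ad g ξ)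
    (hΦ : ∀ (g : T) m, Φ (g • m) = D.Ad g (Φ m)) {x x' : OrbitSpace T M}
    (hx : x ∈ orbitImage T Φ (D.stratum t 1)) (hx' : x' ∈ orbitImage T Φ (D.stratum t 1))
    (heq : closure (connectedComponentIn (orbitImage T Φ (D.stratum t 1)) x) ∩
        orbitImage T Φ (D.stratum t 0) =
      closure (connectedComponentIn (orbitImage T Φ (D.stratum t 1)) x') ∩
        orbitImage T Φ (D.stratum t 0)) :
    connectedComponentIn (orbitImage T Φ (D.stratum t 1)) x =
      connectedComponentIn (orbitImage T Φ (D.stratum t 1)) x' := by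
  obtain ⟨a, h, p, r, H, hp, hr0, hne, hS, hC⟩ :=
    exists_connectedComponentIn_eq hT ht hi hr hΦ hx
  obtain ⟨a', h', p', r', H', hp', hr0', hne', hS', hC'⟩ :=
    exists_connectedComponentIn_eq hT ht hi hr hΦ hx'
  have hpr : ∀ {a : Submodule ℝ V} {h p : V} {r : ℝ}, IsUnitNormal a t h → p ∈ a →
      D.rootSphere a p r ⊆ Set.range Φ → {p + r • h, p - r • h} ⊆ Set.range Φ := by
    rintro a h p r H hp hS v (rfl | rfl)
    · exact hS (pole_mem_rootSphere hT ht H hp r)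
    · have := hS (pole_mem_rootSphere hT ht H.neg hp r)
      rwa [smul_neg, ← sub_eq_add_neg] at this
  rw [hC, hC'] at heq ⊢
  rw [closure_inter_eq hT ht hi hΦ H hp hr0 hne hS,
    closure_inter_eq hT ht hi hΦ H' hp' hr0' hne' hS'] at heq
  have h1 := eq_of_orbitImage_eq hT ht hΦ (pole_subset H hp r) (pole_subset H' hp' r')
    (hpr H hp hS) (hpr H' hp' hS') heq
  -- The sum of the poles is `2p`; what remains of the pair fixes `r h` up to sign.
  have h2 : p = p' ∧ (r • h = r' • h' ∨ r • h = r' • -h') := by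
    rcases Set.pair_eq_pair_iff.1 h1 with ⟨h2, h3⟩ | ⟨h2, h3⟩
    · have h4 : (2 : ℝ) • p = (2 : ℝ) • p' := 
        calc (2 : ℝ) • p = (p + r • h) + (p - r • h) := by module
          _ = (2 : ℝ) • p' := by rw [h2, h3]; module
      have h5 : p = p' := smul_right_injective V (two_ne_zero (α := ℝ)) h4
      subst h5
      exact ⟨rfl, Or.inl (add_left_cancel h2)⟩
    · have h4 : (2 : ℝ) • p = (2 : ℝ) • p' := 
        calc (2 : ℝ) • p = (p + r • h) + (p - r • h) := by module
          _ = (2 : ℝ) • p' := by rw [h2, h3]; module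
      have h5 : p = p' := smul_right_injective V (two_ne_zero (α := ℝ)) h4
      subst h5
      rw [sub_eq_add_neg, ← smul_neg] at h2
      exact ⟨rfl, Or.inr (add_left_cancel h2)⟩
  obtain ⟨rfl, h3⟩ := h2
  -- Norms give `r = r'`, hence equal normals, and a hyperplane of `t` is determined by its normal.
  have key : ∀ {h'}, IsUnitNormal a' t h' → r • h = r' • h' → a = a' ∧ r = r' := by
    intro h' H' h3
    have h4 := congrArg norm h3
    rw [norm_smul, norm_smul, H.norm_eq, H'.norm_eq, mul_one, mul_one, Real.norm_of_nonneg hr0.le,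
      Real.norm_of_nonneg hr0'.le] at h4
    subst h4
    obtain rfl : h = h' := smul_right_injective V hr0.ne' h3
    exact ⟨Submodule.ext fun x => H.mem_iff.trans H'.mem_iff.symm, rfl⟩
  obtain ⟨rfl, rfl⟩ : a = a' ∧ r = r' := h3.elim (key H') (key H'.neg)
  rfl

end OrbitSpace

end AdjointData

/-! ### The homogeneous space as an adjoint orbit -/

section AdjointOrbit

variable {E : Type*} [NormedAddCommGroup E] [NormedSpace ℝ E] [FiniteDimensional ℝ E]
  {G : Type*} [TopologicalSpace G] [ChartedSpace E G] [Group G] [LieGroup 𝓘(ℝ, E) ∞ G]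
  {V : Type*} [NormedAddCommGroup V] [InnerProductSpace ℝ V] [FiniteDimensional ℝ V]
  {D : AdjointData G V} {e : E ≃L[ℝ] V} {T : Subgroup G}

/-- The Lie algebra of a subgroup, transported to `V`. -/
def modelLieAlgebra (e : E ≃L[ℝ] V) (H : Subgroup G) : Submodule ℝ V :=
  Submodule.map e.toLinearEquiv.toLinearMap (subgroupLieAlgebra E H : Submodule ℝ E)

theorem finrank_modelLieAlgebra (e : E ≃L[ℝ] V) (H : Subgroup G) :
    Module.finrank ℝ (modelLieAlgebra e H) = Module.finrank ℝ (subgroupLieAlgebra E H) :=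
  e.toLinearEquiv.finrank_map_eq (subgroupLieAlgebra E H : Submodule ℝ E)

theorem mem_modelLieAlgebra_iff [T2Space G] (hinj : Function.Injective (bracketModel E G))
    (he : ∀ x, D.oneParam (e x) = oneParam G x) {H : Subgroup G}
    (hH : ∀ x ∈ H, ∀ y ∈ H, x * y = y * x) (x : V) :
    x ∈ modelLieAlgebra e H ↔ ∀ s, D.oneParam x s ∈ H := by
  obtain ⟨y, rfl⟩ := e.surjective x
  rw [he]
  refine Iff.trans ?_ (mem_subgroupLieAlgebra_iff hinj hH y)
  exact Function.Injective.mem_set_image (s := {v : E | v ∈ subgroupLieAlgebra E H}) e.injective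

/-- The stabilizer of `m` in `T` is the stabilizer of `Φ m` under `Ad`, and `exp(sx)` fixes `Φ m`
for all `s` exactly when `[x, Φ m] = 0`. So the Lie algebra of the stabilizer is the infinitesimal
isotropy. -/
theorem orbitsOfDim_eq_orbitImage [T2Space G] (hinj : Function.Injective (bracketModel E G))
    (he : ∀ x, D.oneParam (e x) = oneParam G x) (hT : IsCartanSubgroup T)
    {M : Type*} [TopologicalSpace M] [MulAction T M] {Φ : M → V} (hi : Function.Injective Φ)
    (hΦ : ∀ (g : T) m, Φ (g • m) = D.Ad g (Φ m)) (k : ℕ) :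
    orbitsOfDim E T M k =
      AdjointData.orbitImage T Φ (D.stratum (modelLieAlgebra e T) k) := by
  have hmem : ∀ m g, g ∈ (MulAction.stabilizer T m).map T.subtype ↔
      g ∈ T ∧ D.Ad g (Φ m) = Φ m := by
    intro m g
    constructor
    · rintro ⟨g, hg, rfl⟩
      exact ⟨g.2, by rw [Subgroup.subtype_apply, ← hΦ, MulAction.mem_stabilizer_iff.1 hg]⟩
    · rintro ⟨hg, hgm⟩
      exact ⟨⟨g, hg⟩, MulAction.mem_stabilizer_iff.2 (hi (by rw [hΦ, hgm])), rfl⟩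
  have hiso : ∀ m, modelLieAlgebra e ((MulAction.stabilizer T m).map T.subtype) =
      D.isotropy (modelLieAlgebra e T) (Φ m) := by
    intro m
    ext x
    rw [mem_modelLieAlgebra_iff hinj he (fun x hx y hy =>
      hT.1.mul_comm x ((hmem m x).1 hx).1 y ((hmem m y).1 hy).1)]
    change _ ↔ x ∈ modelLieAlgebra e T ∧ D.ad x (Φ m) = 0
    rw [mem_modelLieAlgebra_iff hinj he hT.1.mul_comm]
    simp only [hmem, forall_and]
    exact and_congr_right fun _ => ⟨D.ad_eq_zero_of_Ad_oneParam_apply,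
      D.Ad_oneParam_apply_of_ad_eq_zero⟩
  ext x
  refine exists_congr fun m => and_comm.trans (and_congr_left fun _ => ?_)
  change _ ↔ _ = _
  rw [← hiso, finrank_modelLieAlgebra, finrank_modelLieAlgebra]

theorem mem_adjointStabilizer_iff (he : ∀ g v, D.Ad g (e v) = e (adModel E g v)) (ξ : E) (g : G) :
    g ∈ adjointStabilizer (E := E) (G := G) ξ ↔ D.Ad g (e ξ) = e ξ := by
  rw [he, e.injective.eq_iff]
  rfl

/-- The identification of `G/K` with the orbit of an element with stabilizer `K`. -/
def AdjointData.orbitMap (D : AdjointData G V) {K : Subgroup G} {ξ : V}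
    (hK : ∀ g, g ∈ K ↔ D.Ad g ξ = ξ) (q : G ⧸ K) : V :=
  Quotient.liftOn' q (fun g => D.Ad g ξ) fun a b hab => by
    have h1 := (hK _).1 (QuotientGroup.leftRel_apply.1 hab)
    rw [map_mul, mul_apply_eq_comp] at h1
    conv_lhs => rw [← h1, D.Ad_apply_inv]

theorem AdjointData.orbitMap_mk {K : Subgroup G} {ξ : V}
    (hK : ∀ g, g ∈ K ↔ D.Ad g ξ = ξ) (g : G) : D.orbitMap hK (g : G ⧸ K) = D.Ad g ξ := rfl

theorem AdjointData.range_orbitMap {K : Subgroup G} {ξ : V} (hK : ∀ g, g ∈ K ↔ D.Ad g ξ = ξ) :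
    Set.range (D.orbitMap hK) = Set.range fun g => D.Ad g ξ :=
  (QuotientGroup.mk_surjective.range_comp (D.orbitMap hK)).symm

/-- A continuous injection from a compact space into a Hausdorff space. -/
theorem AdjointData.isEmbedding_orbitMap [CompactSpace G] {K : Subgroup G} {ξ : V}
    (hK : ∀ g, g ∈ K ↔ D.Ad g ξ = ξ) : Topology.IsEmbedding (D.orbitMap hK) := by
  have hc : Continuous (D.orbitMap hK) :=
    (D.continuous_Ad.clm_apply continuous_const).quotient_liftOn' _
  have hi : Function.Injective (D.orbitMap hK) := by
    intro p q hpq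
    obtain ⟨a, rfl⟩ := QuotientGroup.mk_surjective p
    obtain ⟨b, rfl⟩ := QuotientGroup.mk_surjective q
    rw [D.orbitMap_mk, D.orbitMap_mk] at hpq
    refine QuotientGroup.eq.2 ((hK _).2 ?_)
    rw [map_mul, mul_apply_eq_comp, ← hpq, D.Ad_inv_apply]
  exact (hc.isClosedEmbedding hi).isEmbedding

theorem AdjointData.orbitMap_smul {K : Subgroup G} {ξ : V}
    (hK : ∀ g, g ∈ K ↔ D.Ad g ξ = ξ) (g : T) (q : G ⧸ K) :
    D.orbitMap hK (g • q) = D.Ad g (D.orbitMap hK q) := by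
  obtain ⟨a, rfl⟩ := QuotientGroup.mk_surjective q
  change D.Ad (g * a) ξ = D.Ad g (D.Ad a ξ)
  rw [map_mul]
  rfl

end AdjointOrbit

end

theorem mainTheorem9
    {E : Type*} [NormedAddCommGroup E] [NormedSpace ℝ E] [FiniteDimensional ℝ E]
    {G : Type*} [TopologicalSpace G] [ChartedSpace E G] [Group G] [LieGroup 𝓘(ℝ, E) ∞ G]
    [T2Space G] [CompactSpace G] [ConnectedSpace G]
    (hG : IsSemisimpleLieGroup E G)
    (T : Subgroup G) (hT : IsCartanSubgroup T)
    (ξ : GroupLieAlgebra 𝓘(ℝ, E) G) (hξ : ξ ∈ subgroupLieAlgebra E T) :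
    (∀ C, IsOneDimComponent E T (G ⧸ adjointStabilizer ξ) C →
      C ∈ (gkmGraph E T (G ⧸ adjointStabilizer ξ)).edgeSet) ∧
    (gkmGraph E T (G ⧸ adjointStabilizer ξ)).Simple := by
  have : IsTopologicalGroup G := topologicalGroup_of_lieGroup 𝓘(ℝ, E) ∞
  obtain ⟨D, e, he, he'⟩ := exists_adjointData (E := E) (G := G) hG
  have ht := mem_modelLieAlgebra_iff (D := D) (e := e) (injective_bracketModel hG) he' hT.1.mul_comm
  have hK := mem_adjointStabilizer_iff he (ξ : E)
  have hi := D.isEmbedding_orbitMap hK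
  have hr := D.range_orbitMap hK
  have hΦ := D.orbitMap_smul (T := T) hK
  have hdim := orbitsOfDim_eq_orbitImage (injective_bracketModel hG) he' hT hi.injective hΦ
  have key : ∀ C, IsOneDimComponent E T (G ⧸ adjointStabilizer ξ) C → ∃ x y, x ≠ y ∧
      closure C ∩ orbitsOfDim E T (G ⧸ adjointStabilizer ξ) 0 = {x, y} := by
    rintro _ ⟨x, hx, rfl⟩
    rw [hdim] at hx ⊢
    rw [hdim]
    exact D.exists_closure_inter_eq_pair hT ht hi hr hΦ hx
  refine ⟨fun C hC => ?_, ?_⟩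
  · obtain ⟨x, y, -, hxy⟩ := key C hC
    exact ⟨x, y, hC, hxy⟩
  · refine { not_isLoopAt := ?_, eq_of_isLink := ?_ }
    · rintro C x ⟨hC, hx⟩
      obtain ⟨y, z, hyz, h⟩ := key C hC
      have hy : y ∈ ({x, x} : Set (OrbitSpace T (G ⧸ adjointStabilizer ξ))) := by
        rw [← hx, h]; exact Set.mem_insert _ _
      have hz : z ∈ ({x, x} : Set (OrbitSpace T (G ⧸ adjointStabilizer ξ))) := by
        rw [← hx, h]; exact Set.mem_insert_of_mem _ rfl
      rw [Set.pair_eq_singleton] at hy hz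
      exact hyz (hy.trans hz.symm)
    · rintro C C' x y ⟨⟨p, hp, rfl⟩, h⟩ ⟨⟨p', hp', rfl⟩, h'⟩
      have heq := h.trans h'.symm
      rw [hdim] at hp hp' heq ⊢
      rw [hdim] at heq
      exact AdjointData.connectedComponentIn_eq_of_closure_inter_eq hT ht hi hr hΦ hp hp' heq
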